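/- Let $\mathbb H$ be the quaternions, $\mathbb S=\{j\in\mathbb H:\ \mathrm{Re}\,j=0,\ |j|=1\}$ and $\mathbb C_j=\mathbb R+j\mathbb R$ for $j\in\mathbb S$. A set $U\subseteq\mathbb H$ is axially symmetric if $u+jv\in U$ for some $j\in\mathbb S$ implies $u+iv\in U$ for all $i\in\mathbb S$. Let $\mathcal X$ be a left (for example two-sided) quaternionic Banach space. A function $f:U\to\mathcal X$ on an axially symmetric set is a *left slice function* if $f(u+jv)=f_0(u,v)+jf_1(u,v)$ for all $j\in\mathbb S$ and all $u,v\in\mathbb R$ with $u+jv\in U$, where $f_0,f_1$ are $\mathcal X$-valued, $f_0$ is even and $f_1$ is odd in $v$. It is *left slice continuous* if $f_0,f_1$ can be chosen continuous and, for $U$ open, *left slice hyperholomorphic* if they can be chosen real differentiable with $\partial_vf_0+\partial_uf_1=0$ and $\partial_uf_0-\partial_vf_1=0$. If $V$ is open and axially symmetric and $\mathbb H\setminus V$ is bounded, $f:V\cup\{\infty\}\to\mathcal X$ is left slice hyperholomorphic if $f$ is so on $V$ and $p\mapsto f(1/p)$ is so on $\{p\neq0:\ 1/p\in V\}\cup\{0\}$,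 with $1/0=\infty$. Let $U_+\subset\mathbb H$ be a bounded axially symmetric open set and $U_-=\mathbb H\setminus\overline{U_+}$. Assume that for $j\in\mathbb S$ the boundary $\partial(U_+\cap\mathbb C_j)$, taken in $\mathbb C_j$, is a closed piecewise $\mathcal C^1$ contour bounding $U_+\cap\mathbb C_j$, that is, a union of finitely many pairwise disjoint simple closed piecewise $\mathcal C^1$ curves, with nonvanishing one-sided derivatives and without cusps, oriented so that at every smooth point $U_+\cap\mathbb C_j$ lies on the left and $U_-\cap\mathbb C_j$ on the right. (By axial symmetry this holds for all $j\in\mathbb S$ as soon as it holds for one.) Let $f:\partial U_+\to\mathcal X$ be left slice continuous. For $j\in\mathbb S$ let $$\hat f(p)=\frac1{2\pi}\int_{\partial(U_+\cap\mathbb C_j)}S_L^{-1}(s,p)\,ds_j\,f(s),\quad p\in\mathbb H\setminus\partial U_+,\qquad \hat f(\infty)=0,$$ where $S_L^{-1}(s,p)=-(p^2-2p\,\mathrm{Re}(s)+|s|^2)^{-1}(p-\overline s)$ and $ds_j=-j\,ds$, and put $\hat f_+=\hat f|_{U_+}$, $\hat f_-=\hat f|_{U_-\cup\{\infty\}}$.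 A *splitting* of $f$ with respect to $\partial U_+$ is a pair of functions $f_+:\overline{U_+}\to\mathcal X$, $f_-:\overline{U_-}\cup\{\infty\}\to\mathcal X$ such that $f_+$ is left slice continuous on $\overline{U_+}$ and left slice hyperholomorphic in $U_+$, $f_-$ is left slice continuous on $\overline{U_-}$ and left slice hyperholomorphic in $U_-\cup\{\infty\}$, and $f=f_++f_-$ on $\partial U_+$. We say that $f$ *splits* if it has a splitting. **Theorem.** For every $j\in\mathbb S$ the following are equivalent: (i) $f$ splits with respect to $\partial U_+$; (ii) $\hat f_+$ admits a continuous extension to $\overline{U_+}$ and $\hat f_-$ admits a continuous extension to $\overline{U_-}$. Moreover, in this case, with the same symbols denoting the extensions, the pair $(\hat f_+,-\hat f_-)$ is a splitting of $f$ that vanishes at infinity, in particular $f=\hat f_++(-\hat f_-)$ on $\partial U_+$, and it is the only splitting $(f_+,f_-)$ of $f$ with $f_-(\infty)=0$. -/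

import Mathlib

open scoped Quaternion Topology OnePoint

noncomputable section

namespace SliceHyper

/-- The sphere `𝕊` of imaginary units of the quaternions. -/
def imagUnits : Set ℍ := {j | j.re = 0 ∧ ‖j‖ = 1}

/-- The point `u + j v` of `ℂ_j` with coordinates `z = (u, v) ∈ ℝ × ℝ ≃ ℂ`. -/
def slicePt (j : ℍ) (z : ℂ) : ℍ := (z.re : ℍ) + j * (z.im : ℍ)

/-- The sphere `[q] = {Re q + j |Im q| : j ∈ 𝕊}`. -/
def sphereOf (q : ℍ) : Set ℍ := {p | ∃ j ∈ imagUnits, p = (q.re : ℍ) + j * ((‖q.im‖ : ℝ) : ℍ)}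

/-- Axially symmetric sets. -/
def AxiallySymmetric (U : Set ℍ) : Prop := ∀ q ∈ U, sphereOf q ⊆ U

/-- The slice `U ∩ ℂ_j`, read in the coordinates `(u, v)` of `ℂ_j`. -/
def slice (U : Set ℍ) (j : ℍ) : Set ℂ := {z | slicePt j z ∈ U}

/-- The set of all `(u, v)` with `u + j v ∈ U` for every `j ∈ 𝕊`. -/
def sliceBase (U : Set ℍ) : Set ℂ := {z | ∀ j ∈ imagUnits, slicePt j z ∈ U}

section Functions

variable {X : Type*} [NormedAddCommGroup X] [NormedSpace ℝ X] [Module ℍ X]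

/-- `f (u + j v) = f₀ (u, v) + j f₁ (u, v)` on `U`, with `f₀` even and `f₁` odd in `v`. -/
structure IsLeftSliceRep (U : Set ℍ) (f : ℍ → X) (f₀ f₁ : ℂ → X) : Prop where
  even : ∀ z ∈ sliceBase U, f₀ (star z) = f₀ z
  odd : ∀ z ∈ sliceBase U, f₁ (star z) = -f₁ z
  eq : ∀ z ∈ sliceBase U, ∀ j ∈ imagUnits, f (slicePt j z) = f₀ z + j • f₁ z

/-- Left slice continuous functions on an axially symmetric set
(open, closed, or the boundary of such a set). -/
def LeftSliceContinuousOn (f : ℍ → X) (U : Set ℍ) : Prop :=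
  ∃ f₀ f₁ : ℂ → X, IsLeftSliceRep U f f₀ f₁ ∧
    ContinuousOn f₀ (sliceBase U) ∧ ContinuousOn f₁ (sliceBase U)

/-- Left slice hyperholomorphic functions on an axially symmetric open set: `f₀`, `f₁` are real
differentiable and satisfy the Cauchy-Riemann equations
`∂ᵥ f₀ + ∂ᵤ f₁ = 0`, `∂ᵤ f₀ - ∂ᵥ f₁ = 0`. -/
def LeftSliceHyperholomorphicOn (f : ℍ → X) (U : Set ℍ) : Prop :=
  ∃ f₀ f₁ : ℂ → X, IsLeftSliceRep U f f₀ f₁ ∧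
    ∀ z ∈ sliceBase U, DifferentiableAt ℝ f₀ z ∧ DifferentiableAt ℝ f₁ z ∧
      fderiv ℝ f₀ z Complex.I + fderiv ℝ f₁ z 1 = 0 ∧
      fderiv ℝ f₀ z 1 - fderiv ℝ f₁ z Complex.I = 0

open Classical in
/-- `p ↦ 1 / p` as a map into the one-point compactification, with `1 / 0 = ∞`. -/
def invInfty (p : ℍ) : OnePoint ℍ := if p = 0 then ∞ else ((p⁻¹ : ℍ) : OnePoint ℍ)

/-- Left slice hyperholomorphic functions on `V ∪ {∞}`, where `ℍ ∖ V` is bounded: `f` is slice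
hyperholomorphic on `V` and `f (1 / p)` is so on `{p : 1 / p ∈ V} ∪ {0}`. -/
def LeftSliceHyperholomorphicOnInfty (f : OnePoint ℍ → X) (V : Set ℍ) : Prop :=
  LeftSliceHyperholomorphicOn (fun p : ℍ => f p) V ∧
    LeftSliceHyperholomorphicOn (fun p : ℍ => f (invInfty p)) ({p | p ≠ 0 ∧ p⁻¹ ∈ V} ∪ {0})

/-- The outer domain `U₋ = ℍ ∖ closure U₊`. -/
def outer (U : Set ℍ) : Set ℍ := (closure U)ᶜ

/-- `(fp, fm)` is an additive splitting of `f` with respect to the boundary of `U`. -/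
structure IsSplitting (f : ℍ → X) (U : Set ℍ) (fp : ℍ → X) (fm : OnePoint ℍ → X) : Prop where
  continuous_plus : LeftSliceContinuousOn fp (closure U)
  hyperholomorphic_plus : LeftSliceHyperholomorphicOn fp U
  continuous_minus : LeftSliceContinuousOn (fun p : ℍ => fm p) (closure (outer U))
  hyperholomorphic_minus : LeftSliceHyperholomorphicOnInfty fm (outer U)
  eq_add : ∀ q ∈ frontier U, f q = fp q + fm q

/-- `f` splits additively with respect to the boundary of `U`. -/
def Splits (f : ℍ → X) (U : Set ℍ) : Prop :=
  ∃ (fp : ℍ → X) (fm : OnePoint ℍ → X), IsSplitting f U fp fm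

/-- `F` is a continuous extension to the closure of `V` of the restriction of `g` to `V`. -/
def IsContinuousExtension (g : ℍ → X) (V : Set ℍ) (F : ℍ → X) : Prop :=
  ContinuousOn F (closure V) ∧ Set.EqOn F g V

end Functions

/-- A simple closed piecewise `C¹` curve in the plane, parametrized on `[t 0, t n]` with
break points `t 0 < ⋯ < t n`: nonvanishing (one-sided) derivatives on every closed piece, and no
cusps at the break points, the closing point included (the quotient of the two one-sided
derivatives is not in `(-∞, 0]`). -/
structure PwC1ClosedCurve where
  n : ℕ
  n_pos : 0 < n
  t : ℕ → ℝ
  t_lt : ∀ i < n, t i < t (i + 1)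
  γ : ℝ → ℂ
  continuousOn : ContinuousOn γ (Set.Icc (t 0) (t n))
  contDiffOn : ∀ i < n, ContDiffOn ℝ 1 γ (Set.Icc (t i) (t (i + 1)))
  deriv_ne_zero : ∀ i < n, ∀ x ∈ Set.Icc (t i) (t (i + 1)),
    derivWithin γ (Set.Icc (t i) (t (i + 1))) x ≠ 0
  no_cusp : ∀ i, i + 1 < n →
    derivWithin γ (Set.Icc (t i) (t (i + 1))) (t (i + 1)) /
      derivWithin γ (Set.Icc (t (i + 1)) (t (i + 2))) (t (i + 1)) ∈ Complex.slitPlane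
  closed : γ (t 0) = γ (t n)
  no_cusp_closing :
    derivWithin γ (Set.Icc (t (n - 1)) (t n)) (t n) /
      derivWithin γ (Set.Icc (t 0) (t 1)) (t 0) ∈ Complex.slitPlane
  injOn : Set.InjOn γ (Set.Ico (t 0) (t n))

/-- The point set of a curve. -/
def PwC1ClosedCurve.image (c : PwC1ClosedCurve) : Set ℂ := c.γ '' Set.Icc (c.t 0) (c.t c.n)

/-- The boundary of the plane set `D` is the piecewise `C¹` contour made of the pairwise disjoint
curves `Γ k`, each oriented in the usual way: at every smooth point, `D` lies on the left and the
exterior of `D` on the right. -/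
structure IsOrientedBoundary {N : ℕ} (Γ : Fin N → PwC1ClosedCurve) (D : Set ℂ) : Prop where
  disjoint : Pairwise fun k l => Disjoint (Γ k).image (Γ l).image
  frontier_eq : frontier D = ⋃ k, (Γ k).image
  left_right : ∀ k, ∀ i < (Γ k).n, ∀ x ∈ Set.Ioo ((Γ k).t i) ((Γ k).t (i + 1)),
    ∀ᶠ ε : ℝ in 𝓝[>] 0,
      (Γ k).γ x + ε * (Complex.I * deriv (Γ k).γ x) ∈ D ∧
      (Γ k).γ x - ε * (Complex.I * deriv (Γ k).γ x) ∈ (closure D)ᶜ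

/-- The Cauchy kernel `S_L⁻¹ (s, p) = -(p² - 2 p Re s + |s|²)⁻¹ (p - s̄)`. -/
def cauchyKernel (s p : ℍ) : ℍ :=
  -(p ^ 2 - 2 * p * (s.re : ℍ) + ((‖s‖ ^ 2 : ℝ) : ℍ))⁻¹ * (p - star s)

/-- The left Cauchy transform `(2π)⁻¹ ∫ S_L⁻¹ (s, p) ds_j f (s)`, `ds_j = -j ds`, where `s` runs
through the contour `Γ`, transported to `ℂ_j`. -/
def cauchyTransform {X : Type*} [NormedAddCommGroup X] [NormedSpace ℝ X] [Module ℍ X]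
    (j : ℍ) {N : ℕ} (Γ : Fin N → PwC1ClosedCurve) (f : ℍ → X) (p : ℍ) : X :=
  (2 * Real.pi)⁻¹ • ∑ k, ∫ x in ((Γ k).t 0)..((Γ k).t (Γ k).n),
    (cauchyKernel (slicePt j ((Γ k).γ x)) p * (-j * slicePt j (deriv (Γ k).γ x))) •
      f (slicePt j ((Γ k).γ x))

end SliceHyper

end

/-!
Fix `j ∈ 𝕊` and let `i ∈ ℂ` act on `X` as `j`, so that `X` is a complex Banach space. Put
`D = slice U j`, a plane set bounded by the contour `Γ`.

A slice function is determined by its restriction to `ℂ_j` (`SliceFormula`); it is slice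
hyperholomorphic exactly if this restriction is holomorphic
(`LeftSliceHyperholomorphicOn.differentiableOn`, `SliceFormula.leftSliceHyperholomorphicOn`), and
slice continuous on a closure exactly if it is continuous there
(`LeftSliceContinuousOn.continuousOn`, `SliceFormula.leftSliceContinuousOn_closure`). The kernel
`S_L⁻¹ (s, ·)` is a slice function which on `ℂ_j` is the complex Cauchy kernel. Hence the Cauchy
transform is a slice function off the contour, and on `ℂ_j` it is the Cauchy integral over `Γ`
(`sliceFormula_cauchyTransform`, `cauchyTransform_slicePt`). This reduces the theorem to complex
analysis in the plane.

If `f = f₊ + f₋` is a splitting, then by Cauchy's formulas for `D` and for its exterior the Cauchy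
transform of `f` is `f₊ + f₋(∞)` on `U` and `f₋(∞) - f₋` outside
(`IsSplitting.cauchyTransform_eqOn`). Both are continuous up to the boundary, and they determine
the splitting if `f₋(∞) = 0`. Conversely, the Cauchy integral is holomorphic off the contour and
vanishes at infinity, and by Plemelj's jump relation its boundary values from the two sides, if
they exist, differ by `f` (`IsSide.sub_eq_of_continuousOn`); hence they split `f`
(`isSplitting_of_isContinuousExtension`).

Cauchy's formulas are needed for functions that are only continuous up to a piecewise `C¹`
boundary. They follow from Green's formula `∫_Ω 2 ∂φ/∂z̄ F dA = -iσ ∫_Γ φ F dw`, for test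
functions `φ` and for `F` holomorphic in `Ω` and continuous on the closure (`IsSide.green`): near a
smooth boundary point one straightens the boundary and passes to the limit from inside, a partition
of unity glues the local formulas, and small cutoffs remove the break points. With radial functions
`φ` this gives Cauchy's theorem (`IsSide.contourIntegral_eq_zero`) and the residue at infinity
(`IsSide.contourIntegral_exterior`). The latter also yields the winding numbers, without any
appeal to the Jordan curve theorem. The jump relation (`IsSide.tendsto_jump`) is proved by
approaching a smooth point along the normal, where the difference of the two kernels is dominated
by a Poisson kernel.
-/

namespace SliceHyper

open Set MeasureTheory Filter Complex

/-! ### Green's formula on one side of an arc -/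

/-- `2 ∂φ/∂z̄ = ∂φ/∂x + i ∂φ/∂y`, for a real differentiable function `φ` on the plane. -/
noncomputable def dbar (φ : ℂ → ℂ) (w : ℂ) : ℂ := fderiv ℝ φ w 1 + I * fderiv ℝ φ w I

theorem clm_complex_apply {G : Type*} [NormedAddCommGroup G] [NormedSpace ℝ G] (L : ℂ →L[ℝ] G)
    (v : ℂ) : L v = v.re • L 1 + v.im • L I := by
  conv_lhs => rw [show v = v.re • (1 : ℂ) + v.im • I by
    rw [real_smul, real_smul, mul_one]; exact (re_add_im v).symm]
  rw [map_add, map_smul, map_smul]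

/-- The linear map `ζ ↦ Re ζ · u + Im ζ · v`. -/
noncomputable def frameMap (u v : ℂ) : ℂ →L[ℝ] ℂ := reCLM.smulRight u + imCLM.smulRight v

theorem frameMap_apply (u v ζ : ℂ) : frameMap u v ζ = ζ.re * u + ζ.im * v := by
  simp [frameMap]

theorem det_frameMap (u v : ℂ) : (frameMap u v).det = u.re * v.im - u.im * v.re := by
  rw [ContinuousLinearMap.det, ← LinearMap.det_toMatrix basisOneI, Matrix.det_fin_two]
  simp [LinearMap.toMatrix_apply, frameMap_apply]
  ring

theorem hasFDerivAt_frame {γ : ℝ → ℂ} {u : ℂ} (n : ℂ) {ζ : ℂ} (h : HasDerivAt γ u ζ.re) :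
    HasFDerivAt (fun ζ : ℂ => γ ζ.re + ζ.im * n) (frameMap u n) ζ := by
  have h2 := (h.hasFDerivAt.comp ζ reCLM.hasFDerivAt).add
    (imCLM.smulRight n).hasFDerivAt
  have hd : frameMap u n =
      (ContinuousLinearMap.toSpanSingleton ℝ u).comp reCLM + imCLM.smulRight n := by
    ext x
    simp [frameMap]
  rw [hd]
  refine h2.congr_of_eventuallyEq (Eventually.of_forall fun x => ?_)
  simp

theorem hasStrictFDerivAt_frame {γ : ℝ → ℂ} {u : ℂ} (n : ℂ) {ζ : ℂ}
    (h : HasStrictDerivAt γ u ζ.re) :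
    HasStrictFDerivAt (fun ζ : ℂ => γ ζ.re + ζ.im * n) (frameMap u n) ζ := by
  have h2 := (h.hasStrictFDerivAt.comp ζ reCLM.hasStrictFDerivAt).add
    (imCLM.smulRight n).hasStrictFDerivAt
  have hd : frameMap u n =
      (ContinuousLinearMap.toSpanSingleton ℝ u).comp reCLM + imCLM.smulRight n := by
    ext x
    simp [frameMap]
  rw [hd]
  refine h2.congr_of_eventuallyEq (Eventually.of_forall fun x => ?_)
  simp

theorem continuous_dbar {φ : ℂ → ℂ} (hφ : ContDiff ℝ 1 φ) : Continuous (dbar φ) := by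
  have hφ' : Continuous (fderiv ℝ φ) := hφ.continuous_fderiv one_ne_zero
  unfold dbar
  exact (hφ'.clm_apply continuous_const).add
    (continuous_const.mul (hφ'.clm_apply continuous_const))

theorem dbar_eq_zero_of_notMem_tsupport {φ : ℂ → ℂ} {w : ℂ} (hw : w ∉ tsupport φ) :
    dbar φ w = 0 := by
  have : fderiv ℝ φ w = 0 := by
    by_contra h
    exact hw (support_fderiv_subset ℝ h)
  simp [dbar, this]

section Green

variable {E : Type*} [NormedAddCommGroup E] [NormedSpace ℂ E]

theorem intervalIntegral_swap_of_continuousOn {a b c d : ℝ} (hab : a ≤ b) (hcd : c ≤ d)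
    {f : ℝ → ℝ → E} (hf : ContinuousOn (Function.uncurry f) (Icc a b ×ˢ Icc c d)) :
    ∫ x in a..b, ∫ y in c..d, f x y = ∫ y in c..d, ∫ x in a..b, f x y := by
  simp only [intervalIntegral.integral_of_le hab, intervalIntegral.integral_of_le hcd]
  apply integral_integral_swap
  rw [Measure.prod_restrict]
  exact (hf.integrableOn_compact (isCompact_Icc.prod isCompact_Icc)).mono_set
    (prod_mono Ioc_subset_Icc_self Ioc_subset_Icc_self)

theorem hasDerivAt_smul_along {φ : ℂ → ℂ} {F : ℂ → E} {c : ℝ → ℂ} {v : ℂ} {s : ℝ}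
    (hφ : DifferentiableAt ℝ φ (c s)) (hF : DifferentiableAt ℂ F (c s)) (hc : HasDerivAt c v s) :
    HasDerivAt (fun s => φ (c s) • F (c s))
      (fderiv ℝ φ (c s) v • F (c s) + φ (c s) • v • deriv F (c s)) s := by
  have h1 : HasDerivAt (fun s => φ (c s)) (fderiv ℝ φ (c s) v) s :=
    hφ.hasFDerivAt.comp_hasDerivAt s hc
  have h2 : HasDerivAt (fun s => F (c s)) (v • deriv F (c s)) s :=
    hF.hasDerivAt.scomp s hc
  rw [add_comm]
  exact h1.smul h2

variable [CompleteSpace E]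

/-- Green's formula in the strip `ε ≤ y ≤ a` above the arc `γ`, in the coordinates
`(t, y) ↦ γ t + y n`. Multiplied by the Jacobian, the integrand `2 ∂φ/∂z̄ F` becomes
`i (γ' ∂/∂y - n ∂/∂t) (φ F)`, and the fundamental theorem of calculus applies in each variable. -/
theorem green_strip {γ γ' : ℝ → ℂ} {n : ℂ} {p q ε a : ℝ} (hpq : p ≤ q) (hε : ε ≤ a)
    (hγ : ∀ t ∈ Icc p q, HasDerivAt γ (γ' t) t) (hγ' : ContinuousOn γ' (Icc p q))
    {Ω : Set ℂ} (hΩ : IsOpen Ω) (hup : ∀ t ∈ Icc p q, ∀ y ∈ Icc ε a, γ t + y * n ∈ Ω)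
    {F : ℂ → E} (hF : DifferentiableOn ℂ F Ω) {φ : ℂ → ℂ} (hφ : ContDiff ℝ 1 φ)
    (hp : ∀ y ∈ Icc ε a, φ (γ p + y * n) = 0) (hq : ∀ y ∈ Icc ε a, φ (γ q + y * n) = 0)
    (ha : ∀ t ∈ Icc p q, φ (γ t + a * n) = 0) :
    ∫ y in ε..a, ∫ t in p..q, (((γ' t).re * n.im - (γ' t).im * n.re : ℝ) : ℂ) •
        dbar φ (γ t + y * n) • F (γ t + y * n) =
      -I • ∫ t in p..q, φ (γ t + ε * n) • γ' t • F (γ t + ε * n) := by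
  have hφd : ∀ w, DifferentiableAt ℝ φ w := fun w => (hφ.differentiable one_ne_zero) w
  have hφ' : Continuous (fderiv ℝ φ) := hφ.continuous_fderiv one_ne_zero
  have hFd : ∀ w ∈ Ω, DifferentiableAt ℂ F w := fun w hw => hF.differentiableAt (hΩ.mem_nhds hw)
  have hF' : ContinuousOn (deriv F) Ω := (hF.deriv hΩ).continuousOn
  have hγc : ContinuousOn γ (Icc p q) := fun t ht => (hγ t ht).continuousAt.continuousWithinAt
  have hS : IsCompact (Icc p q ×ˢ Icc ε a) := isCompact_Icc.prod isCompact_Icc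
  -- the coordinates, and the two terms whose difference is the integrand
  have hΦ : ContinuousOn (fun x : ℝ × ℝ => γ x.1 + x.2 * n) (Icc p q ×ˢ Icc ε a) := by
    have := hγc.comp continuousOn_fst (fun x (hx : x ∈ Icc p q ×ˢ Icc ε a) => hx.1)
    have h2 : Continuous fun x : ℝ × ℝ => (x.2 : ℂ) * n := by fun_prop
    exact this.add h2.continuousOn
  have hm : MapsTo (fun x : ℝ × ℝ => γ x.1 + x.2 * n) (Icc p q ×ˢ Icc ε a) Ω :=
    fun x hx => hup x.1 hx.1 x.2 hx.2
  have hFΦ := hF.continuousOn.comp hΦ hm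
  have hF'Φ := hF'.comp hΦ hm
  have hφΦ := hφ.continuous.comp_continuousOn hΦ
  have hφ'Φ := hφ'.comp_continuousOn hΦ
  have hγ1 : ContinuousOn (fun x : ℝ × ℝ => γ' x.1) (Icc p q ×ˢ Icc ε a) :=
    hγ'.comp continuousOn_fst (fun x hx => hx.1)
  set A : ℝ → ℝ → E := fun t y => γ' t • (fderiv ℝ φ (γ t + y * n) n • F (γ t + y * n) +
    φ (γ t + y * n) • n • deriv F (γ t + y * n)) with hA
  set B : ℝ → ℝ → E := fun t y => n • (fderiv ℝ φ (γ t + y * n) (γ' t) • F (γ t + y * n) +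
    φ (γ t + y * n) • γ' t • deriv F (γ t + y * n)) with hB
  have hAc : ContinuousOn (Function.uncurry A) (Icc p q ×ˢ Icc ε a) := by
    refine hγ1.smul (ContinuousOn.add (ContinuousOn.smul ?_ hFΦ) (hφΦ.smul (hF'Φ.const_smul n)))
    exact hφ'Φ.clm_apply continuousOn_const
  have hBc : ContinuousOn (Function.uncurry B) (Icc p q ×ˢ Icc ε a) := by
    refine ContinuousOn.const_smul (ContinuousOn.add (ContinuousOn.smul ?_ hFΦ)
      (hφΦ.smul (hγ1.smul hF'Φ))) n
    exact hφ'Φ.clm_apply hγ1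
  have hsl1 : ∀ {G : ℝ → ℝ → E}, ContinuousOn (Function.uncurry G) (Icc p q ×ˢ Icc ε a) →
      ∀ y ∈ Icc ε a, IntervalIntegrable (fun t => G t y) volume p q := by
    intro G hG y hy
    refine ContinuousOn.intervalIntegrable ?_
    rw [uIcc_of_le hpq]
    exact hG.comp (f := fun t => (t, y)) (by fun_prop) (fun t ht => ⟨ht, hy⟩)
  have hsl2 : ∀ {G : ℝ → ℝ → E}, ContinuousOn (Function.uncurry G) (Icc p q ×ˢ Icc ε a) →
      ∀ t ∈ Icc p q, IntervalIntegrable (fun y => G t y) volume ε a := by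
    intro G hG t ht
    refine ContinuousOn.intervalIntegrable ?_
    rw [uIcc_of_le hε]
    exact hG.comp (f := fun y => (t, y)) (by fun_prop) (fun y hy => ⟨ht, hy⟩)
  -- the `t`-derivative integrates to zero, since `φ` vanishes at both ends
  have hB0 : ∀ y ∈ Icc ε a, ∫ t in p..q, B t y = 0 := by
    intro y hy
    have h := intervalIntegral.integral_eq_sub_of_hasDerivAt (a := p) (b := q)
      (f := fun t => n • (φ (γ t + y * n) • F (γ t + y * n))) (f' := fun t => B t y) ?_
      (hsl1 hBc y hy)
    · rw [h, hp y hy, hq y hy]; simp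
    · intro t ht
      rw [uIcc_of_le hpq] at ht
      exact (hasDerivAt_smul_along (c := fun t => γ t + y * n) (hφd _) (hFd _ (hup t ht y hy))
        ((hγ t ht).add_const _)).const_smul n
  have hA0 : ∀ t ∈ Icc p q, ∫ y in ε..a, A t y =
      -(φ (γ t + ε * n) • γ' t • F (γ t + ε * n)) := by
    intro t ht
    have h := intervalIntegral.integral_eq_sub_of_hasDerivAt (a := ε) (b := a)
      (f := fun y : ℝ => γ' t • (φ (γ t + y * n) • F (γ t + y * n))) (f' := fun y => A t y) ?_
      (hsl2 hAc t ht)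
    · rw [h, ha t ht, zero_smul, smul_zero, zero_sub, smul_comm]
    · intro y hy
      rw [uIcc_of_le hε] at hy
      refine (hasDerivAt_smul_along (c := fun y : ℝ => γ t + y * n) (hφd _)
        (hFd _ (hup t ht y hy)) ?_).const_smul (γ' t)
      have := ((hasDerivAt_id y).ofReal_comp.mul_const n).const_add (γ t)
      simpa using this
  have hid : ∀ t y : ℝ, (((γ' t).re * n.im - (γ' t).im * n.re : ℝ) : ℂ) •
        dbar φ (γ t + y * n) • F (γ t + y * n) = I • (A t y - B t y) := by
    intro t y
    simp only [hA, hB, dbar]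
    rw [clm_complex_apply _ n, clm_complex_apply _ (γ' t)]
    simp only [real_smul]
    set r := fderiv ℝ φ (γ t + y * n) 1
    set s := fderiv ℝ φ (γ t + y * n) I
    rw [← sub_eq_zero]
    have hn : n = n.re + n.im * I := (re_add_im n).symm
    have hg : γ' t = (γ' t).re + (γ' t).im * I := (re_add_im _).symm
    match_scalars
    · linear_combination (r * (γ' t).re + s * (γ' t).im) * I * hn
        - (r * n.re + s * n.im) * I * hg
        + r * ((γ' t).re * n.im - (γ' t).im * n.re) * I_sq
    · ring
  calc ∫ y in ε..a, ∫ t in p..q, (((γ' t).re * n.im - (γ' t).im * n.re : ℝ) : ℂ) •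
        dbar φ (γ t + y * n) • F (γ t + y * n)
      = ∫ y in ε..a, I • ∫ t in p..q, A t y := by
        refine intervalIntegral.integral_congr fun y hy => ?_
        rw [uIcc_of_le hε] at hy
        simp only [hid]
        rw [intervalIntegral.integral_smul, intervalIntegral.integral_sub (hsl1 hAc y hy)
          (hsl1 hBc y hy), hB0 y hy, sub_zero]
    _ = I • ∫ t in p..q, ∫ y in ε..a, A t y := by
        rw [intervalIntegral.integral_smul, intervalIntegral_swap_of_continuousOn hpq hε hAc]
    _ = I • ∫ t in p..q, -(φ (γ t + ε * n) • γ' t • F (γ t + ε * n)) := by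
        congr 1
        refine intervalIntegral.integral_congr fun t ht => ?_
        rw [uIcc_of_le hpq] at ht
        exact hA0 t ht
    _ = _ := by rw [intervalIntegral.integral_neg, neg_smul, smul_neg]

/-- Green's formula above the arc `γ`, up to the arc itself, where `F` is only continuous: the
limit `ε → 0` of the formula in the strips `ε ≤ y ≤ a`. -/
theorem green_strip_zero {γ γ' : ℝ → ℂ} {n : ℂ} {p q a : ℝ} (hpq : p ≤ q) (hpos : 0 < a)
    (hγ : ∀ t ∈ Icc p q, HasDerivAt γ (γ' t) t) (hγ' : ContinuousOn γ' (Icc p q))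
    {Ω : Set ℂ} (hΩ : IsOpen Ω) (hup : ∀ t ∈ Icc p q, ∀ y ∈ Ioc 0 a, γ t + y * n ∈ Ω)
    (hmid : ∀ t ∈ Icc p q, γ t ∈ closure Ω)
    {F : ℂ → E} (hF : DifferentiableOn ℂ F Ω) (hFc : ContinuousOn F (closure Ω))
    {φ : ℂ → ℂ} (hφ : ContDiff ℝ 1 φ)
    (hp : ∀ y ∈ Icc 0 a, φ (γ p + y * n) = 0) (hq : ∀ y ∈ Icc 0 a, φ (γ q + y * n) = 0)
    (ha : ∀ t ∈ Icc p q, φ (γ t + a * n) = 0) :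
    ∫ y in 0..a, ∫ t in p..q, (((γ' t).re * n.im - (γ' t).im * n.re : ℝ) : ℂ) •
        dbar φ (γ t + y * n) • F (γ t + y * n) =
      -I • ∫ t in p..q, φ (γ t) • γ' t • F (γ t) := by
  have hdb : Continuous (dbar φ) := continuous_dbar hφ
  have hγc : ContinuousOn γ (Icc p q) := fun t ht => (hγ t ht).continuousAt.continuousWithinAt
  have hS : IsCompact (Icc p q ×ˢ Icc 0 a) := isCompact_Icc.prod isCompact_Icc
  have hΦ : ContinuousOn (fun x : ℝ × ℝ => γ x.1 + x.2 * n) (Icc p q ×ˢ Icc 0 a) := by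
    have := hγc.comp continuousOn_fst (fun x (hx : x ∈ Icc p q ×ˢ Icc 0 a) => hx.1)
    have h2 : Continuous fun x : ℝ × ℝ => (x.2 : ℂ) * n := by fun_prop
    exact this.add h2.continuousOn
  have hm : MapsTo (fun x : ℝ × ℝ => γ x.1 + x.2 * n) (Icc p q ×ˢ Icc 0 a) (closure Ω) := by
    rintro ⟨t, y⟩ ⟨ht, hy⟩
    rcases hy.1.eq_or_lt with h | h
    · obtain rfl : (0 : ℝ) = y := h
      simpa using hmid t ht
    · exact subset_closure (hup t ht y ⟨h, hy.2⟩)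
  have hFΦ := hFc.comp hΦ hm
  have hγ1 : ContinuousOn (fun x : ℝ × ℝ => γ' x.1) (Icc p q ×ˢ Icc 0 a) :=
    hγ'.comp continuousOn_fst (fun x hx => hx.1)
  set K : ℝ → ℝ → E := fun t y => (((γ' t).re * n.im - (γ' t).im * n.re : ℝ) : ℂ) •
        dbar φ (γ t + y * n) • F (γ t + y * n) with hK
  have hKc : ContinuousOn (Function.uncurry K) (Icc p q ×ˢ Icc 0 a) := by
    refine ContinuousOn.smul ?_ ((hdb.comp_continuousOn hΦ).smul hFΦ)
    refine continuous_ofReal.comp_continuousOn (ContinuousOn.sub ?_ ?_)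
    · exact (continuous_re.comp_continuousOn hγ1).mul continuousOn_const
    · exact (continuous_im.comp_continuousOn hγ1).mul continuousOn_const
  set P : ℝ → ℝ → E := fun y t => φ (γ t + y * n) • γ' t • F (γ t + y * n) with hP
  have hPc : ContinuousOn (Function.uncurry fun t y => P y t) (Icc p q ×ˢ Icc 0 a) :=
    (hφ.continuous.comp_continuousOn hΦ).smul (hγ1.smul hFΦ)
  have hPt : ∀ y ∈ Icc 0 a, ContinuousOn (fun t => P y t) (Icc p q) := fun y hy =>
    hPc.comp (f := fun t => (t, y)) (by fun_prop) (fun t ht => ⟨ht, hy⟩)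
  have hPy : ∀ t ∈ Icc p q, ContinuousOn (fun y => P y t) (Icc 0 a) := fun t ht =>
    hPc.comp (f := fun y => (t, y)) (by fun_prop) (fun y hy => ⟨ht, hy⟩)
  have hmem : Ioc 0 a ∈ 𝓝[>] (0 : ℝ) := Ioc_mem_nhdsGT hpos
  have hlim1 : Tendsto (fun ε => ∫ y in ε..a, ∫ t in p..q, K t y) (𝓝[>] 0)
      (𝓝 (∫ y in 0..a, ∫ t in p..q, K t y)) := by
    have hint : IntegrableOn (fun y => ∫ t in p..q, K t y) (uIcc 0 a) := by
      rw [uIcc_of_le hpos.le]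
      simp only [intervalIntegral.integral_of_le hpq]
      have h1 : Integrable (Function.uncurry K)
          ((volume.restrict (Ioc p q)).prod (volume.restrict (Icc 0 a))) := by
        rw [Measure.prod_restrict]
        exact (hKc.integrableOn_compact hS).mono_set (prod_mono Ioc_subset_Icc_self le_rfl)
      exact h1.integral_prod_right
    have := intervalIntegral.continuousOn_primitive_interval_left hint 0 (by simp)
    rw [uIcc_of_le hpos.le] at this
    exact (this.mono_of_mem_nhdsWithin (t := Icc 0 a) (s := Ioi 0)
      (mem_of_superset hmem Ioc_subset_Icc_self)).tendsto
  have hlim2 : Tendsto (fun ε => ∫ t in p..q, P ε t) (𝓝[>] 0) (𝓝 (∫ t in p..q, P 0 t)) := by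
    obtain ⟨C, hC⟩ := hS.exists_bound_of_continuousOn hPc
    refine intervalIntegral.tendsto_integral_filter_of_dominated_convergence (fun _ => C) ?_ ?_
      (by simp) ?_
    · filter_upwards [hmem] with y hy
      rw [uIoc_of_le hpq]
      exact ((hPt y (Ioc_subset_Icc_self hy)).mono Ioc_subset_Icc_self).aestronglyMeasurable
        measurableSet_Ioc
    · filter_upwards [hmem] with y hy
      refine Eventually.of_forall fun t ht => ?_
      rw [uIoc_of_le hpq] at ht
      exact hC (t, y) ⟨Ioc_subset_Icc_self ht, Ioc_subset_Icc_self hy⟩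
    · refine Eventually.of_forall fun t ht => ?_
      rw [uIoc_of_le hpq] at ht
      exact ((hPy t (Ioc_subset_Icc_self ht) 0 ⟨le_rfl, hpos.le⟩).mono_of_mem_nhdsWithin
        (mem_of_superset hmem Ioc_subset_Icc_self)).tendsto
  have heq : ∀ᶠ ε in 𝓝[>] (0 : ℝ), ∫ y in ε..a, ∫ t in p..q, K t y =
      -I • ∫ t in p..q, P ε t := by
    filter_upwards [hmem] with ε hε
    have hsub : Icc ε a ⊆ Icc 0 a := Icc_subset_Icc_left hε.1.le
    exact green_strip hpq hε.2 hγ hγ' hΩ (fun t ht y hy => hup t ht y ⟨hε.1.trans_le hy.1, hy.2⟩)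
      hF hφ (fun y hy => hp y (hsub hy)) (fun y hy => hq y (hsub hy)) ha
  have := tendsto_nhds_unique (hlim1.congr' heq) (hlim2.const_smul (-I))
  rw [this]
  simp [hP]

omit [CompleteSpace E] in
theorem setIntegral_reProdIm {p q c d : ℝ} (hpq : p ≤ q) (hcd : c ≤ d) {f : ℂ → E}
    (hf : IntegrableOn f (Icc p q ×ℂ Icc c d)) :
    ∫ ζ in Ioo p q ×ℂ Ioo c d, f ζ = ∫ y in c..d, ∫ t in p..q, f (t + y * I) := by
  have hpre : measurableEquivRealProd.symm ⁻¹' (Ioo p q ×ℂ Ioo c d) = Ioo p q ×ˢ Ioo c d := rfl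
  have hpre' : measurableEquivRealProd.symm ⁻¹' (Icc p q ×ℂ Icc c d) = Icc p q ×ˢ Icc c d := rfl
  have hmp := volume_preserving_equiv_real_prod.symm measurableEquivRealProd
  have hemb := measurableEquivRealProd.symm.measurableEmbedding
  have h1 := hmp.setIntegral_preimage_emb hemb f (Ioo p q ×ℂ Ioo c d)
  have h2 := (hmp.integrableOn_comp_preimage hemb (f := f) (s := Icc p q ×ℂ Icc c d)).2 hf
  rw [hpre] at h1
  rw [hpre'] at h2
  have h3 : Integrable (f ∘ measurableEquivRealProd.symm)
      ((volume.restrict (Ioo p q)).prod (volume.restrict (Ioo c d))) := by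
    rw [Measure.prod_restrict]
    exact h2.mono_set (prod_mono Ioo_subset_Icc_self Ioo_subset_Icc_self)
  rw [← h1, Measure.volume_eq_prod, ← Measure.prod_restrict]
  refine (integral_prod_symm _ h3).trans ?_
  simp only [intervalIntegral.integral_of_le hpq, intervalIntegral.integral_of_le hcd,
    integral_Ioc_eq_integral_Ioo]
  refine integral_congr_ae (Eventually.of_forall fun y => integral_congr_ae
    (Eventually.of_forall fun t => ?_))
  simp only [Function.comp, measurableEquivRealProd_symm_apply, mk_eq_add_mul_I]

/-- Green's formula near an arc, for `φ` supported in a coordinate patch: `Ω` lies above the arc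
in the coordinates `ζ ↦ γ (Re ζ) + Im ζ · n`, whose Jacobian has the sign `σ`. -/
theorem green_arc {γ γ' : ℝ → ℂ} {n : ℂ} {p q a σ : ℝ} (hpq : p ≤ q) (hpos : 0 < a)
    (hγ : ∀ t ∈ Icc p q, HasDerivAt γ (γ' t) t) (hγ' : ContinuousOn γ' (Icc p q))
    (hJ : ∀ t ∈ Icc p q, |(γ' t).re * n.im - (γ' t).im * n.re| =
      σ * ((γ' t).re * n.im - (γ' t).im * n.re))
    (hinj : InjOn (fun ζ : ℂ => γ ζ.re + ζ.im * n) (Icc p q ×ℂ Icc (-a) a))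
    {Ω : Set ℂ} (hΩ : IsOpen Ω) (hup : ∀ t ∈ Icc p q, ∀ y ∈ Ioc 0 a, γ t + y * n ∈ Ω)
    (hmid : ∀ t ∈ Icc p q, γ t ∈ closure Ω)
    (hlow : ∀ t ∈ Icc p q, ∀ y ∈ Icc (-a) 0, γ t + y * n ∉ Ω)
    {F : ℂ → E} (hF : DifferentiableOn ℂ F Ω) (hFc : ContinuousOn F (closure Ω))
    {φ : ℂ → ℂ} (hφ : ContDiff ℝ 1 φ)
    (hsupp : tsupport φ ⊆ (fun ζ : ℂ => γ ζ.re + ζ.im * n) '' (Ioo p q ×ℂ Ioo (-a) a)) :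
    ∫ w in Ω, dbar φ w • F w = (-I * σ) • ∫ t in p..q, φ (γ t) • γ' t • F (γ t) := by
  set Φ : ℂ → ℂ := fun ζ => γ ζ.re + ζ.im * n with hΦdef
  have hγc : ContinuousOn γ (Icc p q) := fun t ht => (hγ t ht).continuousAt.continuousWithinAt
  have hR : ∀ {t y : ℝ}, φ (γ t + y * n) ≠ 0 → t ∈ Icc p q → y ∈ Icc (-a) a →
      t ∈ Ioo p q ∧ y ∈ Ioo (-a) a := by
    intro t y h ht hy
    obtain ⟨ζ, hζ, hζe⟩ := hsupp (subset_tsupport _ h)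
    have : ζ = t + y * I := by
      apply hinj (show ζ ∈ Icc p q ×ℂ Icc (-a) a from
        ⟨Ioo_subset_Icc_self hζ.1, Ioo_subset_Icc_self hζ.2⟩)
      · simpa [mem_reProdIm] using And.intro ht hy
      · simpa [hΦdef] using hζe
    simpa [this, mem_reProdIm] using hζ
  -- restriction to the part of `Ω` in the coordinate patch
  have hsub : Φ '' (Ioo p q ×ℂ Ioo 0 a) ⊆ Ω := by
    rintro _ ⟨ζ, hζ, rfl⟩
    exact hup _ (Ioo_subset_Icc_self hζ.1) _ (Ioo_subset_Ioc_self hζ.2)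
  have h1 : ∫ w in Ω, dbar φ w • F w = ∫ w in Φ '' (Ioo p q ×ℂ Ioo 0 a), dbar φ w • F w := by
    refine setIntegral_eq_of_subset_of_forall_sdiff_eq_zero hΩ.measurableSet hsub ?_
    rintro w ⟨hw, hw'⟩
    rw [dbar_eq_zero_of_notMem_tsupport, zero_smul]
    intro hwt
    obtain ⟨ζ, hζ, rfl⟩ := hsupp hwt
    rcases le_or_gt ζ.im 0 with h | h
    · exact hlow _ (Ioo_subset_Icc_self hζ.1) _ ⟨hζ.2.1.le, h⟩ hw
    · exact hw' ⟨ζ, ⟨hζ.1, h, hζ.2.2⟩, rfl⟩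
  -- change of variables
  have hmeas : MeasurableSet (Ioo p q ×ℂ Ioo 0 a) := (isOpen_Ioo.reProdIm isOpen_Ioo).measurableSet
  have hder : ∀ ζ ∈ Ioo p q ×ℂ Ioo 0 a,
      HasFDerivWithinAt Φ (frameMap (γ' ζ.re) n) (Ioo p q ×ℂ Ioo 0 a) ζ := by
    intro ζ hζ
    refine HasFDerivAt.hasFDerivWithinAt ?_
    exact hasFDerivAt_frame n (hγ ζ.re (Ioo_subset_Icc_self hζ.1))
  have hinj' : InjOn Φ (Ioo p q ×ℂ Ioo 0 a) := by
    refine hinj.mono ?_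
    rintro ζ ⟨h2, h3⟩
    exact ⟨Ioo_subset_Icc_self h2, Ioo_subset_Icc_self (Ioo_subset_Ioo_left (by linarith) h3)⟩
  rw [h1, integral_image_eq_integral_abs_det_fderiv_smul volume hmeas hder hinj']
  set K : ℂ → E := fun ζ => (((γ' ζ.re).re * n.im - (γ' ζ.re).im * n.re : ℝ) : ℂ) •
        dbar φ (Φ ζ) • F (Φ ζ) with hK
  have hcl : Icc p q ×ℂ Icc 0 a ⊆ Φ ⁻¹' (closure Ω) := by
    rintro ζ ⟨ht, hy⟩
    rcases hy.1.eq_or_lt with h | h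
    · have : Φ ζ = γ ζ.re := by simp [hΦdef, ← h]
      rw [mem_preimage, this]
      exact hmid _ ht
    · exact subset_closure (hup _ ht _ ⟨h, hy.2⟩)
  have hKi : IntegrableOn K (Icc p q ×ℂ Icc 0 a) := by
    refine ContinuousOn.integrableOn_compact (isCompact_Icc.reProdIm isCompact_Icc) ?_
    have hre : ContinuousOn (fun ζ : ℂ => γ' ζ.re) (Icc p q ×ℂ Icc 0 a) :=
      hγ'.comp continuous_re.continuousOn fun ζ hζ => hζ.1
    have hΦc : ContinuousOn Φ (Icc p q ×ℂ Icc 0 a) := by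
      refine (hγc.comp continuous_re.continuousOn fun ζ hζ => hζ.1).add ?_
      exact Continuous.continuousOn (by fun_prop)
    refine ContinuousOn.smul ?_ (((continuous_dbar hφ).comp_continuousOn hΦc).smul
      (hFc.comp hΦc hcl))
    refine continuous_ofReal.comp_continuousOn (ContinuousOn.sub ?_ ?_)
    · exact (continuous_re.comp_continuousOn hre).mul continuousOn_const
    · exact (continuous_im.comp_continuousOn hre).mul continuousOn_const
  have h5 : ∫ ζ in Ioo p q ×ℂ Ioo 0 a, |(frameMap (γ' ζ.re) n).det| • dbar φ (Φ ζ) • F (Φ ζ) =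
      ∫ ζ in Ioo p q ×ℂ Ioo 0 a, (σ : ℂ) • K ζ := by
    refine setIntegral_congr_fun hmeas fun ζ hζ => ?_
    simp only [hK]
    rw [det_frameMap, hJ _ (Ioo_subset_Icc_self hζ.1), ← Complex.coe_smul, smul_smul (σ : ℂ),
      ofReal_mul]
  rw [h5, integral_smul, setIntegral_reProdIm hpq hpos.le hKi, mul_comm (-I), mul_smul]
  congr 1
  rw [← green_strip_zero hpq hpos hγ hγ' hΩ hup hmid hF hFc hφ]
  · simp [hK, hΦdef]
  · intro y hy
    by_contra h
    exact lt_irrefl _ (hR h (left_mem_Icc.2 hpq) ⟨by linarith [hy.1], hy.2⟩).1.1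
  · intro y hy
    by_contra h
    exact lt_irrefl _ (hR h (right_mem_Icc.2 hpq) ⟨by linarith [hy.1], hy.2⟩).1.2
  · intro t ht
    by_contra h
    exact lt_irrefl _ (hR h ht ⟨by linarith, le_rfl⟩).2.2

end Green

/-! ### Piecewise `C¹` contours -/

namespace PwC1ClosedCurve

variable (c : PwC1ClosedCurve)

theorem t_le_t {i k : ℕ} (hik : i ≤ k) (hk : k ≤ c.n) : c.t i ≤ c.t k := by
  induction k, hik using Nat.le_induction with
  | base => exact le_rfl
  | succ m him ih => exact (ih (by omega)).trans (c.t_lt m (by omega)).le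

theorem t_zero_lt : c.t 0 < c.t c.n :=
  (c.t_lt 0 c.n_pos).trans_le (c.t_le_t c.n_pos le_rfl)

theorem Icc_piece_subset {i : ℕ} (hi : i < c.n) :
    Icc (c.t i) (c.t (i + 1)) ⊆ Icc (c.t 0) (c.t c.n) :=
  Icc_subset_Icc (c.t_le_t (Nat.zero_le _) hi.le) (c.t_le_t hi le_rfl)

theorem Ioo_piece_subset {i : ℕ} (hi : i < c.n) :
    Ioo (c.t i) (c.t (i + 1)) ⊆ Ioo (c.t 0) (c.t c.n) :=
  Ioo_subset_Ioo (c.t_le_t (Nat.zero_le _) hi.le) (c.t_le_t hi le_rfl)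

theorem exists_mem_piece {x : ℝ} (hx : x ∈ Icc (c.t 0) (c.t c.n)) :
    ∃ i < c.n, x ∈ Icc (c.t i) (c.t (i + 1)) := by
  by_contra! h
  have : ∀ i ≤ c.n, c.t i ≤ x := by
    intro i
    induction i with
    | zero => exact fun _ => hx.1
    | succ m ih =>
      intro hm
      by_contra! hlt
      exact h m hm ⟨ih (by omega), hlt.le⟩
  have hn := c.n_pos
  have h1 := this c.n le_rfl
  refine h (c.n - 1) (by omega) ⟨this _ (by omega), ?_⟩
  rw [Nat.sub_add_cancel hn]
  exact hx.2

theorem exists_mem_Ioo_of_ne {x : ℝ} (hx : x ∈ Icc (c.t 0) (c.t c.n))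
    (h : ∀ i ≤ c.n, x ≠ c.t i) : ∃ i < c.n, x ∈ Ioo (c.t i) (c.t (i + 1)) := by
  obtain ⟨i, hi, hxi⟩ := c.exists_mem_piece hx
  exact ⟨i, hi, hxi.1.lt_of_ne (h i hi.le).symm, hxi.2.lt_of_ne (h (i + 1) hi)⟩

theorem isCompact_image : IsCompact c.image := isCompact_Icc.image_of_continuousOn c.continuousOn

theorem contDiffAt {i : ℕ} (hi : i < c.n) {x : ℝ} (hx : x ∈ Ioo (c.t i) (c.t (i + 1))) :
    ContDiffAt ℝ 1 c.γ x :=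
  (c.contDiffOn i hi).contDiffAt (Icc_mem_nhds hx.1 hx.2)

theorem hasDerivAt {i : ℕ} (hi : i < c.n) {x : ℝ} (hx : x ∈ Ioo (c.t i) (c.t (i + 1))) :
    HasDerivAt c.γ (deriv c.γ x) x :=
  ((c.contDiffAt hi hx).differentiableAt one_ne_zero).hasDerivAt

theorem derivWithin_eq {i : ℕ} {x : ℝ} (hx : x ∈ Ioo (c.t i) (c.t (i + 1))) :
    derivWithin c.γ (Icc (c.t i) (c.t (i + 1))) x = deriv c.γ x :=
  derivWithin_of_mem_nhds (Icc_mem_nhds hx.1 hx.2)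

theorem deriv_ne_zero' {i : ℕ} (hi : i < c.n) {x : ℝ} (hx : x ∈ Ioo (c.t i) (c.t (i + 1))) :
    deriv c.γ x ≠ 0 := by
  rw [← c.derivWithin_eq hx]
  exact c.deriv_ne_zero i hi x (Ioo_subset_Icc_self hx)

theorem continuousOn_deriv {i : ℕ} (hi : i < c.n) :
    ContinuousOn (deriv c.γ) (Ioo (c.t i) (c.t (i + 1))) :=
  ((c.contDiffOn i hi).mono Ioo_subset_Icc_self).continuousOn_deriv_of_isOpen isOpen_Ioo le_rfl

theorem exists_norm_deriv_le : ∃ M, 0 ≤ M ∧ ∀ i < c.n, ∀ x ∈ Ioo (c.t i) (c.t (i + 1)),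
    ‖deriv c.γ x‖ ≤ M := by
  have h : ∀ i, ∃ M, i < c.n → ∀ x ∈ Ioo (c.t i) (c.t (i + 1)), ‖deriv c.γ x‖ ≤ M := by
    intro i
    by_cases hi : i < c.n
    · obtain ⟨M, hM⟩ := isCompact_Icc.exists_bound_of_continuousOn
        ((c.contDiffOn i hi).continuousOn_derivWithin (uniqueDiffOn_Icc (c.t_lt i hi)) le_rfl)
      refine ⟨M, fun _ x hx => ?_⟩
      rw [← c.derivWithin_eq hx]
      exact hM x (Ioo_subset_Icc_self hx)
    · exact ⟨0, fun h => absurd h hi⟩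
  choose M hM using h
  refine ⟨∑ i ∈ Finset.range c.n, |M i|, Finset.sum_nonneg fun _ _ => abs_nonneg _,
    fun i hi x hx => (hM i hi x hx).trans ((le_abs_self _).trans ?_)⟩
  exact Finset.single_le_sum (f := fun i => |M i|) (fun _ _ => abs_nonneg _)
    (Finset.mem_range.2 hi)

/-- Away from the finitely many break points, the derivative is bounded. -/
theorem exists_ae_norm_deriv_le : ∃ M, 0 ≤ M ∧
    ∀ᵐ x ∂volume.restrict (Ioc (c.t 0) (c.t c.n)), ‖deriv c.γ x‖ ≤ M := by
  obtain ⟨M, hM0, hM⟩ := c.exists_norm_deriv_le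
  refine ⟨M, hM0, ?_⟩
  have hfin : (c.t '' Iic c.n).Finite := (finite_Iic c.n).image _
  filter_upwards [ae_restrict_mem measurableSet_Ioc,
    ae_restrict_of_ae (hfin.countable.ae_notMem volume)] with x hx hx'
  obtain ⟨i, hi, hxi⟩ := c.exists_mem_Ioo_of_ne (Ioc_subset_Icc_self hx)
    fun i hi h => hx' ⟨i, hi, h.symm⟩
  exact hM i hi x hxi

variable {E : Type*} [NormedAddCommGroup E] [NormedSpace ℂ E]

/-- The contour integral `∫_c g(w) dw`. -/
noncomputable def integral (g : ℂ → E) : E :=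
  ∫ x in c.t 0..c.t c.n, deriv c.γ x • g (c.γ x)

theorem aestronglyMeasurable_integrand {g : ℂ → E} (hg : ContinuousOn g c.image) :
    AEStronglyMeasurable (fun x => deriv c.γ x • g (c.γ x))
      (volume.restrict (Ioc (c.t 0) (c.t c.n))) := by
  refine (stronglyMeasurable_deriv c.γ).aestronglyMeasurable.smul ?_
  exact ((hg.comp c.continuousOn fun x hx => mem_image_of_mem _ hx).mono
    Ioc_subset_Icc_self).aestronglyMeasurable measurableSet_Ioc

theorem intervalIntegrable {g : ℂ → E} (hg : ContinuousOn g c.image) :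
    IntervalIntegrable (fun x => deriv c.γ x • g (c.γ x)) volume (c.t 0) (c.t c.n) := by
  rw [intervalIntegrable_iff_integrableOn_Ioc_of_le c.t_zero_lt.le]
  obtain ⟨M, hM0, hM⟩ := c.exists_ae_norm_deriv_le
  obtain ⟨C, hC⟩ := c.isCompact_image.exists_bound_of_continuousOn hg
  refine Integrable.of_bound (c.aestronglyMeasurable_integrand hg) (M * C) ?_
  filter_upwards [hM, ae_restrict_mem measurableSet_Ioc] with x hx hx'
  rw [norm_smul]
  exact mul_le_mul hx (hC _ (mem_image_of_mem _ (Ioc_subset_Icc_self hx'))) (norm_nonneg _) hM0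

theorem integral_add {g h : ℂ → E} (hg : ContinuousOn g c.image) (hh : ContinuousOn h c.image) :
    c.integral (fun w => g w + h w) = c.integral g + c.integral h := by
  simp only [integral, smul_add]
  exact intervalIntegral.integral_add (c.intervalIntegrable hg) (c.intervalIntegrable hh)

theorem integral_smul (a : ℂ) (g : ℂ → E) :
    c.integral (fun w => a • g w) = a • c.integral g := by
  simp only [integral, smul_comm _ a]
  exact intervalIntegral.integral_smul _ _

theorem integral_congr {g h : ℂ → E} (hgh : EqOn g h c.image) : c.integral g = c.integral h := by
  refine intervalIntegral.integral_congr fun x hx => ?_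
  rw [uIcc_of_le c.t_zero_lt.le] at hx
  simp only [hgh (mem_image_of_mem _ hx)]

end PwC1ClosedCurve

section Contour

variable {E : Type*} [NormedAddCommGroup E] [NormedSpace ℂ E] {N : ℕ}

/-- The integral `∫_Γ g(w) dw` over the contour made of the curves `Γ k`. -/
noncomputable def contourIntegral (Γ : Fin N → PwC1ClosedCurve) (g : ℂ → E) : E :=
  ∑ k, (Γ k).integral g

/-- The set of points of a contour. -/
def trace (Γ : Fin N → PwC1ClosedCurve) : Set ℂ := ⋃ k, (Γ k).image

variable (Γ : Fin N → PwC1ClosedCurve)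

theorem image_subset_trace (k : Fin N) : (Γ k).image ⊆ trace Γ :=
  subset_iUnion (fun k => (Γ k).image) k

theorem isCompact_trace : IsCompact (trace Γ) := isCompact_iUnion fun k => (Γ k).isCompact_image

theorem contourIntegral_add {g h : ℂ → E} (hg : ContinuousOn g (trace Γ))
    (hh : ContinuousOn h (trace Γ)) :
    contourIntegral Γ (fun w => g w + h w) = contourIntegral Γ g + contourIntegral Γ h := by
  simp only [contourIntegral, ← Finset.sum_add_distrib]
  exact Finset.sum_congr rfl fun k _ => (Γ k).integral_add (hg.mono (image_subset_trace Γ k))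
    (hh.mono (image_subset_trace Γ k))

theorem contourIntegral_smul (a : ℂ) (g : ℂ → E) :
    contourIntegral Γ (fun w => a • g w) = a • contourIntegral Γ g := by
  simp only [contourIntegral, PwC1ClosedCurve.integral_smul, Finset.smul_sum]

theorem contourIntegral_congr {g h : ℂ → E} (hgh : EqOn g h (trace Γ)) :
    contourIntegral Γ g = contourIntegral Γ h :=
  Finset.sum_congr rfl fun k _ => (Γ k).integral_congr (hgh.mono (image_subset_trace Γ k))

theorem contourIntegral_sub {g h : ℂ → E} (hg : ContinuousOn g (trace Γ))
    (hh : ContinuousOn h (trace Γ)) :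
    contourIntegral Γ (fun w => g w - h w) = contourIntegral Γ g - contourIntegral Γ h := by
  have := contourIntegral_add Γ hg (h := fun w => (-1 : ℂ) • h w) (hh.const_smul (-1 : ℂ))
  rw [contourIntegral_smul] at this
  simpa [sub_eq_add_neg] using this

/-- `Γ` bounds the open set `Ω`, which lies on its left if `σ = 1` and on its right if `σ = -1`. -/
structure IsSide (Γ : Fin N → PwC1ClosedCurve) (Ω : Set ℂ) (σ : ℝ) : Prop where
  isOpen : IsOpen Ω
  sign : σ = 1 ∨ σ = -1
  disjoint : Pairwise fun k l => Disjoint (Γ k).image (Γ l).image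
  frontier_eq : frontier Ω = trace Γ
  left_right : ∀ k, ∀ i < (Γ k).n, ∀ x ∈ Ioo ((Γ k).t i) ((Γ k).t (i + 1)),
    ∀ᶠ ε : ℝ in 𝓝[>] 0,
      (Γ k).γ x + ε * (I * (σ * deriv (Γ k).γ x)) ∈ Ω ∧
      (Γ k).γ x - ε * (I * (σ * deriv (Γ k).γ x)) ∈ (closure Ω)ᶜ

variable {Γ}

theorem IsOrientedBoundary.isSide {D : Set ℂ} (h : IsOrientedBoundary Γ D) (hD : IsOpen D) :
    IsSide Γ D 1 where
  isOpen := hD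
  sign := Or.inl rfl
  disjoint := h.disjoint
  frontier_eq := h.frontier_eq
  left_right k i hi x hx := by simpa using h.left_right k i hi x hx

/-- A closed condition that holds at the smooth points of the contour holds on all of it. -/
theorem trace_subset_of_smooth {Z : Set ℂ} (hZ : IsClosed Z)
    (h : ∀ k, ∀ i < (Γ k).n, ∀ x ∈ Ioo ((Γ k).t i) ((Γ k).t (i + 1)), (Γ k).γ x ∈ Z) :
    trace Γ ⊆ Z := by
  intro w hw
  obtain ⟨k, hk⟩ := mem_iUnion.1 hw
  obtain ⟨x, hx, rfl⟩ := hk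
  obtain ⟨i, hi, hxi⟩ := (Γ k).exists_mem_piece hx
  have hc : ContinuousOn (Γ k).γ (closure (Ioo ((Γ k).t i) ((Γ k).t (i + 1)))) := by
    rw [closure_Ioo ((Γ k).t_lt i hi).ne]
    exact ((Γ k).contDiffOn i hi).continuousOn
  have hm := hc.image_closure
  refine closure_minimal ?_ hZ (hm (mem_image_of_mem _ ?_))
  · rintro _ ⟨y, hy, rfl⟩
    exact h k i hi y hy
  · rwa [closure_Ioo ((Γ k).t_lt i hi).ne]

theorem IsSide.smooth_mem_closure_compl {Ω : Set ℂ} {σ : ℝ} (h : IsSide Γ Ω σ) (k : Fin N)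
    {i : ℕ} (hi : i < (Γ k).n) {x : ℝ} (hx : x ∈ Ioo ((Γ k).t i) ((Γ k).t (i + 1))) :
    (Γ k).γ x ∈ closure (closure Ω)ᶜ := by
  refine mem_closure_of_tendsto (b := 𝓝[>] (0 : ℝ))
    (f := fun ε : ℝ => (Γ k).γ x - ε * (I * (σ * deriv (Γ k).γ x))) ?_
    ((h.left_right k i hi x hx).mono fun ε hε => hε.2)
  have : Continuous fun ε : ℝ => (Γ k).γ x - ε * (I * (σ * deriv (Γ k).γ x)) := by fun_prop
  simpa using (this.tendsto 0).mono_left nhdsWithin_le_nhds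

/-- The exterior of a set bounded by a contour is bounded by the same contour, and lies on the
other side of it. -/
theorem IsSide.exterior {Ω : Set ℂ} {σ : ℝ} (h : IsSide Γ Ω σ) :
    IsSide Γ (closure Ω)ᶜ (-σ) where
  isOpen := isClosed_closure.isOpen_compl
  sign := by rcases h.sign with h | h <;> simp [h]
  disjoint := h.disjoint
  frontier_eq := by
    apply Subset.antisymm
    · rw [frontier_compl, ← h.frontier_eq]
      exact frontier_closure_subset
    · intro w hw
      rw [isClosed_closure.isOpen_compl.frontier_eq]
      refine ⟨trace_subset_of_smooth isClosed_closure
        (fun k i hi x hx => h.smooth_mem_closure_compl k hi hx) hw, ?_⟩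
      rw [← h.frontier_eq] at hw
      exact fun hw' => hw' (frontier_subset_closure hw)
  left_right k i hi x hx := by
    filter_upwards [h.left_right k i hi x hx] with ε hε
    refine ⟨?_, ?_⟩
    · convert hε.2 using 1
      push_cast; ring
    · have h1 : (Γ k).γ x + ε * (I * (σ * deriv (Γ k).γ x)) ∉ closure (closure Ω)ᶜ := by
        have : Disjoint Ω (closure (closure Ω)ᶜ) :=
          (disjoint_compl_right.mono_left subset_closure).closure_right h.isOpen
        exact disjoint_left.1 this hε.1
      convert h1 using 1
      push_cast; ring_nf

theorem IsSide.closure_exterior {Ω : Set ℂ} {σ : ℝ} (h : IsSide Γ Ω σ) :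
    closure (closure Ω)ᶜ = (closure Ω)ᶜ ∪ trace Γ := by
  rw [← h.exterior.frontier_eq, closure_eq_self_union_frontier]

theorem IsSide.closure_eq {Ω : Set ℂ} {σ : ℝ} (h : IsSide Γ Ω σ) :
    closure Ω = Ω ∪ trace Γ := by
  rw [← h.frontier_eq, closure_eq_self_union_frontier]

end Contour

/-! ### Coordinates near a smooth point of a contour -/

section Green

variable {E : Type*} [NormedAddCommGroup E] [NormedSpace ℂ E] {N : ℕ}
  {Γ : Fin N → PwC1ClosedCurve}

/-- Near a smooth point, the whole contour is a single arc. -/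
theorem exists_le_dist_trace (hd : Pairwise fun k l => Disjoint (Γ k).image (Γ l).image)
    (k : Fin N) {x₀ a : ℝ} (ha : 0 < a) (hx₀ : x₀ ∈ Ioo ((Γ k).t 0) ((Γ k).t (Γ k).n)) :
    ∃ r > 0, (∀ x ∈ Icc ((Γ k).t 0) ((Γ k).t (Γ k).n), x ∉ Ioo (x₀ - a) (x₀ + a) →
        r ≤ dist ((Γ k).γ x) ((Γ k).γ x₀)) ∧
      ∀ l ≠ k, ∀ w ∈ (Γ l).image, r ≤ dist w ((Γ k).γ x₀) := by
  set c := Γ k with hc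
  set K : Set ℂ := c.γ '' (Icc (c.t 0) (c.t c.n) \ Ioo (x₀ - a) (x₀ + a)) with hK
  have hKc : IsClosed K := by
    refine IsCompact.isClosed (IsCompact.image_of_continuousOn ?_
      (c.continuousOn.mono sdiff_subset))
    exact isCompact_Icc.diff isOpen_Ioo
  have hKn : c.γ x₀ ∉ K := by
    rintro ⟨y, ⟨hy, hy'⟩, hyx⟩
    have hxn : x₀ ∈ Ioo (x₀ - a) (x₀ + a) := ⟨by linarith, by linarith⟩
    rcases hy.2.eq_or_lt with h | h
    · have h0 : c.t 0 = x₀ := by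
        refine c.injOn ⟨le_rfl, c.t_zero_lt⟩ ⟨hx₀.1.le, hx₀.2⟩ ?_
        rw [c.closed, ← h, hyx]
      exact hx₀.1.ne h0
    · have h0 : y = x₀ := c.injOn ⟨hy.1, h⟩ ⟨hx₀.1.le, hx₀.2⟩ hyx
      exact hy' (h0 ▸ hxn)
  have hLc : IsClosed (⋃ l ∈ {l | l ≠ k}, (Γ l).image) :=
    (Set.toFinite _).isClosed_biUnion fun l _ => (Γ l).isCompact_image.isClosed
  have hLn : c.γ x₀ ∉ ⋃ l ∈ {l | l ≠ k}, (Γ l).image := by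
    intro h
    obtain ⟨l, hl, hl'⟩ := mem_iUnion₂.1 h
    exact disjoint_left.1 (hd hl) hl' (mem_image_of_mem _ (Ioo_subset_Icc_self hx₀))
  obtain ⟨r, hr, hball⟩ := Metric.isOpen_iff.1 (hKc.union hLc).isOpen_compl (c.γ x₀)
    (by rintro (h | h); exacts [hKn h, hLn h])
  refine ⟨r, hr, fun x hx hxn => ?_, fun l hl w hw => ?_⟩
  · by_contra! hlt
    exact hball hlt (Or.inl ⟨x, ⟨hx, hxn⟩, rfl⟩)
  · by_contra! hlt
    exact hball hlt (Or.inr (mem_biUnion (show l ∈ {l | l ≠ k} from hl) hw))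

theorem exists_ball_inter_trace_subset (hd : Pairwise fun k l => Disjoint (Γ k).image (Γ l).image)
    (k : Fin N) {x₀ a : ℝ} (ha : 0 < a) (hx₀ : x₀ ∈ Ioo ((Γ k).t 0) ((Γ k).t (Γ k).n)) :
    ∃ r > 0, ∀ w ∈ Metric.ball ((Γ k).γ x₀) r ∩ trace Γ,
      ∃ x ∈ Ioo (x₀ - a) (x₀ + a) ∩ Icc ((Γ k).t 0) ((Γ k).t (Γ k).n), (Γ k).γ x = w := by
  obtain ⟨r, hr, h1, h2⟩ := exists_le_dist_trace hd k ha hx₀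
  refine ⟨r, hr, ?_⟩
  rintro w ⟨hw, hwt⟩
  obtain ⟨l, hl⟩ := mem_iUnion.1 hwt
  obtain rfl : l = k := by
    by_contra hlk
    exact not_le.2 hw (h2 l hlk w hl)
  obtain ⟨x, hx, rfl⟩ := hl
  refine ⟨x, ⟨?_, hx⟩, rfl⟩
  by_contra hx'
  exact not_le.2 hw (h1 x hx hx')

theorem convex_reProdIm {s t : Set ℝ} (hs : Convex ℝ s) (ht : Convex ℝ t) :
    Convex ℝ (s ×ℂ t) :=
  (hs.is_linear_preimage reLm.isLinear).inter (ht.is_linear_preimage imLm.isLinear)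

/-- Near a smooth point, a side of the contour lies above an arc of it: there are coordinates
`ζ ↦ γ (Re ζ) + Im ζ · n` in which it is the upper half of a rectangle, and the remainder of the
contour does not meet the image of the rectangle. -/
theorem IsSide.exists_chart {Ω : Set ℂ} {σ : ℝ} (h : IsSide Γ Ω σ) (k : Fin N) {i : ℕ}
    (hi : i < (Γ k).n) {x₀ : ℝ} (hx₀ : x₀ ∈ Ioo ((Γ k).t i) ((Γ k).t (i + 1))) :
    ∃ (n : ℂ) (a : ℝ), 0 < a ∧
      Icc (x₀ - a) (x₀ + a) ⊆ Ioo ((Γ k).t i) ((Γ k).t (i + 1)) ∧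
      (∀ t ∈ Icc (x₀ - a) (x₀ + a),
        |(deriv (Γ k).γ t).re * n.im - (deriv (Γ k).γ t).im * n.re| =
          σ * ((deriv (Γ k).γ t).re * n.im - (deriv (Γ k).γ t).im * n.re)) ∧
      InjOn (fun ζ : ℂ => (Γ k).γ ζ.re + ζ.im * n)
        (Icc (x₀ - a) (x₀ + a) ×ℂ Icc (-a) a) ∧
      (∀ t ∈ Icc (x₀ - a) (x₀ + a), ∀ y ∈ Ioc 0 a, (Γ k).γ t + y * n ∈ Ω) ∧
      (∀ t ∈ Icc (x₀ - a) (x₀ + a), ∀ y ∈ Icc (-a) 0, (Γ k).γ t + y * n ∉ Ω) ∧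
      (fun ζ : ℂ => (Γ k).γ ζ.re + ζ.im * n) '' (Ioo (x₀ - a) (x₀ + a) ×ℂ Ioo (-a) a) ∈
        𝓝 ((Γ k).γ x₀) ∧
      (∀ t ∈ Icc ((Γ k).t 0) ((Γ k).t (Γ k).n), t ∉ Ioo (x₀ - a) (x₀ + a) → (Γ k).γ t ∉
        (fun ζ : ℂ => (Γ k).γ ζ.re + ζ.im * n) '' (Ioo (x₀ - a) (x₀ + a) ×ℂ Ioo (-a) a)) ∧
      (∀ l ≠ k, Disjoint (Γ l).image
        ((fun ζ : ℂ => (Γ k).γ ζ.re + ζ.im * n) '' (Ioo (x₀ - a) (x₀ + a) ×ℂ Ioo (-a) a))) := by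
  set c := Γ k with hc
  set u := deriv c.γ x₀ with hu
  have hu0 : u ≠ 0 := c.deriv_ne_zero' hi hx₀
  have hσ : σ ≠ 0 := by rcases h.sign with h | h <;> simp [h]
  have hσ2 : σ * σ = 1 := by rcases h.sign with h | h <;> simp [h]
  set n : ℂ := I * (σ * u) with hn
  set Φ : ℂ → ℂ := fun ζ => c.γ ζ.re + ζ.im * n with hΦ
  set J : ℝ → ℝ := fun t => (deriv c.γ t).re * n.im - (deriv c.γ t).im * n.re with hJ
  have hJ0 : 0 < σ * J x₀ := by
    have : σ * J x₀ = σ * σ * (u.re ^ 2 + u.im ^ 2) := by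
      simp [hJ, hn, ← hu]; ring
    rw [this, hσ2, one_mul, ← Complex.normSq_add_mul_I, re_add_im]
    exact normSq_pos.2 hu0
  -- the inverse function theorem at the smooth point
  have hstrict : HasStrictFDerivAt Φ (frameMap u n) (x₀ : ℂ) := by
    refine hasStrictFDerivAt_frame n ?_
    rw [ofReal_re]
    exact ((c.contDiffAt hi hx₀).hasStrictDerivAt one_ne_zero)
  have hdet : IsUnit (frameMap u n).det := by
    rw [det_frameMap, isUnit_iff_ne_zero]
    exact right_ne_zero_of_mul hJ0.ne'
  set L : ℂ ≃L[ℝ] ℂ := (frameMap u n).toContinuousLinearEquivOfDetNeZero hdet.ne_zero with hL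
  have hstrict' : HasStrictFDerivAt Φ (L : ℂ →L[ℝ] ℂ) (x₀ : ℂ) := by
    rwa [hL, ContinuousLinearMap.coe_toContinuousLinearEquivOfDetNeZero]
  set e := hstrict'.toOpenPartialHomeomorph Φ with he
  have hx₀e : (x₀ : ℂ) ∈ e.source := hstrict'.mem_toOpenPartialHomeomorph_source
  have hΦx₀ : Φ x₀ = c.γ x₀ := by simp [hΦ]
  -- boxes around `x₀` form a basis of neighbourhoods
  have hbox : ∀ s ∈ 𝓝 (x₀ : ℂ), ∃ a > 0, Icc (x₀ - a) (x₀ + a) ×ℂ Icc (-a) a ⊆ s := by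
    intro s hs
    obtain ⟨r, hr, hrs⟩ := Metric.mem_nhds_iff.1 hs
    refine ⟨r / 4, by positivity, ?_⟩
    rintro ζ ⟨h1, h2⟩
    refine hrs (lt_of_le_of_lt ?_ (show r / 2 < r by linarith))
    rw [dist_eq]
    refine (norm_le_abs_re_add_abs_im _).trans ?_
    have h3 : |(ζ - x₀).re| ≤ r / 4 := by
      rw [abs_le]; simp; constructor <;> linarith [h1.1, h1.2]
    have h4 : |(ζ - x₀).im| ≤ r / 4 := by
      rw [abs_le]; simp; exact h2
    linarith
  have hs1 : ∀ᶠ ζ in 𝓝 (x₀ : ℂ), ζ ∈ e.source ∧ ζ.re ∈ Ioo (c.t i) (c.t (i + 1)) ∧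
      0 < σ * J ζ.re := by
    refine Filter.Eventually.and (e.open_source.eventually_mem hx₀e) ?_
    have hre : Tendsto re (𝓝 (x₀ : ℂ)) (𝓝 x₀) := by
      simpa using continuous_re.tendsto (x₀ : ℂ)
    refine Filter.Eventually.and (hre.eventually (isOpen_Ioo.eventually_mem hx₀)) ?_
    refine hre.eventually (p := fun t => 0 < σ * J t) ?_
    have hJc : ContinuousAt (fun t => σ * J t) x₀ := by
      have := (c.continuousOn_deriv hi).continuousAt (isOpen_Ioo.mem_nhds hx₀)
      exact continuousAt_const.mul (((continuous_re.continuousAt.comp this).mul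
        continuousAt_const).sub ((continuous_im.continuousAt.comp this).mul continuousAt_const))
    exact hJc.eventually (lt_mem_nhds hJ0)
  -- the second box is so small that the contour can meet its image only in the arc through the
  -- first box
  obtain ⟨a₁, ha₁, hbox₁⟩ := hbox _ hs1
  obtain ⟨r, hr, hball⟩ := exists_ball_inter_trace_subset h.disjoint k ha₁
    (c.Ioo_piece_subset hi hx₀)
  have hs2 : ∀ᶠ ζ in 𝓝 (x₀ : ℂ), ζ ∈ Icc (x₀ - a₁) (x₀ + a₁) ×ℂ Icc (-a₁) a₁ ∧
      Φ ζ ∈ Metric.ball (c.γ x₀) r := by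
    refine Filter.Eventually.and ?_ ?_
    · have : Ioo (x₀ - a₁) (x₀ + a₁) ×ℂ Ioo (-a₁) a₁ ∈ 𝓝 (x₀ : ℂ) := by
        refine (isOpen_Ioo.reProdIm isOpen_Ioo).mem_nhds ?_
        simp [mem_reProdIm, ha₁]
      filter_upwards [this]
      rintro ζ ⟨h1, h2⟩
      exact ⟨Ioo_subset_Icc_self h1, Ioo_subset_Icc_self h2⟩
    · have := hstrict.continuousAt.eventually (Metric.ball_mem_nhds _ hr)
      rwa [hΦx₀] at this
  obtain ⟨a, ha, hbox₂⟩ := hbox _ hs2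
  have hsrc : ∀ ζ ∈ Icc (x₀ - a) (x₀ + a) ×ℂ Icc (-a) a, ζ ∈ e.source :=
    fun ζ hζ => (hbox₁ (hbox₂ hζ).1).1
  have hinj : InjOn Φ (Icc (x₀ - a) (x₀ + a) ×ℂ Icc (-a) a) := fun ζ hζ ζ' hζ' heq =>
    e.injOn (hsrc ζ hζ) (hsrc ζ' hζ') heq
  have hmk : ∀ {t y : ℝ}, t ∈ Icc (x₀ - a) (x₀ + a) → y ∈ Icc (-a) a →
      (⟨t, y⟩ : ℂ) ∈ Icc (x₀ - a) (x₀ + a) ×ℂ Icc (-a) a := fun ht hy => ⟨ht, hy⟩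
  have h0 : (0 : ℝ) ∈ Icc (-a) a := ⟨by linarith, ha.le⟩
  have ha0 : a ∈ Icc (-a) a := ⟨by linarith, le_rfl⟩
  -- inside the box the contour is the coordinate line `Im ζ = 0`
  have htrace : ∀ ζ ∈ Icc (x₀ - a) (x₀ + a) ×ℂ Icc (-a) a, ∀ l, Φ ζ ∈ (Γ l).image →
      ζ.im = 0 := by
    intro ζ hζ l hζt
    obtain ⟨x, hx, hxe⟩ := hball _ ⟨(hbox₂ hζ).2, image_subset_trace Γ l hζt⟩
    have hx' : (x : ℂ) ∈ e.source := by
      refine (hbox₁ ?_).1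
      have : (x : ℂ) = ⟨x, 0⟩ := rfl
      rw [this]
      exact ⟨Ioo_subset_Icc_self hx.1, ⟨by simp [ha₁.le], ha₁.le⟩⟩
    have : ζ = x := e.injOn (hsrc ζ hζ) hx' (by
      change Φ ζ = Φ x
      rw [← hxe]; simp [hΦ, hc])
    simp [this]
  have hofftrace : ∀ t ∈ Icc (x₀ - a) (x₀ + a), ∀ y ∈ Icc (-a) a, y ≠ 0 →
      c.γ t + y * n ∉ trace Γ := by
    intro t ht y hy hy0 hmem
    obtain ⟨l, hl⟩ := mem_iUnion.1 hmem
    exact hy0 (htrace ⟨t, y⟩ (hmk ht hy) l hl)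
  have hpiece : Icc (x₀ - a) (x₀ + a) ⊆ Ioo (c.t i) (c.t (i + 1)) := fun t ht =>
    (hbox₁ (hbox₂ (hmk ht h0)).1).2.1
  have hΦc : ContinuousOn Φ (Icc (x₀ - a) (x₀ + a) ×ℂ Icc (-a) a) := by
    refine ContinuousOn.add (ContinuousOn.comp (t := Icc (x₀ - a) (x₀ + a)) ?_
      continuous_re.continuousOn fun ζ hζ => hζ.1) (Continuous.continuousOn (by fun_prop))
    exact fun t ht => (c.hasDerivAt hi (hpiece ht)).continuousAt.continuousWithinAt
  -- a connected part of the box that avoids the contour lies on one side of it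
  have hdich : ∀ s : Set ℝ, Convex ℝ s → s ⊆ Icc (-a) a → (0 : ℝ) ∉ s →
      Φ '' (Icc (x₀ - a) (x₀ + a) ×ℂ s) ⊆ Ω ∨
        Φ '' (Icc (x₀ - a) (x₀ + a) ×ℂ s) ⊆ (closure Ω)ᶜ := by
    intro s hs hsub hs0
    have hsub' : Icc (x₀ - a) (x₀ + a) ×ℂ s ⊆ Icc (x₀ - a) (x₀ + a) ×ℂ Icc (-a) a := by
      rintro ζ ⟨h1, h2⟩
      exact ⟨h1, hsub h2⟩
    refine IsPreconnected.subset_or_subset h.isOpen isClosed_closure.isOpen_compl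
      (disjoint_compl_right.mono_left subset_closure) ?_
      ((convex_reProdIm (convex_Icc _ _) hs).isPreconnected.image _ (hΦc.mono hsub'))
    rintro _ ⟨ζ, hζ, rfl⟩
    by_contra hcon
    rw [mem_union, not_or, notMem_compl_iff] at hcon
    have hfr : Φ ζ ∈ frontier Ω := by
      rw [h.isOpen.frontier_eq]
      exact ⟨hcon.2, hcon.1⟩
    rw [h.frontier_eq] at hfr
    refine hofftrace ζ.re hζ.1 ζ.im (hsub hζ.2) (fun h0 => hs0 ?_) hfr
    rw [← h0]
    exact hζ.2
  have hx₀m : x₀ ∈ Icc (x₀ - a) (x₀ + a) := ⟨by linarith, by linarith⟩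
  obtain ⟨ε, hε1, hε2⟩ := ((h.left_right k i hi x₀ hx₀).and (Ioc_mem_nhdsGT ha)).exists
  have hup : Φ '' (Icc (x₀ - a) (x₀ + a) ×ℂ Ioc 0 a) ⊆ Ω := by
    refine (hdich _ (convex_Ioc 0 a) (fun y hy => ⟨by linarith [hy.1], hy.2⟩)
      (by simp)).resolve_right fun hcon => ?_
    have := hcon (mem_image_of_mem Φ (show (⟨x₀, ε⟩ : ℂ) ∈ _ from ⟨hx₀m, hε2⟩))
    exact this (subset_closure hε1.1)
  have hlow : Φ '' (Icc (x₀ - a) (x₀ + a) ×ℂ Ico (-a) 0) ⊆ (closure Ω)ᶜ := by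
    refine (hdich _ (convex_Ico (-a) 0) (fun y hy => ⟨hy.1, by linarith [hy.2]⟩)
      (by simp)).resolve_left fun hcon => ?_
    have := hcon (mem_image_of_mem Φ (show (⟨x₀, -ε⟩ : ℂ) ∈ _ from
      ⟨hx₀m, ⟨by simpa using hε2.2, by simpa using hε2.1⟩⟩))
    refine hε1.2 (subset_closure ?_)
    convert this using 1
    simp [hΦ, hn, hu]; ring
  refine ⟨n, a, ha, hpiece, ?_, hinj, ?_, ?_, ?_, ?_, ?_⟩
  · intro t ht
    have h1 : 0 < σ * J t := (hbox₁ (hbox₂ (hmk ht h0)).1).2.2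
    have h2 : |σ| = 1 := by rcases h.sign with h | h <;> simp [h]
    change |J t| = σ * J t
    rw [← abs_of_pos h1, abs_mul, h2, one_mul]
  · exact fun t ht y hy => hup ⟨⟨t, y⟩, ⟨ht, hy⟩, rfl⟩
  · intro t ht y hy hmem
    rcases hy.2.eq_or_lt with h1 | h1
    · have h2 : c.γ t + y * n ∈ frontier Ω := by
        rw [h.frontier_eq, h1]
        refine image_subset_trace Γ k
          ⟨t, c.Icc_piece_subset hi (Ioo_subset_Icc_self (hpiece ht)), ?_⟩
        simp [hc]
      rw [h.isOpen.frontier_eq] at h2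
      exact h2.2 hmem
    · exact hlow ⟨⟨t, y⟩, ⟨ht, ⟨hy.1, h1⟩⟩, rfl⟩ (subset_closure hmem)
  · have hopen : IsOpen (Ioo (x₀ - a) (x₀ + a) ×ℂ Ioo (-a) a) := isOpen_Ioo.reProdIm isOpen_Ioo
    have : IsOpen (e '' (Ioo (x₀ - a) (x₀ + a) ×ℂ Ioo (-a) a)) := by
      refine e.isOpen_image_of_subset_source hopen ?_
      rintro ζ ⟨h1, h2⟩
      exact hsrc ζ ⟨Ioo_subset_Icc_self h1, Ioo_subset_Icc_self h2⟩
    refine this.mem_nhds ⟨x₀, ?_, hΦx₀⟩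
    simp [mem_reProdIm, ha]
  · rintro t ht htn ⟨ζ, ⟨h1, h2⟩, hζe⟩
    have hζ : ζ ∈ Icc (x₀ - a) (x₀ + a) ×ℂ Icc (-a) a :=
      ⟨Ioo_subset_Icc_self h1, Ioo_subset_Icc_self h2⟩
    have him := htrace ζ hζ k ⟨t, ht, hζe.symm⟩
    have hre : c.γ ζ.re = c.γ t := by simpa [him] using hζe
    have h3 := c.Ioo_piece_subset hi (hpiece (Ioo_subset_Icc_self h1))
    rcases ht.2.eq_or_lt with h4 | h4
    · have : ζ.re = c.t 0 := by
        refine c.injOn ⟨h3.1.le, h3.2⟩ ⟨le_rfl, c.t_zero_lt⟩ ?_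
        rw [hre, h4, c.closed]
      exact h3.1.ne this.symm
    · exact htn (c.injOn ⟨h3.1.le, h3.2⟩ ⟨ht.1, h4⟩ hre ▸ h1)
  · intro l hl
    rw [disjoint_right]
    rintro _ ⟨ζ, ⟨h1, h2⟩, rfl⟩ hmem
    have hζ : ζ ∈ Icc (x₀ - a) (x₀ + a) ×ℂ Icc (-a) a :=
      ⟨Ioo_subset_Icc_self h1, Ioo_subset_Icc_self h2⟩
    have him := htrace ζ hζ l hmem
    have h3 := c.Ioo_piece_subset hi (hpiece (Ioo_subset_Icc_self h1))
    refine disjoint_left.1 (h.disjoint hl) hmem ⟨ζ.re, Ioo_subset_Icc_self h3, ?_⟩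
    simp [him, hc]

end Green

/-! ### Test functions -/

section Test

/-- Test functions: `C¹` functions with compact support. -/
structure IsTest (φ : ℂ → ℂ) : Prop where
  contDiff : ContDiff ℝ 1 φ
  hasCompactSupport : HasCompactSupport φ

theorem IsTest.mul_left {φ b : ℂ → ℂ} (hφ : IsTest φ) (hb : ContDiff ℝ 1 b) :
    IsTest (fun w => b w * φ w) :=
  ⟨hb.mul hφ.1, hφ.2.mul_left⟩

theorem dbar_add {φ ψ : ℂ → ℂ} (hφ : ContDiff ℝ 1 φ) (hψ : ContDiff ℝ 1 ψ) (w : ℂ) :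
    dbar (fun w => φ w + ψ w) w = dbar φ w + dbar ψ w := by
  simp only [dbar]
  rw [fderiv_fun_add (hφ.differentiable one_ne_zero w) (hψ.differentiable one_ne_zero w)]
  simp only [add_apply]
  ring

theorem dbar_mul {φ ψ : ℂ → ℂ} (hφ : ContDiff ℝ 1 φ) (hψ : ContDiff ℝ 1 ψ) (w : ℂ) :
    dbar (fun w => φ w * ψ w) w = dbar φ w * ψ w + φ w * dbar ψ w := by
  simp only [dbar]
  rw [fderiv_fun_mul (hφ.differentiable one_ne_zero w) (hψ.differentiable one_ne_zero w)]
  simp only [add_apply, smul_apply, smul_eq_mul]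
  ring

theorem dbar_comp_scale {b : ℂ → ℂ} (hb : ContDiff ℝ 1 b) (c : ℂ) (s : ℝ) (w : ℂ) :
    dbar (fun w => b (s • (w - c))) w = s * dbar b (s • (w - c)) := by
  have h1 : HasFDerivAt (fun w : ℂ => s • (w - c)) (s • ContinuousLinearMap.id ℝ ℂ) w :=
    ((hasFDerivAt_id w).sub_const c).const_smul s
  have h2 := ((hb.differentiable one_ne_zero (s • (w - c))).hasFDerivAt.comp w h1).fderiv
  have h3 : (fun w => b (s • (w - c))) = b ∘ fun w => s • (w - c) := rfl
  simp only [dbar]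
  rw [h3, h2]
  simp only [ContinuousLinearMap.comp_apply, smul_apply,
    ContinuousLinearMap.id_apply]
  rw [map_smul, map_smul]
  simp only [real_smul]
  ring

/-- A property of test functions that is additive and holds locally holds globally. -/
theorem IsTest.induction_local {G : (ℂ → ℂ) → Prop} (h0 : G fun _ => 0)
    (hadd : ∀ φ ψ, IsTest φ → IsTest ψ → G φ → G ψ → G fun w => φ w + ψ w) {φ : ℂ → ℂ}
    (hφ : IsTest φ)
    (hloc : ∀ p ∈ tsupport φ, ∃ V ∈ 𝓝 p, ∀ ψ, IsTest ψ → tsupport ψ ⊆ V → G ψ) : G φ := by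
  have hch : ∀ p ∈ tsupport φ, ∃ b : ContDiffBump p,
      ∀ ψ, IsTest ψ → tsupport ψ ⊆ Metric.closedBall p b.rOut → G ψ := by
    intro p hp
    obtain ⟨V, hV, hG⟩ := hloc p hp
    obtain ⟨r, hr, hrV⟩ := Metric.nhds_basis_closedBall.mem_iff.1 hV
    exact ⟨⟨r / 2, r, by positivity, by linarith⟩, fun ψ hψ hs => hG ψ hψ (hs.trans hrV)⟩
  choose! b hb using hch
  obtain ⟨T, hT, hcov⟩ := hφ.2.isCompact.elim_nhds_subcover (fun p => Metric.ball p (b p).rIn)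
    fun p _ => Metric.ball_mem_nhds p (b p).rIn_pos
  clear hloc
  have key : ∀ T : Finset ℂ, (∀ p ∈ T, ∀ ψ, IsTest ψ →
      tsupport ψ ⊆ Metric.closedBall p (b p).rOut → G ψ) →
      ∀ ψ, IsTest ψ → tsupport ψ ⊆ ⋃ p ∈ T, Metric.ball p (b p).rIn → G ψ := by
    intro T
    induction T using Finset.induction_on with
    | empty =>
      intro _ ψ _ hs
      have : tsupport ψ = ∅ := by simpa [subset_empty_iff] using hs
      rw [tsupport_eq_empty_iff] at this
      rw [this]
      exact h0
    | insert p T hp ih =>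
      intro hG ψ hψ hs
      have hbs : ContDiff ℝ 1 fun w => ((b p w : ℝ) : ℂ) :=
        ofRealCLM.contDiff.comp (b p).contDiff
      have hbs' : ContDiff ℝ 1 fun w => 1 - ((b p w : ℝ) : ℂ) := contDiff_const.sub hbs
      have h1 : G fun w => ((b p w : ℝ) : ℂ) * ψ w := by
        refine hG p (Finset.mem_insert_self p T) _ (hψ.mul_left hbs) ?_
        rw [← (b p).tsupport_eq]
        refine closure_mono fun w hw => ?_
        simp only [Function.mem_support] at hw ⊢
        exact fun h => hw (by simp [h])
      have h2 : G fun w => (1 - ((b p w : ℝ) : ℂ)) * ψ w := by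
        refine ih (fun q hq => hG q (Finset.mem_insert_of_mem hq)) _ (hψ.mul_left hbs') ?_
        intro w hw
        have hw1 : w ∈ tsupport ψ :=
          closure_mono (fun w hw => right_ne_zero_of_mul hw) hw
        have hw2 : w ∉ Metric.ball p (b p).rIn := by
          intro hwb
          have : tsupport (fun w => (1 - ((b p w : ℝ) : ℂ)) * ψ w) ⊆
              (Metric.ball p (b p).rIn)ᶜ := by
            refine closure_minimal ?_ Metric.isOpen_ball.isClosed_compl
            intro x hx hxb
            refine hx ?_
            simp [(b p).one_of_mem_closedBall (Metric.ball_subset_closedBall hxb)]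
          exact this hw hwb
        have := hs hw1
        simp only [Finset.mem_insert, iUnion_iUnion_eq_or_left, mem_union] at this
        exact this.resolve_left hw2
      have := hadd _ _ (hψ.mul_left hbs) (hψ.mul_left hbs') h1 h2
      convert this using 2
      ring
  exact key T (fun p hp => hb p (hT p hp)) φ hφ hcov

end Test

/-! ### Green's formula away from the break points -/

section Green

variable {E : Type*} [NormedAddCommGroup E] [NormedSpace ℂ E] {N : ℕ}
  {Γ : Fin N → PwC1ClosedCurve} {Ω : Set ℂ} {σ : ℝ}

theorem IsSide.trace_subset_closure (h : IsSide Γ Ω σ) : trace Γ ⊆ closure Ω := by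
  rw [← h.frontier_eq]; exact frontier_subset_closure

theorem IsSide.disjoint_trace (h : IsSide Γ Ω σ) : Disjoint Ω (trace Γ) := by
  rw [← h.frontier_eq, disjoint_iff_inter_eq_empty]
  exact h.isOpen.inter_frontier_eq

theorem integrableOn_dbar {F : ℂ → E} (hFc : ContinuousOn F (closure Ω)) {φ : ℂ → ℂ}
    (hφ : IsTest φ) (hΩ : IsOpen Ω) : IntegrableOn (fun w => dbar φ w • F w) Ω := by
  have h1 : IntegrableOn (fun w => dbar φ w • F w) (closure Ω ∩ tsupport φ) := by
    refine ContinuousOn.integrableOn_compact (hφ.2.isCompact.inter_left isClosed_closure) ?_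
    exact ((continuous_dbar hφ.1).continuousOn.smul hFc).mono inter_subset_left
  refine h1.of_forall_sdiff_eq_zero hΩ.measurableSet ?_
  rintro w ⟨hw, hw'⟩
  rw [dbar_eq_zero_of_notMem_tsupport, zero_smul]
  exact fun h => hw' ⟨subset_closure hw, h⟩

/-- The defect in Green's formula `∫_Ω 2 ∂φ/∂z̄ F dA = -iσ ∫_Γ φ F dw`. -/
noncomputable def greenDefect (Γ : Fin N → PwC1ClosedCurve) (Ω : Set ℂ) (σ : ℝ) (F : ℂ → E)
    (φ : ℂ → ℂ) : E :=
  (∫ w in Ω, dbar φ w • F w) - (-I * σ) • contourIntegral Γ fun w => φ w • F w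

theorem IsSide.greenDefect_add (h : IsSide Γ Ω σ) {F : ℂ → E} (hFc : ContinuousOn F (closure Ω))
    {φ ψ : ℂ → ℂ} (hφ : IsTest φ) (hψ : IsTest ψ) :
    greenDefect Γ Ω σ F (fun w => φ w + ψ w) = greenDefect Γ Ω σ F φ + greenDefect Γ Ω σ F ψ := by
  have hF' := hFc.mono h.trace_subset_closure
  simp only [greenDefect, dbar_add hφ.1 hψ.1, add_smul]
  rw [integral_add (integrableOn_dbar hFc hφ h.isOpen) (integrableOn_dbar hFc hψ h.isOpen),
    contourIntegral_add Γ (g := fun w => φ w • F w) (h := fun w => ψ w • F w)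
      (hφ.1.continuous.continuousOn.smul hF') (hψ.1.continuous.continuousOn.smul hF'), smul_add]
  abel

theorem contourIntegral_eq_zero {g : ℂ → E} (hg : ∀ w ∈ trace Γ, g w = 0) :
    contourIntegral Γ g = 0 := by
  rw [contourIntegral_congr Γ (h := fun _ => 0) hg]
  simp [contourIntegral, PwC1ClosedCurve.integral]

variable [CompleteSpace E]

theorem IsSide.green_near_smooth (h : IsSide Γ Ω σ) {F : ℂ → E} (hF : DifferentiableOn ℂ F Ω)
    (hFc : ContinuousOn F (closure Ω)) (k : Fin N) {i : ℕ} (hi : i < (Γ k).n) {x₀ : ℝ}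
    (hx₀ : x₀ ∈ Ioo ((Γ k).t i) ((Γ k).t (i + 1))) :
    ∃ V ∈ 𝓝 ((Γ k).γ x₀), ∀ φ, IsTest φ → tsupport φ ⊆ V → greenDefect Γ Ω σ F φ = 0 := by
  obtain ⟨n, a, ha, hpiece, hJ, hinj, hup, hlow, hV, hk, hl⟩ := h.exists_chart k hi hx₀
  refine ⟨_, hV, fun φ hφ hs => ?_⟩
  have hpq : x₀ - a ≤ x₀ + a := by linarith
  have hsub : Icc (x₀ - a) (x₀ + a) ⊆ Icc ((Γ k).t 0) ((Γ k).t (Γ k).n) := fun t ht =>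
    Ioo_subset_Icc_self ((Γ k).Ioo_piece_subset hi (hpiece ht))
  have h1 := green_arc hpq ha (fun t ht => (Γ k).hasDerivAt hi (hpiece ht))
    (((Γ k).continuousOn_deriv hi).mono hpiece) hJ hinj h.isOpen hup
    (fun t ht => h.trace_subset_closure (image_subset_trace Γ k ⟨t, hsub ht, rfl⟩)) hlow hF hFc
    hφ.1 hs
  rw [greenDefect, h1, sub_eq_zero]
  congr 1
  rw [contourIntegral, Finset.sum_eq_single k]
  · rw [PwC1ClosedCurve.integral, intervalIntegral.integral_of_le (Γ k).t_zero_lt.le,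
      intervalIntegral.integral_of_le hpq]
    have h2 : ∫ t in Ioc ((Γ k).t 0) ((Γ k).t (Γ k).n),
        deriv (Γ k).γ t • φ ((Γ k).γ t) • F ((Γ k).γ t) =
        ∫ t in Ioc (x₀ - a) (x₀ + a), deriv (Γ k).γ t • φ ((Γ k).γ t) • F ((Γ k).γ t) := by
      refine setIntegral_eq_of_subset_of_forall_sdiff_eq_zero measurableSet_Ioc
        (Ioc_subset_Ioc (hsub (left_mem_Icc.2 hpq)).1 (hsub (right_mem_Icc.2 hpq)).2) ?_
      rintro t ⟨ht, ht'⟩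
      rw [image_eq_zero_of_notMem_tsupport (f := φ), zero_smul, smul_zero]
      exact fun hmem => hk t (Ioc_subset_Icc_self ht) (fun h' => ht' (Ioo_subset_Ioc_self h'))
        (hs hmem)
    rw [h2]
    simp only [smul_comm (deriv _ _)]
  · intro l _ hlk
    rw [PwC1ClosedCurve.integral_congr (h := fun _ => (0 : E))]
    · simp [PwC1ClosedCurve.integral]
    · intro w hw
      simp only
      rw [image_eq_zero_of_notMem_tsupport (f := φ), zero_smul]
      exact fun hmem => disjoint_left.1 (hl l hlk) hw (hs hmem)
  · simp

/-- Inside `Ω`, Green's formula is that of a strip above a horizontal segment, on all of whose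
sides the test function vanishes. -/
theorem IsSide.green_near_interior (h : IsSide Γ Ω σ) {F : ℂ → E} (hF : DifferentiableOn ℂ F Ω)
    {p : ℂ} (hp : p ∈ Ω) :
    ∃ V ∈ 𝓝 p, ∀ φ, IsTest φ → tsupport φ ⊆ V → greenDefect Γ Ω σ F φ = 0 := by
  obtain ⟨r, hr, hrΩ⟩ := Metric.isOpen_iff.1 h.isOpen p hp
  set R : Set ℂ := Ioo (p.re - r / 4) (p.re + r / 4) ×ℂ Ioo (p.im - r / 4) (p.im + r / 4) with hR
  have hRo : IsOpen R := isOpen_Ioo.reProdIm isOpen_Ioo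
  have hcl : Icc (p.re - r / 4) (p.re + r / 4) ×ℂ Icc (p.im - r / 4) (p.im + r / 4) ⊆ Ω := by
    rintro ζ ⟨h1, h2⟩
    refine hrΩ (lt_of_le_of_lt ?_ (show r / 2 < r by linarith))
    rw [dist_eq]
    refine (norm_le_abs_re_add_abs_im _).trans ?_
    have h3 : |(ζ - p).re| ≤ r / 4 := by
      rw [abs_le]; simp; constructor <;> linarith [h1.1, h1.2]
    have h4 : |(ζ - p).im| ≤ r / 4 := by
      rw [abs_le]; simp; constructor <;> linarith [h2.1, h2.2]
    linarith
  have hRcl : R ⊆ Icc (p.re - r / 4) (p.re + r / 4) ×ℂ Icc (p.im - r / 4) (p.im + r / 4) := by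
    rintro ζ ⟨h1, h2⟩
    exact ⟨Ioo_subset_Icc_self h1, Ioo_subset_Icc_self h2⟩
  refine ⟨R, hRo.mem_nhds ?_, fun φ hφ hs => ?_⟩
  · simp [hR, mem_reProdIm, hr]
  have h0 : ∀ t y : ℝ, (t ∉ Ioo (p.re - r / 4) (p.re + r / 4) ∨
      y ∉ Ioo (p.im - r / 4) (p.im + r / 4)) → φ (t + y * I) = 0 := by
    intro t y hty
    refine image_eq_zero_of_notMem_tsupport fun hmem => ?_
    have := hs hmem
    simp [hR, mem_reProdIm] at this
    rcases hty with h | h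
    · exact h ⟨by linarith, by linarith⟩
    · exact h ⟨by linarith, by linarith⟩
  have hs1 := green_strip (γ := fun t => (t : ℂ)) (γ' := fun _ => 1) (n := I)
    (show p.re - r / 4 ≤ p.re + r / 4 by linarith) (show p.im - r / 4 ≤ p.im + r / 4 by linarith)
    (fun t _ => by simpa using (hasDerivAt_id t).ofReal_comp) continuousOn_const h.isOpen
    (fun t ht y hy => hcl (by simpa [mem_reProdIm] using And.intro ht hy)) hF hφ.1
    (fun y _ => h0 _ _ (Or.inl (by simp))) (fun y _ => h0 _ _ (Or.inl (by simp)))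
    (fun t _ => h0 _ _ (Or.inr (by simp)))
  have hs2 : ∫ w in Ω, dbar φ w • F w = ∫ w in R, dbar φ w • F w := by
    refine setIntegral_eq_of_subset_of_forall_sdiff_eq_zero h.isOpen.measurableSet
      (hRcl.trans hcl) ?_
    rintro w ⟨_, hw⟩
    rw [dbar_eq_zero_of_notMem_tsupport (fun hmem => hw (hs hmem)), zero_smul]
  have hs3 : contourIntegral Γ (fun w => φ w • F w) = 0 := by
    refine contourIntegral_eq_zero fun w hw => ?_
    rw [image_eq_zero_of_notMem_tsupport (f := φ), zero_smul]
    exact fun hmem => disjoint_left.1 h.disjoint_trace (hcl (hRcl (hs hmem))) hw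
  rw [greenDefect, hs3, hs2, setIntegral_reProdIm (by linarith) (by linarith)]
  · have hz : ∀ t : ℝ, φ (t + ((p.im - r / 4 : ℝ) : ℂ) * I) = 0 := fun t =>
      h0 _ _ (Or.inr (by simp))
    simp only [hz] at hs1
    simpa using hs1
  · refine ContinuousOn.integrableOn_compact (isCompact_Icc.reProdIm isCompact_Icc) ?_
    exact (continuous_dbar hφ.1).continuousOn.smul (hF.continuousOn.mono hcl)

omit [CompleteSpace E] in
theorem IsSide.green_near_exterior (h : IsSide Γ Ω σ) {F : ℂ → E} {p : ℂ} (hp : p ∉ closure Ω) :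
    ∃ V ∈ 𝓝 p, ∀ φ, IsTest φ → tsupport φ ⊆ V → greenDefect Γ Ω σ F φ = 0 := by
  refine ⟨(closure Ω)ᶜ, isClosed_closure.isOpen_compl.mem_nhds hp, fun φ hφ hs => ?_⟩
  rw [greenDefect, setIntegral_eq_zero_of_forall_eq_zero, contourIntegral_eq_zero]
  · simp
  · intro w hw
    rw [image_eq_zero_of_notMem_tsupport (f := φ), zero_smul]
    exact fun hmem => hs hmem (h.trace_subset_closure hw)
  · intro w hw
    rw [dbar_eq_zero_of_notMem_tsupport (fun hmem => hs hmem (subset_closure hw)), zero_smul]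

/-- The break points of a contour. -/
def corners (Γ : Fin N → PwC1ClosedCurve) : Set ℂ := ⋃ k, (Γ k).γ '' ((Γ k).t '' Iic (Γ k).n)

theorem finite_corners (Γ : Fin N → PwC1ClosedCurve) : (corners Γ).Finite :=
  finite_iUnion fun _ => ((finite_Iic _).image _).image _

theorem exists_smooth_of_notMem_corners {w : ℂ} (hw : w ∈ trace Γ) (hc : w ∉ corners Γ) :
    ∃ k, ∃ i < (Γ k).n, ∃ x ∈ Ioo ((Γ k).t i) ((Γ k).t (i + 1)), (Γ k).γ x = w := by
  obtain ⟨k, x, hx, rfl⟩ := mem_iUnion.1 hw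
  obtain ⟨i, hi, hxi⟩ := (Γ k).exists_mem_Ioo_of_ne hx fun i hi h =>
    hc (mem_iUnion.2 ⟨k, x, ⟨i, hi, h.symm⟩, rfl⟩)
  exact ⟨k, i, hi, x, hxi, rfl⟩

/-- Green's formula for test functions that vanish near the break points, from its local forms. -/
theorem IsSide.green_off_corners (h : IsSide Γ Ω σ) {F : ℂ → E} (hF : DifferentiableOn ℂ F Ω)
    (hFc : ContinuousOn F (closure Ω)) {φ : ℂ → ℂ} (hφ : IsTest φ)
    (hs : ∀ p ∈ tsupport φ, p ∉ corners Γ) : greenDefect Γ Ω σ F φ = 0 := by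
  refine hφ.induction_local (G := fun φ => greenDefect Γ Ω σ F φ = 0) ?_ ?_ ?_
  · simp [greenDefect, dbar, contourIntegral, PwC1ClosedCurve.integral]
  · intro φ ψ hφ hψ h1 h2
    rw [h.greenDefect_add hFc hφ hψ, h1, h2, add_zero]
  · intro p hp
    by_cases hpΩ : p ∈ Ω
    · exact h.green_near_interior hF hpΩ
    by_cases hpc : p ∈ closure Ω
    · rw [h.closure_eq] at hpc
      obtain ⟨k, i, hi, x, hx, rfl⟩ :=
        exists_smooth_of_notMem_corners (hpc.resolve_left hpΩ) (hs p hp)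
      exact h.green_near_smooth hF hFc k hi hx
    · exact h.green_near_exterior hpc

end Green

/-! ### Green's formula for piecewise `C¹` contours -/

section Corners

variable {E : Type*} [NormedAddCommGroup E] [NormedSpace ℂ E] {N : ℕ}
  {Γ : Fin N → PwC1ClosedCurve} {Ω : Set ℂ} {σ : ℝ}

/-- A complex-valued cutoff function, equal to `1` on the unit disc and to `0` outside the disc of
radius `2`. -/
noncomputable def unitBump (w : ℂ) : ℂ :=
  ((⟨1, 2, one_pos, one_lt_two⟩ : ContDiffBump (0 : ℂ)) w : ℝ)

theorem contDiff_unitBump : ContDiff ℝ 1 unitBump :=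
  ofRealCLM.contDiff.comp (ContDiffBump.contDiff _)

theorem unitBump_of_norm_le {w : ℂ} (h : ‖w‖ ≤ 1) : unitBump w = 1 := by
  rw [unitBump, ContDiffBump.one_of_mem_closedBall _ (by simpa using h), ofReal_one]

theorem unitBump_of_le_norm {w : ℂ} (h : 2 ≤ ‖w‖) : unitBump w = 0 := by
  rw [unitBump, ContDiffBump.zero_of_le_dist _ (by simpa using h), ofReal_zero]

theorem norm_unitBump_le (w : ℂ) : ‖unitBump w‖ ≤ 1 := by
  rw [unitBump, norm_real, Real.norm_of_nonneg (ContDiffBump.nonneg _)]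
  exact ContDiffBump.le_one _

theorem isTest_unitBump : IsTest unitBump where
  contDiff := contDiff_unitBump
  hasCompactSupport := by
    refine HasCompactSupport.intro (isCompact_closedBall (0 : ℂ) 2) fun w hw => ?_
    refine unitBump_of_le_norm ?_
    simpa using (not_le.1 (by simpa using hw)).le

theorem exists_norm_dbar_le {φ : ℂ → ℂ} (hφ : IsTest φ) : ∃ C, ∀ w, ‖dbar φ w‖ ≤ C := by
  obtain ⟨C, hC⟩ := hφ.2.isCompact.exists_bound_of_continuousOn
    (continuous_dbar hφ.1).continuousOn
  refine ⟨max C 0, fun w => ?_⟩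
  by_cases hw : w ∈ tsupport φ
  · exact (hC w hw).trans (le_max_left _ _)
  · rw [dbar_eq_zero_of_notMem_tsupport hw]; simp

/-- The cutoff function at scale `1 / (m + 1)` around `c`. -/
noncomputable def cornerBump (c : ℂ) (m : ℕ) (w : ℂ) : ℂ := unitBump (((m : ℝ) + 1) • (w - c))

theorem contDiff_cornerBump (c : ℂ) (m : ℕ) : ContDiff ℝ 1 (cornerBump c m) := by
  have : ContDiff ℝ 1 fun w : ℂ => ((m : ℝ) + 1) • (w - c) := by fun_prop
  exact contDiff_unitBump.comp this

theorem norm_cornerBump_arg (c : ℂ) (m : ℕ) (w : ℂ) :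
    ‖((m : ℝ) + 1) • (w - c)‖ = ((m : ℝ) + 1) * ‖w - c‖ := by
  rw [norm_smul, Real.norm_of_nonneg (by positivity)]

theorem cornerBump_of_dist_le {c w : ℂ} {m : ℕ} (h : 2 / ((m : ℝ) + 1) ≤ ‖w - c‖) :
    cornerBump c m w = 0 := by
  refine unitBump_of_le_norm ?_
  rw [norm_cornerBump_arg]
  rwa [div_le_iff₀ (by positivity), mul_comm] at h

theorem tendsto_cornerBump {c w : ℂ} (h : w ≠ c) :
    ∀ᶠ m : ℕ in atTop, cornerBump c m w = 0 := by
  have h0 : 0 < ‖w - c‖ := norm_pos_iff.2 (sub_ne_zero.2 h)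
  have h1 : Tendsto (fun m : ℕ => 2 / ((m : ℝ) + 1)) atTop (𝓝 0) := by
    have := (tendsto_one_div_add_atTop_nhds_zero_nat (𝕜 := ℝ)).const_mul 2
    simpa [div_eq_mul_inv] using this
  filter_upwards [h1.eventually (gt_mem_nhds h0)] with m hm
  exact cornerBump_of_dist_le hm.le

theorem PwC1ClosedCurve.ae_ne (c : PwC1ClosedCurve) (z : ℂ) :
    ∀ᵐ x ∂volume.restrict (Ioc (c.t 0) (c.t c.n)), c.γ x ≠ z := by
  have hfin : ({x ∈ Ico (c.t 0) (c.t c.n) | c.γ x = z} ∪ {c.t c.n}).Finite := by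
    refine (Set.Subsingleton.finite ?_).union (finite_singleton _)
    rintro x ⟨hx, hxz⟩ y ⟨hy, hyz⟩
    exact c.injOn hx hy (hxz.trans hyz.symm)
  filter_upwards [ae_restrict_mem measurableSet_Ioc,
    ae_restrict_of_ae (hfin.countable.ae_notMem volume)] with x hx hx' hxz
  rcases hx.2.eq_or_lt with h | h
  · exact hx' (Or.inr h)
  · exact hx' (Or.inl ⟨⟨hx.1.le, h⟩, hxz⟩)

/-- The cutoff tends to `0` at all parameters except the finitely many ones of the point `c`. -/
theorem tendsto_contourIntegral_cornerBump {g : ℂ → E} (hg : ContinuousOn g (trace Γ)) (c : ℂ) :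
    Tendsto (fun m => contourIntegral Γ fun w => cornerBump c m w • g w) atTop (𝓝 0) := by
  rw [show (0 : E) = ∑ _k : Fin N, (0 : E) by simp]
  refine tendsto_finsetSum _ fun k _ => ?_
  have hgk := hg.mono (image_subset_trace Γ k)
  obtain ⟨M, hM0, hM⟩ := (Γ k).exists_ae_norm_deriv_le
  obtain ⟨C, hC⟩ := (Γ k).isCompact_image.exists_bound_of_continuousOn hgk
  rw [show (0 : E) = ∫ _x in (Γ k).t 0..(Γ k).t (Γ k).n, (0 : E) from
    intervalIntegral.integral_zero.symm]
  simp only [PwC1ClosedCurve.integral, intervalIntegral.integral_of_le (Γ k).t_zero_lt.le]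
  refine tendsto_integral_of_dominated_convergence (fun _ => M * C) (fun m => ?_)
    (integrable_const _) (fun m => ?_) ?_
  · exact (Γ k).aestronglyMeasurable_integrand
      ((contDiff_cornerBump c m).continuous.continuousOn.smul hgk)
  · filter_upwards [hM, ae_restrict_mem measurableSet_Ioc] with x hx hx'
    rw [norm_smul, norm_smul]
    refine mul_le_mul hx ?_ (by positivity) hM0
    have h1 := hC _ (mem_image_of_mem _ (Ioc_subset_Icc_self hx'))
    calc _ ≤ 1 * ‖g ((Γ k).γ x)‖ :=
          mul_le_mul_of_nonneg_right (norm_unitBump_le _) (norm_nonneg _)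
      _ ≤ C := by rwa [one_mul]
  · filter_upwards [(Γ k).ae_ne c] with x hx
    refine tendsto_const_nhds.congr' ?_
    filter_upwards [tendsto_cornerBump hx] with m hm
    rw [hm, zero_smul, smul_zero]

/-- The gradient of the cutoff at scale `1 / (m + 1)` is of the order of `m`, on a disc with area
of the order of `m⁻²`; hence the break points do not contribute to Green's formula. -/
theorem tendsto_integral_cornerBump (hΩ : IsOpen Ω) {F : ℂ → E}
    (hFc : ContinuousOn F (closure Ω)) {φ : ℂ → ℂ} (hφ : IsTest φ) (c : ℂ) :
    Tendsto (fun m => ∫ w in Ω, dbar (fun w => cornerBump c m w * φ w) w • F w) atTop (𝓝 0) := by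
  obtain ⟨A, hA⟩ := exists_norm_dbar_le hφ
  obtain ⟨B, hB⟩ := exists_norm_dbar_le isTest_unitBump
  obtain ⟨P, hP⟩ := hφ.1.continuous.bounded_above_of_compact_support hφ.2
  obtain ⟨M, hM⟩ := (hφ.2.isCompact.inter_left isClosed_closure).exists_bound_of_continuousOn
    (hFc.mono (inter_subset_left (t := tsupport φ)))
  have hA0 : 0 ≤ A := (norm_nonneg _).trans (hA 0)
  have hB0 : 0 ≤ B := (norm_nonneg _).trans (hB 0)
  have hP0 : 0 ≤ P := (norm_nonneg _).trans (hP 0)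
  have hbound : ∀ m : ℕ, ‖∫ w in Ω, dbar (fun w => cornerBump c m w * φ w) w • F w‖ ≤
      ((m + 1) * (B * P + A) * |M|) * ((2 / ((m : ℝ) + 1)) ^ 2 * Real.pi) := by
    intro m
    have hm : (1 : ℝ) ≤ m + 1 := by simp
    have h1 : ∫ w in Ω, dbar (fun w => cornerBump c m w * φ w) w • F w =
        ∫ w in Ω ∩ Metric.closedBall c (2 / ((m : ℝ) + 1)),
          dbar (fun w => cornerBump c m w * φ w) w • F w := by
      refine setIntegral_eq_of_subset_of_forall_sdiff_eq_zero hΩ.measurableSet inter_subset_left ?_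
      rintro w ⟨hw, hw'⟩
      rw [dbar_eq_zero_of_notMem_tsupport, zero_smul]
      intro hmem
      have hsub : tsupport (fun w => cornerBump c m w * φ w) ⊆
          Metric.closedBall c (2 / ((m : ℝ) + 1)) := by
        refine closure_minimal (fun x hx => ?_) Metric.isClosed_closedBall
        by_contra hxb
        rw [Metric.mem_closedBall, not_le, dist_eq] at hxb
        exact hx (by simp [cornerBump_of_dist_le hxb.le])
      exact hw' ⟨hw, hsub hmem⟩
    rw [h1]
    have hvol : volume.real (Ω ∩ Metric.closedBall c (2 / ((m : ℝ) + 1))) ≤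
        (2 / ((m : ℝ) + 1)) ^ 2 * Real.pi := by
      refine (measureReal_mono inter_subset_right ?_).trans_eq ?_
      · exact (isCompact_closedBall _ _).measure_lt_top.ne
      · rw [measureReal_def, Complex.volume_closedBall, ENNReal.toReal_mul, ENNReal.toReal_pow,
          ENNReal.toReal_ofReal (by positivity)]
        simp
    have hfin : volume (Ω ∩ Metric.closedBall c (2 / ((m : ℝ) + 1))) < ⊤ :=
      (measure_mono inter_subset_right).trans_lt (isCompact_closedBall _ _).measure_lt_top
    refine (norm_setIntegral_le_of_norm_le_const hfin fun w hw => ?_).trans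
      (mul_le_mul_of_nonneg_left hvol (by positivity))
    by_cases hwt : w ∈ tsupport φ
    · rw [norm_smul]
      refine mul_le_mul ?_ ((hM w ⟨subset_closure hw.1, hwt⟩).trans (le_abs_self M))
        (norm_nonneg _) (by positivity)
      rw [dbar_mul (contDiff_cornerBump c m) hφ.1]
      have h2 : ‖dbar (cornerBump c m) w‖ ≤ (m + 1) * B := by
        have : dbar (cornerBump c m) w = _ := dbar_comp_scale contDiff_unitBump c (m + 1) w
        rw [this, norm_mul, norm_real, Real.norm_of_nonneg (by positivity)]
        exact mul_le_mul_of_nonneg_left (hB _) (by positivity)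
      calc _ ≤ ‖dbar (cornerBump c m) w‖ * ‖φ w‖ + ‖cornerBump c m w‖ * ‖dbar φ w‖ := by
            refine (norm_add_le _ _).trans_eq ?_
            rw [norm_mul, norm_mul]
        _ ≤ (m + 1) * B * P + 1 * A := by
            gcongr
            · exact hP w
            · exact norm_unitBump_le _
            · exact hA w
        _ ≤ (m + 1) * (B * P + A) := by nlinarith
    · have h2 : w ∉ tsupport (fun w => cornerBump c m w * φ w) := fun h =>
        hwt (closure_mono (fun w hw => right_ne_zero_of_mul hw) h)
      rw [dbar_eq_zero_of_notMem_tsupport h2, zero_smul, norm_zero]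
      positivity
  refine squeeze_zero_norm hbound ?_
  have h1 := (tendsto_one_div_add_atTop_nhds_zero_nat (𝕜 := ℝ)).const_mul
    (4 * Real.pi * (B * P + A) * |M|)
  rw [mul_zero] at h1
  refine h1.congr fun m => ?_
  field_simp
  ring

variable [CompleteSpace E]

/-- Green's formula for a set bounded by a piecewise `C¹` contour. The function `F` is
holomorphic in the open set, and merely continuous up to the boundary. The proof is by induction
on the set of those break points that lie in the support of the test function. -/
theorem IsSide.green (h : IsSide Γ Ω σ) {F : ℂ → E} (hF : DifferentiableOn ℂ F Ω)
    (hFc : ContinuousOn F (closure Ω)) {φ : ℂ → ℂ} (hφ : IsTest φ) :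
    ∫ w in Ω, dbar φ w • F w = (-I * σ) • contourIntegral Γ fun w => φ w • F w := by
  suffices key : ∀ T : Finset ℂ, ∀ φ, IsTest φ → (∀ p ∈ tsupport φ, p ∈ corners Γ → p ∈ T) →
      greenDefect Γ Ω σ F φ = 0 from
    sub_eq_zero.1 (key (finite_corners Γ).toFinset φ hφ fun p _ hp => by simpa using hp)
  intro T
  induction T using Finset.induction_on with
  | empty =>
    exact fun φ hφ hs => h.green_off_corners hF hFc hφ fun p hp hc => by simpa using hs p hp hc
  | insert c T _ ih =>
    intro φ hφ hs
    have hconst : ∀ m, greenDefect Γ Ω σ F φ =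
        greenDefect Γ Ω σ F (fun w => cornerBump c m w * φ w) := by
      intro m
      have hb := contDiff_cornerBump c m
      have hb' : ContDiff ℝ 1 fun w => 1 - cornerBump c m w := contDiff_const.sub hb
      have h1 : greenDefect Γ Ω σ F (fun w => (1 - cornerBump c m w) * φ w) = 0 := by
        refine ih _ (hφ.mul_left hb') fun p hp hpc => ?_
        refine (Finset.mem_insert.1 (hs p (closure_mono (fun w hw => right_ne_zero_of_mul hw) hp)
          hpc)).resolve_left ?_
        rintro rfl
        have : tsupport (fun w => (1 - cornerBump p m w) * φ w) ⊆
            (Metric.ball p (1 / ((m : ℝ) + 1)))ᶜ := by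
          refine closure_minimal (fun x hx hxb => hx ?_) Metric.isOpen_ball.isClosed_compl
          have : cornerBump p m x = 1 := by
            refine unitBump_of_norm_le ?_
            rw [norm_cornerBump_arg]
            rw [Metric.mem_ball, dist_eq, lt_div_iff₀ (by positivity), mul_comm] at hxb
            exact hxb.le
          simp [this]
        exact this hp (Metric.mem_ball_self (by positivity))
      have h2 := h.greenDefect_add hFc (hφ.mul_left hb) (hφ.mul_left hb')
      rw [h1, add_zero] at h2
      rw [← h2]
      congr 1
      ext w
      ring
    have hlim : Tendsto (fun m => greenDefect Γ Ω σ F (fun w => cornerBump c m w * φ w)) atTop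
        (𝓝 0) := by
      have h1 := tendsto_integral_cornerBump h.isOpen hFc hφ c
      have h2 := tendsto_contourIntegral_cornerBump (Γ := Γ) (g := fun w => φ w • F w)
        (hφ.1.continuous.continuousOn.smul (hFc.mono h.trace_subset_closure)) c
      have h3 := h1.sub (h2.const_smul (-I * (σ : ℂ)))
      simpa only [greenDefect, smul_smul, smul_zero, sub_zero] using h3
    exact tendsto_nhds_unique (tendsto_const_nhds.congr hconst) hlim

end Corners

/-! ### Radial cutoff functions -/

section Radial

/-- The profile of a radial cutoff: `1` on `(-∞, 1]` and `0` on `[2, ∞)`. -/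
noncomputable def profile (s : ℝ) : ℝ := 1 - Real.smoothTransition (s - 1)

theorem contDiff_profile : ContDiff ℝ 1 profile :=
  contDiff_const.sub (Real.smoothTransition.contDiff.comp (contDiff_id.sub contDiff_const))

theorem profile_of_le {s : ℝ} (h : s ≤ 1) : profile s = 1 := by
  rw [profile, Real.smoothTransition.zero_of_nonpos (by linarith), sub_zero]

theorem profile_of_ge {s : ℝ} (h : 2 ≤ s) : profile s = 0 := by
  rw [profile, Real.smoothTransition.one_of_one_le (by linarith), sub_self]

theorem deriv_profile_of_lt {s : ℝ} (h : s < 1) : deriv profile s = 0 := by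
  have : profile =ᶠ[𝓝 s] fun _ => 1 := by
    filter_upwards [gt_mem_nhds h] with x hx using profile_of_le hx.le
  rw [this.deriv_eq]; simp

theorem deriv_profile_of_gt {s : ℝ} (h : 2 < s) : deriv profile s = 0 := by
  have : profile =ᶠ[𝓝 s] fun _ => 0 := by
    filter_upwards [lt_mem_nhds h] with x hx using profile_of_ge hx.le
  rw [this.deriv_eq]; simp

theorem continuous_deriv_profile : Continuous (deriv profile) :=
  contDiff_profile.continuous_deriv le_rfl

theorem exists_deriv_profile_le : ∃ C, 0 ≤ C ∧ ∀ s, |deriv profile s| ≤ C := by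
  obtain ⟨C, hC⟩ := (isCompact_Icc (a := (1 : ℝ)) (b := 2)).exists_bound_of_continuousOn
    continuous_deriv_profile.continuousOn
  refine ⟨max C 0, le_max_right _ _, fun s => ?_⟩
  by_cases hs : s ∈ Icc (1 : ℝ) 2
  · exact (hC s hs).trans (le_max_left _ _)
  · rw [mem_Icc, not_and_or, not_le, not_le] at hs
    rcases hs with h | h
    · rw [deriv_profile_of_lt h]; simp
    · rw [deriv_profile_of_gt h]; simp

/-- The radial cutoff `w ↦ profile (|w|² / R²)`. -/
noncomputable def radialBump (R : ℝ) (w : ℂ) : ℂ := (profile (normSq w / R ^ 2) : ℝ)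

variable {R : ℝ}

theorem hasFDerivAt_normSq (w : ℂ) :
    HasFDerivAt (fun w : ℂ => normSq w) ((2 * w.re) • reCLM + (2 * w.im) • imCLM) w := by
  have h1 := (reCLM.hasFDerivAt (x := w)).mul (reCLM.hasFDerivAt (x := w))
  have h2 := (imCLM.hasFDerivAt (x := w)).mul (imCLM.hasFDerivAt (x := w))
  have h3 := h1.add h2
  have he : (fun w : ℂ => normSq w) = fun w => reCLM w * reCLM w + imCLM w * imCLM w := by
    ext w; simp [normSq_apply]
  rw [he]
  refine h3.congr_fderiv ?_
  ext
  simp; ring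

theorem contDiff_radialBump : ContDiff ℝ 1 (radialBump R) := by
  have h1 : ContDiff ℝ 1 fun w : ℂ => normSq w := by
    have : (fun w : ℂ => normSq w) = fun w => reCLM w * reCLM w + imCLM w * imCLM w := by
      ext w; simp [normSq_apply]
    rw [this]
    exact (reCLM.contDiff.mul reCLM.contDiff).add (imCLM.contDiff.mul imCLM.contDiff)
  exact ofRealCLM.contDiff.comp (contDiff_profile.comp (h1.div_const _))

/-- For a radial cutoff, `2 ∂φ/∂z̄` is a radial multiple of `w`. -/
theorem dbar_radialBump (w : ℂ) :
    dbar (radialBump R) w = (2 * deriv profile (normSq w / R ^ 2) / R ^ 2 : ℝ) * w := by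
  have h1 := (hasFDerivAt_normSq w).mul_const (R ^ 2)⁻¹
  have h2 : HasDerivAt profile (deriv profile (normSq w * (R ^ 2)⁻¹)) (normSq w * (R ^ 2)⁻¹) :=
    (contDiff_profile.differentiable one_ne_zero _).hasDerivAt
  have h3 := ofRealCLM.hasFDerivAt.comp w (h2.comp_hasFDerivAt w h1)
  have h4 : radialBump R = ofRealCLM ∘ (profile ∘ fun w : ℂ => normSq w * (R ^ 2)⁻¹) := by
    ext w; simp [radialBump, div_eq_mul_inv]
  rw [dbar, h4, h3.fderiv, ← div_eq_mul_inv]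
  simp
  linear_combination (2 * ((deriv profile (normSq w / R ^ 2) : ℝ) : ℂ) / R ^ 2) * re_add_im w

theorem radialBump_eq_one (hR : 0 < R) {w : ℂ} (h : ‖w‖ ≤ R) : radialBump R w = 1 := by
  rw [radialBump, profile_of_le, ofReal_one]
  rw [div_le_one (by positivity), normSq_eq_norm_sq]
  gcongr

theorem deriv_profile_eq_zero_of_norm_lt (hR : 0 < R) {w : ℂ} (h : ‖w‖ < R) :
    deriv profile (normSq w / R ^ 2) = 0 := by
  refine deriv_profile_of_lt ?_
  rw [div_lt_one (by positivity), normSq_eq_norm_sq]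
  gcongr

theorem deriv_profile_eq_zero_of_lt_norm (hR : 0 < R) {w : ℂ} (h : 2 * R < ‖w‖) :
    deriv profile (normSq w / R ^ 2) = 0 := by
  refine deriv_profile_of_gt ?_
  rw [lt_div_iff₀ (by positivity), normSq_eq_norm_sq]
  nlinarith

theorem isTest_radialBump (hR : 0 < R) : IsTest (radialBump R) where
  contDiff := contDiff_radialBump
  hasCompactSupport := by
    refine HasCompactSupport.intro (isCompact_closedBall (0 : ℂ) (2 * R)) fun w hw => ?_
    have h : 2 * R < ‖w‖ := by simpa using hw
    rw [radialBump, profile_of_ge, ofReal_zero]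
    rw [le_div_iff₀ (by positivity), normSq_eq_norm_sq]
    nlinarith

/-- The total mass of the radial density in `dbar_radialBump`, in polar coordinates. -/
theorem integral_deriv_profile (hR : 0 < R) :
    ∫ w : ℂ, 2 * deriv profile (normSq w / R ^ 2) / R ^ 2 = -(2 * Real.pi) := by
  have h1 := integral_fun_norm_addHaar (volume : Measure ℂ)
    (fun r => 2 * deriv profile (r ^ 2 / R ^ 2) / R ^ 2)
  have h2 : ∫ w : ℂ, 2 * deriv profile (normSq w / R ^ 2) / R ^ 2 =
      ∫ w : ℂ, 2 * deriv profile (‖w‖ ^ 2 / R ^ 2) / R ^ 2 := by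
    simp only [normSq_eq_norm_sq]
  have h3 : ∫ y in Ioi (0 : ℝ), y * (2 * deriv profile (y ^ 2 / R ^ 2) / R ^ 2) = 0 - 1 := by
    have hder : ∀ y : ℝ, HasDerivAt (fun y => profile (y ^ 2 / R ^ 2))
        (y * (2 * deriv profile (y ^ 2 / R ^ 2) / R ^ 2)) y := by
      intro y
      have h4 : HasDerivAt (fun y : ℝ => y ^ 2 / R ^ 2) (2 * y / R ^ 2) y := by
        simpa using ((hasDerivAt_id y).pow 2).div_const (R ^ 2)
      have h5 := (contDiff_profile.differentiable one_ne_zero (y ^ 2 / R ^ 2)).hasDerivAt.comp y h4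
      exact h5.congr_deriv (by ring)
    have hcont : Continuous fun y : ℝ => y * (2 * deriv profile (y ^ 2 / R ^ 2) / R ^ 2) := by
      have := continuous_deriv_profile
      fun_prop
    have hz : ∀ y : ℝ, 2 * R < y → y ^ 2 / R ^ 2 > 2 := by
      intro y hy
      rw [gt_iff_lt, lt_div_iff₀ (by positivity)]
      nlinarith
    rw [integral_Ioi_of_hasDerivAt_of_tendsto (f := fun y => profile (y ^ 2 / R ^ 2)) (m := 0)
      (hder 0).continuousAt.continuousWithinAt (fun y _ => hder y)]
    · simp [profile_of_le]
    · refine (hcont.integrable_of_hasCompactSupport ?_).integrableOn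
      refine HasCompactSupport.intro (isCompact_Icc (a := -(2 * R)) (b := 2 * R)) fun y hy => ?_
      have : 2 * R < |y| := by
        rw [mem_Icc, ← abs_le] at hy
        exact not_le.1 hy
      have h6 := hz _ this
      rw [sq_abs] at h6
      rw [deriv_profile_of_gt h6]; simp
    · refine tendsto_const_nhds.congr' ?_
      filter_upwards [eventually_gt_atTop (2 * R)] with y hy
      exact (profile_of_ge (hz y hy).le).symm
  rw [h2, h1]
  simp only [Complex.finrank_real_complex, smul_eq_mul, measureReal_def, Complex.volume_ball]
  simp only [Nat.add_one_sub_one, pow_one, h3]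
  simp

end Radial

/-! ### Cauchy's theorem inside and outside a contour -/

section Cauchy

variable {E : Type*} [NormedAddCommGroup E] [NormedSpace ℂ E] [CompleteSpace E] {N : ℕ}
  {Γ : Fin N → PwC1ClosedCurve} {D : Set ℂ}

/-- Cauchy's theorem, from Green's formula with a cutoff equal to `1` near the closure of `D`. -/
theorem IsSide.contourIntegral_eq_zero (h : IsSide Γ D 1) (hb : Bornology.IsBounded D)
    {F : ℂ → E} (hF : DifferentiableOn ℂ F D) (hFc : ContinuousOn F (closure D)) :
    contourIntegral Γ F = 0 := by
  obtain ⟨R, hR, hD⟩ := hb.closure.subset_ball_lt 0 (0 : ℂ)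
  have hg := h.green hF hFc (isTest_radialBump hR)
  have h1 : ∫ w in D, dbar (radialBump R) w • F w = 0 := by
    refine setIntegral_eq_zero_of_forall_eq_zero fun w hw => ?_
    have hw' : ‖w‖ < R := by simpa using hD (subset_closure hw)
    rw [dbar_radialBump, deriv_profile_eq_zero_of_norm_lt hR hw', mul_zero, zero_div, ofReal_zero,
      zero_mul, zero_smul]
  have h2 : contourIntegral Γ (fun w => radialBump R w • F w) = contourIntegral Γ F := by
    refine contourIntegral_congr Γ fun w hw => ?_
    have hw' : ‖w‖ < R := by simpa using hD (h.trace_subset_closure hw)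
    rw [radialBump_eq_one hR hw'.le, one_smul]
  rw [h1, h2] at hg
  have := smul_eq_zero.1 hg.symm
  simpa using this

/-- The residue at infinity, for a function that is holomorphic outside a contour. Green's formula
with a radial cutoff of radius `R` writes the contour integral as an average of `w G(w)` over an
annulus whose radius is of the order of `R`, and `R` is arbitrarily large. -/
theorem IsSide.contourIntegral_exterior (h : IsSide Γ D 1) (hb : Bornology.IsBounded D)
    {G : ℂ → E} (hG : DifferentiableOn ℂ G (closure D)ᶜ)
    (hGc : ContinuousOn G (closure (closure D)ᶜ)) {L : E}
    (hL : Tendsto (fun w => w • G w) (Bornology.cobounded ℂ) (𝓝 L)) :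
    contourIntegral Γ G = (2 * Real.pi * I : ℂ) • L := by
  obtain ⟨R₀, hR₀, hD⟩ := hb.closure.subset_ball_lt 0 (0 : ℂ)
  have hD' : ∀ w ∈ closure D, ‖w‖ < R₀ := fun w hw => by simpa using hD hw
  obtain ⟨C, hC0, hC⟩ := exists_deriv_profile_le
  have hG' : ContinuousOn (fun w => w • G w) (closure (closure D)ᶜ) := continuousOn_id.smul hGc
  -- Green's formula outside the contour, with a radial cutoff
  have hgreen : ∀ R ≥ R₀, ∫ w : ℂ, (2 * deriv profile (normSq w / R ^ 2) / R ^ 2 : ℝ) • (w • G w) =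
      I • contourIntegral Γ G := by
    intro R hR
    have hRpos : 0 < R := hR₀.trans_le hR
    have hg := h.exterior.green hG hGc (isTest_radialBump hRpos)
    have h2 : contourIntegral Γ (fun w => radialBump R w • G w) = contourIntegral Γ G := by
      refine contourIntegral_congr Γ fun w hw => ?_
      rw [radialBump_eq_one hRpos ((hD' w (h.trace_subset_closure hw)).le.trans hR), one_smul]
    rw [h2] at hg
    have h3 : ∫ w in (closure D)ᶜ, dbar (radialBump R) w • G w =
        ∫ w, dbar (radialBump R) w • G w := by
      refine setIntegral_eq_integral_of_forall_compl_eq_zero fun w hw => ?_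
      rw [dbar_radialBump, deriv_profile_eq_zero_of_norm_lt hRpos
        ((hD' w (not_not.1 hw)).trans_le hR), mul_zero, zero_div, ofReal_zero, zero_mul, zero_smul]
    rw [h3] at hg
    simp only [dbar_radialBump, mul_smul, Complex.coe_smul] at hg
    rw [hg]
    simp
  have hint : ∀ R ≥ R₀, Integrable fun w : ℂ => 2 * deriv profile (normSq w / R ^ 2) / R ^ 2 := by
    intro R hR
    refine Continuous.integrable_of_hasCompactSupport ?_ ?_
    · have := continuous_deriv_profile
      have := continuous_normSq
      fun_prop
    · refine HasCompactSupport.intro (isCompact_closedBall (0 : ℂ) (2 * R)) fun w hw => ?_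
      rw [deriv_profile_eq_zero_of_lt_norm (hR₀.trans_le hR) (by simpa using hw)]
      simp
  have hlim : I • contourIntegral Γ G = (-(2 * Real.pi) : ℝ) • L := by
    rw [← sub_eq_zero, ← norm_le_zero_iff]
    refine le_of_forall_pos_le_add fun ε hε => ?_
    rw [zero_add]
    -- the density is at most `2 C / R ^ 2` on a disc of area `4 π R ^ 2`, so that its absolute
    -- mass is at most `8 C π`
    set δ : ℝ := ε / (8 * C * Real.pi + 1) with hδ
    have hden : 0 < 8 * C * Real.pi + 1 := by positivity
    have hδ0 : 0 < δ := div_pos hε hden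
    have hev := (Metric.tendsto_nhds.1 hL δ hδ0)
    obtain ⟨R₁, -, hR₁⟩ := (Metric.hasBasis_cobounded_compl_closedBall (0 : ℂ)).eventually_iff.1 hev
    set R := max R₀ (R₁ + 1) with hRdef
    have hRR : R ≥ R₀ := le_max_left _ _
    have hRpos : 0 < R := hR₀.trans_le hRR
    have hR1 : R₁ < R := (lt_add_one R₁).trans_le (le_max_right _ _)
    set k : ℂ → ℝ := fun w => 2 * deriv profile (normSq w / R ^ 2) / R ^ 2 with hk
    have hk0 : ∀ w : ℂ, ‖w‖ < R → k w = 0 := fun w hw => by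
      simp [hk, deriv_profile_eq_zero_of_norm_lt hRpos hw]
    have hk2 : ∀ w : ℂ, 2 * R < ‖w‖ → k w = 0 := fun w hw => by
      simp [hk, deriv_profile_eq_zero_of_lt_norm hRpos hw]
    have hkb : ∀ w, |k w| ≤ 2 * C / R ^ 2 := by
      intro w
      simp only [hk]
      rw [abs_div, abs_mul, abs_of_pos (show (0 : ℝ) < 2 by norm_num), abs_of_pos (pow_pos hRpos 2)]
      gcongr
      exact hC _
    have hi1 : Integrable fun w => k w • (w • G w) := by
      have h1 : IntegrableOn (fun w => k w • (w • G w))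
          (closure (closure D)ᶜ ∩ Metric.closedBall 0 (2 * R)) := by
        refine ContinuousOn.integrableOn_compact
          ((isCompact_closedBall _ _).inter_left isClosed_closure) ?_
        have hkc : Continuous k := by
          have := continuous_deriv_profile
          have := continuous_normSq
          fun_prop
        exact hkc.continuousOn.smul (hG'.mono inter_subset_left)
      refine (integrableOn_iff_integrable_of_support_subset ?_).1 h1
      intro w hw
      have hw1 : k w ≠ 0 := fun h0 => hw (by simp [h0])
      refine ⟨subset_closure fun hcl => hw1 (hk0 w ((hD' w hcl).trans_le hRR)), ?_⟩
      by_contra hcon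
      exact hw1 (hk2 w (by simpa using hcon))
    have hi2 : Integrable fun w => k w • L := (hint R hRR).smul_const L
    have h1 : I • contourIntegral Γ G - (-(2 * Real.pi) : ℝ) • L =
        ∫ w, k w • (w • G w - L) := by
      simp only [smul_sub]
      rw [integral_sub hi1 hi2, integral_smul_const, integral_deriv_profile hRpos, hgreen R hRR]
    have h2 : ∫ w, k w • (w • G w - L) =
        ∫ w in Metric.closedBall 0 (2 * R), k w • (w • G w - L) := by
      refine (setIntegral_eq_integral_of_forall_compl_eq_zero fun w hw => ?_).symm
      rw [hk2 w (by simpa using hw), zero_smul]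
    rw [h1, h2]
    have h3 := norm_setIntegral_le_of_norm_le_const (μ := volume)
      (s := Metric.closedBall (0 : ℂ) (2 * R)) (f := fun w => k w • (w • G w - L)) (C := 2 * C / R ^ 2 * δ)
      (isCompact_closedBall _ _).measure_lt_top (fun w _ => ?_)
    · refine h3.trans ?_
      rw [measureReal_def, Complex.volume_closedBall, ENNReal.toReal_mul, ENNReal.toReal_pow,
          ENNReal.toReal_ofReal (by positivity)]
      have : 2 * C / R ^ 2 * δ * ((2 * R) ^ 2 * Real.pi) = 8 * C * Real.pi * δ := by
        field_simp; ring
      simp only [ENNReal.coe_toReal, NNReal.coe_real_pi]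
      rw [this, hδ, mul_div_assoc', div_le_iff₀ hden]
      nlinarith
    · rcases lt_or_ge ‖w‖ R with hw | hw
      · rw [hk0 w hw]; simp; positivity
      · rw [norm_smul]
        refine mul_le_mul (hkb w) ?_ (norm_nonneg _) (by positivity)
        have := hR₁ (show w ∈ (Metric.closedBall 0 R₁)ᶜ by simpa using hR1.trans_le hw)
        rw [dist_eq_norm] at this
        exact this.le
  have := congrArg (fun x => (-I) • x) hlim
  simp only [smul_smul, neg_mul, I_mul_I, neg_neg, one_smul] at this
  rw [this, ← Complex.coe_smul, smul_smul]
  congr 1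
  push_cast
  ring

end Cauchy

/-! ### The Cauchy integral -/

section CauchyIntegral

variable {E : Type*} [NormedAddCommGroup E] [NormedSpace ℂ E] {N : ℕ}
  {Γ : Fin N → PwC1ClosedCurve} {D : Set ℂ}

/-- The Cauchy integral `(2πi)⁻¹ ∫_Γ g(w) / (w - z) dw`. -/
noncomputable def cauchyIntegral (Γ : Fin N → PwC1ClosedCurve) (g : ℂ → E) (z : ℂ) : E :=
  (2 * Real.pi * I : ℂ)⁻¹ • contourIntegral Γ fun w => (w - z)⁻¹ • g w

theorem continuousOn_inv_sub_smul {g : ℂ → E} (hg : ContinuousOn g (trace Γ)) {z : ℂ}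
    (hz : z ∉ trace Γ) : ContinuousOn (fun w => (w - z)⁻¹ • g w) (trace Γ) := by
  refine ContinuousOn.smul (ContinuousOn.inv₀ (by fun_prop) fun w hw h0 => ?_) hg
  exact hz (sub_eq_zero.1 h0 ▸ hw)

theorem cauchyIntegral_congr {g h : ℂ → E} (hgh : EqOn g h (trace Γ)) (z : ℂ) :
    cauchyIntegral Γ g z = cauchyIntegral Γ h z := by
  rw [cauchyIntegral, cauchyIntegral]
  congr 1
  refine contourIntegral_congr Γ fun w hw => ?_
  simp only [hgh hw]

theorem cauchyIntegral_add {g h : ℂ → E} (hg : ContinuousOn g (trace Γ))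
    (hh : ContinuousOn h (trace Γ)) {z : ℂ} (hz : z ∉ trace Γ) :
    cauchyIntegral Γ (fun w => g w + h w) z = cauchyIntegral Γ g z + cauchyIntegral Γ h z := by
  simp only [cauchyIntegral, smul_add]
  rw [contourIntegral_add Γ (continuousOn_inv_sub_smul hg hz) (continuousOn_inv_sub_smul hh hz),
    smul_add]

theorem cauchyIntegral_smul_const (a : ℂ → ℂ) (x : E) (z : ℂ) [CompleteSpace E] :
    cauchyIntegral Γ (fun w => a w • x) z = cauchyIntegral Γ a z • x := by
  simp only [cauchyIntegral, contourIntegral, PwC1ClosedCurve.integral, smul_smul, smul_assoc,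
    Finset.sum_smul]
  congr 1
  refine Finset.sum_congr rfl fun k _ => ?_
  rw [← intervalIntegral.integral_smul_const]
  simp [mul_smul]

theorem differentiableAt_integral_kernel (c : PwC1ClosedCurve) {g : ℂ → E}
    (hg : ContinuousOn g c.image) {z₀ : ℂ} (hz₀ : z₀ ∉ c.image) :
    DifferentiableAt ℂ (fun z => c.integral fun w => (w - z)⁻¹ • g w) z₀ := by
  obtain ⟨r, hr, hball⟩ := Metric.isOpen_iff.1 c.isCompact_image.isClosed.isOpen_compl z₀ hz₀
  obtain ⟨M, hM0, hM⟩ := c.exists_ae_norm_deriv_le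
  obtain ⟨C, hC⟩ := c.isCompact_image.exists_bound_of_continuousOn hg
  have hdist : ∀ z ∈ Metric.ball z₀ (r / 2), ∀ w ∈ c.image, r / 2 ≤ ‖w - z‖ := by
    intro z hz w hw
    have h1 : r ≤ dist w z₀ := by
      by_contra! hlt
      exact hball hlt hw
    have h2 := dist_triangle w z z₀
    rw [Metric.mem_ball] at hz
    rw [← dist_eq_norm]
    linarith
  have hne : ∀ z ∈ Metric.ball z₀ (r / 2), ∀ w ∈ c.image, w - z ≠ 0 := fun z hz w hw =>
    norm_pos_iff.1 ((half_pos hr).trans_le (hdist z hz w hw))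
  have hcont : ∀ z ∈ Metric.ball z₀ (r / 2), ContinuousOn (fun w => (w - z)⁻¹ • g w) c.image :=
    fun z hz => ContinuousOn.smul (ContinuousOn.inv₀ (by fun_prop) (hne z hz)) hg
  have hz₀b : z₀ ∈ Metric.ball z₀ (r / 2) := Metric.mem_ball_self (half_pos hr)
  have hmem : ∀ x ∈ Ioc (c.t 0) (c.t c.n), c.γ x ∈ c.image := fun x hx =>
    mem_image_of_mem _ (Ioc_subset_Icc_self hx)
  simp only [PwC1ClosedCurve.integral, intervalIntegral.integral_of_le c.t_zero_lt.le]
  refine (hasDerivAt_integral_of_dominated_loc_of_deriv_le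
    (F := fun z x => deriv c.γ x • (c.γ x - z)⁻¹ • g (c.γ x))
    (F' := fun z x => deriv c.γ x • ((c.γ x - z) ^ 2)⁻¹ • g (c.γ x))
    (bound := fun _ => M * (((r / 2) ^ 2)⁻¹ * C))
    (Metric.ball_mem_nhds z₀ (half_pos hr)) ?_ ?_ ?_ ?_ (integrable_const _) ?_).2.differentiableAt
  · filter_upwards [Metric.ball_mem_nhds z₀ (half_pos hr)] with z hz
    exact c.aestronglyMeasurable_integrand (hcont z hz)
  · have := c.intervalIntegrable (hcont z₀ hz₀b)
    rwa [intervalIntegrable_iff_integrableOn_Ioc_of_le c.t_zero_lt.le] at this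
  · refine c.aestronglyMeasurable_integrand (g := fun w => ((w - z₀) ^ 2)⁻¹ • g w)
      (ContinuousOn.smul (ContinuousOn.inv₀ (by fun_prop) fun w hw => ?_) hg)
    exact pow_ne_zero 2 (hne z₀ hz₀b w hw)
  · filter_upwards [hM, ae_restrict_mem measurableSet_Ioc] with x hx hx' z hz
    rw [norm_smul, norm_smul, norm_inv, norm_pow]
    have h1 := hdist z hz _ (hmem x hx')
    have h2 := hC _ (hmem x hx')
    gcongr
  · filter_upwards [ae_restrict_mem measurableSet_Ioc] with x hx z hz
    have h1 : HasDerivAt (fun z => (c.γ x - z)⁻¹) (((c.γ x - z) ^ 2)⁻¹) z := by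
      exact (((hasDerivAt_id z).const_sub (c.γ x)).inv (hne z hz _ (hmem x hx))).congr_deriv
        (by simp)
    exact (h1.smul_const (g (c.γ x))).const_smul _

/-- The Cauchy integral is holomorphic off the contour. -/
theorem differentiableAt_cauchyIntegral {g : ℂ → E} (hg : ContinuousOn g (trace Γ)) {z : ℂ}
    (hz : z ∉ trace Γ) : DifferentiableAt ℂ (cauchyIntegral Γ g) z := by
  refine DifferentiableAt.const_smul ?_ _
  simp only [contourIntegral]
  refine DifferentiableAt.fun_sum fun k _ => ?_
  exact differentiableAt_integral_kernel (Γ k) (hg.mono (image_subset_trace Γ k))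
    fun h => hz (image_subset_trace Γ k h)

theorem tendsto_cauchyIntegral_cobounded {g : ℂ → E} (hg : ContinuousOn g (trace Γ)) :
    Tendsto (cauchyIntegral Γ g) (Bornology.cobounded ℂ) (𝓝 0) := by
  rw [show (0 : E) = (2 * Real.pi * I : ℂ)⁻¹ • ∑ _k : Fin N, (0 : E) by simp]
  refine Tendsto.const_smul ?_ _
  simp only [contourIntegral]
  refine tendsto_finsetSum _ fun k _ => ?_
  set c := Γ k
  have hgk : ContinuousOn g c.image := hg.mono (image_subset_trace Γ k)
  obtain ⟨M, hM0, hM⟩ := c.exists_ae_norm_deriv_le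
  obtain ⟨C, hC⟩ := c.isCompact_image.exists_bound_of_continuousOn hgk
  obtain ⟨R, hR⟩ := c.isCompact_image.exists_bound_of_continuousOn continuousOn_id
  have hfar : ∀ᶠ z in Bornology.cobounded ℂ, ∀ w ∈ c.image, 1 ≤ ‖w - z‖ := by
    filter_upwards [(Metric.hasBasis_cobounded_compl_closedBall (0 : ℂ)).mem_of_mem
      (i := R + 1) trivial] with z hz w hw
    have h1 : R + 1 < ‖z‖ := by simpa using hz
    have h2 : ‖w‖ ≤ R := hR w hw
    have h3 := norm_sub_norm_le z w
    rw [norm_sub_rev]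
    linarith
  have : (Bornology.cobounded ℂ).IsCountablyGenerated := by
    rw [← comap_norm_atTop]
    infer_instance
  rw [show (0 : E) = ∫ _x in c.t 0..c.t c.n, (0 : E) from intervalIntegral.integral_zero.symm]
  simp only [PwC1ClosedCurve.integral, intervalIntegral.integral_of_le c.t_zero_lt.le]
  refine tendsto_integral_filter_of_dominated_convergence (fun _ => M * (1 * C)) ?_ ?_
    (integrable_const _) ?_
  · filter_upwards [hfar] with z hz
    refine c.aestronglyMeasurable_integrand (g := fun w => (w - z)⁻¹ • g w)
      (ContinuousOn.smul (ContinuousOn.inv₀ (by fun_prop) fun w hw => ?_) hgk)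
    exact norm_pos_iff.1 (one_pos.trans_le (hz w hw))
  · filter_upwards [hfar] with z hz
    filter_upwards [hM, ae_restrict_mem measurableSet_Ioc] with x hx hx'
    have hw : c.γ x ∈ c.image := mem_image_of_mem _ (Ioc_subset_Icc_self hx')
    rw [norm_smul, norm_smul, norm_inv]
    have h1 := inv_le_one_of_one_le₀ (hz _ hw)
    have h2 := hC _ hw
    gcongr
  · refine Eventually.of_forall fun x => ?_
    have h1 : Tendsto (fun z => (c.γ x - z)⁻¹) (Bornology.cobounded ℂ) (𝓝 0) := by
      exact tendsto_inv₀_cobounded.comp (tendsto_const_sub_cobounded (c.γ x))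
    have := (h1.smul_const (g (c.γ x))).const_smul (deriv c.γ x)
    simpa using this

theorem tendsto_mul_inv_sub_cobounded (z : ℂ) :
    Tendsto (fun w : ℂ => w * (w - z)⁻¹) (Bornology.cobounded ℂ) (𝓝 1) := by
  have h1 : Tendsto (fun w : ℂ => (w - z)⁻¹) (Bornology.cobounded ℂ) (𝓝 0) :=
    tendsto_inv₀_cobounded.comp (tendsto_sub_const_cobounded z)
  have h2 := (h1.const_mul z).const_add 1
  rw [mul_zero, add_zero] at h2
  refine h2.congr' ?_
  filter_upwards [Bornology.isBounded_def.1 (Bornology.isBounded_singleton (x := z))] with w hw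
  have : w - z ≠ 0 := sub_ne_zero.2 hw
  field_simp
  ring

variable [CompleteSpace E]

theorem IsSide.cauchyIntegral_eq_zero (h : IsSide Γ D 1) (hb : Bornology.IsBounded D)
    {F : ℂ → E} (hF : DifferentiableOn ℂ F D) (hFc : ContinuousOn F (closure D)) {z : ℂ}
    (hz : z ∉ closure D) : cauchyIntegral Γ F z = 0 := by
  have hne : ∀ w ∈ closure D, w - z ≠ 0 := fun w hw h0 => hz (sub_eq_zero.1 h0 ▸ hw)
  rw [cauchyIntegral, h.contourIntegral_eq_zero hb, smul_zero]
  · exact DifferentiableOn.smul (DifferentiableOn.inv (by fun_prop) fun w hw =>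
      hne w (subset_closure hw)) hF
  · exact ContinuousOn.smul (ContinuousOn.inv₀ (by fun_prop) hne) hFc

theorem IsSide.notMem_trace (h : IsSide Γ D 1) {z : ℂ} (hz : z ∈ D) : z ∉ trace Γ :=
  fun h' => disjoint_left.1 h.disjoint_trace hz h'

/-- The Cauchy integral of a function that is holomorphic outside the contour is, inside, the
value of that function at infinity. -/
theorem IsSide.cauchyIntegral_exterior_of_mem (h : IsSide Γ D 1) (hb : Bornology.IsBounded D)
    {F : ℂ → E} (hF : DifferentiableOn ℂ F (closure D)ᶜ)
    (hFc : ContinuousOn F (closure (closure D)ᶜ)) {L : E}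
    (hL : Tendsto F (Bornology.cobounded ℂ) (𝓝 L)) {z : ℂ} (hz : z ∈ D) :
    cauchyIntegral Γ F z = L := by
  have hz' : z ∉ closure (closure D)ᶜ := by
    rw [h.closure_exterior]
    rintro (h1 | h1)
    · exact h1 (subset_closure hz)
    · exact h.notMem_trace hz h1
  have hne : ∀ w ∈ closure (closure D)ᶜ, w - z ≠ 0 := fun w hw h0 => hz' (sub_eq_zero.1 h0 ▸ hw)
  have hlim := tendsto_mul_inv_sub_cobounded z
  rw [cauchyIntegral, h.contourIntegral_exterior hb (L := L), smul_smul, inv_mul_cancel₀ (by simp),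
    one_smul]
  · exact DifferentiableOn.smul (DifferentiableOn.inv (by fun_prop) fun w hw =>
      hne w (subset_closure hw)) hF
  · exact ContinuousOn.smul (ContinuousOn.inv₀ (by fun_prop) hne) hFc
  · simpa [smul_smul] using hlim.smul hL

/-- The winding number of the contour around the points that it encloses is `1`. -/
theorem IsSide.cauchyIntegral_one_of_mem (h : IsSide Γ D 1) (hb : Bornology.IsBounded D)
    {z : ℂ} (hz : z ∈ D) : cauchyIntegral Γ (fun _ => (1 : ℂ)) z = 1 :=
  h.cauchyIntegral_exterior_of_mem hb (differentiableOn_const _) continuousOn_const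
    tendsto_const_nhds hz

/-- The winding number of the contour around the exterior points is `0`. -/
theorem IsSide.cauchyIntegral_one_of_notMem (h : IsSide Γ D 1) (hb : Bornology.IsBounded D)
    {z : ℂ} (hz : z ∉ closure D) : cauchyIntegral Γ (fun _ => (1 : ℂ)) z = 0 :=
  h.cauchyIntegral_eq_zero hb (differentiableOn_const _) continuousOn_const hz

/-- The Cauchy integral with the value at `z` split off. The quotient `dslope F z` is holomorphic
where `F` is, so that its contour integral is given by Cauchy's theorem. -/
theorem cauchyIntegral_eq_dslope {F : ℂ → E} (hF : ContinuousOn F (trace Γ)) {z : ℂ}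
    (hz : z ∉ trace Γ) :
    cauchyIntegral Γ F z = (2 * Real.pi * I : ℂ)⁻¹ • contourIntegral Γ (dslope F z) +
      cauchyIntegral Γ (fun _ => (1 : ℂ)) z • F z := by
  have h1 := cauchyIntegral_add (Γ := Γ) (g := fun w => F w - F z)
    (h := fun _ => (1 : ℂ) • F z) (hF.sub continuousOn_const) continuousOn_const hz
  simp only [one_smul, sub_add_cancel] at h1
  rw [h1]
  congr 1
  · rw [cauchyIntegral]
    congr 1
    refine contourIntegral_congr Γ fun w hw => ?_
    have hwz : w ≠ z := fun h => hz (h ▸ hw)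
    rw [dslope_of_ne F hwz, slope_def_module]
  · rw [← cauchyIntegral_smul_const]
    simp

/-- Cauchy's integral formula. -/
theorem IsSide.cauchyIntegral_eq (h : IsSide Γ D 1) (hb : Bornology.IsBounded D)
    {F : ℂ → E} (hF : DifferentiableOn ℂ F D) (hFc : ContinuousOn F (closure D)) {z : ℂ}
    (hz : z ∈ D) : cauchyIntegral Γ F z = F z := by
  have hD := h.isOpen.mem_nhds hz
  rw [cauchyIntegral_eq_dslope (hFc.mono h.trace_subset_closure) (h.notMem_trace hz),
    h.contourIntegral_eq_zero hb, h.cauchyIntegral_one_of_mem hb hz]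
  · simp
  · exact (differentiableOn_dslope hD).2 hF
  · exact (continuousOn_dslope (mem_of_superset hD subset_closure)).2
      ⟨hFc, hF.differentiableAt hD⟩

/-- Cauchy's integral formula outside the contour. -/
theorem IsSide.cauchyIntegral_exterior_of_notMem (h : IsSide Γ D 1) (hb : Bornology.IsBounded D)
    {F : ℂ → E} (hF : DifferentiableOn ℂ F (closure D)ᶜ)
    (hFc : ContinuousOn F (closure (closure D)ᶜ)) {L : E}
    (hL : Tendsto F (Bornology.cobounded ℂ) (𝓝 L)) {z : ℂ} (hz : z ∉ closure D) :
    cauchyIntegral Γ F z = L - F z := by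
  have hD : (closure D)ᶜ ∈ 𝓝 z := isClosed_closure.isOpen_compl.mem_nhds hz
  have hlim := tendsto_mul_inv_sub_cobounded z
  rw [cauchyIntegral_eq_dslope (hFc.mono (h.exterior.trace_subset_closure))
    (fun h' => hz (h.trace_subset_closure h')),
    h.contourIntegral_exterior hb (L := L - F z), h.cauchyIntegral_one_of_notMem hb hz, smul_smul,
    inv_mul_cancel₀ (by simp)]
  · simp
  · exact (differentiableOn_dslope hD).2 hF
  · exact (continuousOn_dslope (mem_of_superset hD subset_closure)).2
      ⟨hFc, hF.differentiableAt hD⟩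
  · have h1 := hlim.smul (hL.sub_const (F z))
    rw [one_smul] at h1
    refine h1.congr' ?_
    filter_upwards [Bornology.isBounded_def.1 (Bornology.isBounded_singleton (x := z))] with w hw
    rw [dslope_of_ne F hw, slope_def_module, smul_smul]

end CauchyIntegral

/-! ### The jump relation -/

section Jump

/-- Distance estimate behind the jump relation: the two points `γ x₀ ± ε i γ' x₀` stay away from
the arc, linearly in `|x - x₀| + ε`. -/
theorem exists_le_norm_sub_normal {γ : ℝ → ℂ} {x₀ : ℝ} {u : ℂ} (hu : u ≠ 0)
    (hγ : HasDerivAt γ u x₀) :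
    ∃ δ > 0, ∀ x, |x - x₀| < δ → ∀ ε : ℝ,
      ‖u‖ / 4 * (|x - x₀| + |ε|) ≤ ‖γ x - (γ x₀ + ε * (I * u))‖ := by
  have hu0 : 0 < ‖u‖ := norm_pos_iff.2 hu
  have h1 := (hasDerivAt_iff_isLittleO.1 hγ).def (show 0 < ‖u‖ / 4 by positivity)
  obtain ⟨δ, hδ, hball⟩ := Metric.eventually_nhds_iff.1 h1
  refine ⟨δ, hδ, fun x hx ε => ?_⟩
  have h2 := hball (show dist x x₀ < δ by rwa [Real.dist_eq])
  rw [Real.norm_eq_abs] at h2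
  set s := x - x₀ with hs
  have h3 : ‖(s : ℂ) - ε * I‖ * 2 ≥ |s| + |ε| := by
    have hre := abs_re_le_norm ((s : ℂ) - ε * I)
    have him := abs_im_le_norm ((s : ℂ) - ε * I)
    simp at hre him
    linarith
  have h4 : γ x - (γ x₀ + ε * (I * u)) = (γ x - γ x₀ - s • u) + u * ((s : ℂ) - ε * I) := by
    rw [real_smul]; ring
  have h5 : ‖u * ((s : ℂ) - ε * I)‖ ≤ ‖γ x - (γ x₀ + ε * (I * u))‖ + ‖γ x - γ x₀ - s • u‖ := by
    rw [h4]
    have := norm_sub_le (γ x - γ x₀ - s • u + u * ((s : ℂ) - ε * I)) (γ x - γ x₀ - s • u)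
    rwa [add_sub_cancel_left] at this
  rw [norm_mul] at h5
  have h6 : ‖u‖ / 2 * (|s| + |ε|) ≤ ‖u‖ * ‖(s : ℂ) - ε * I‖ := by nlinarith
  have h7 := abs_nonneg ε
  nlinarith

theorem integral_poisson_le {a b x₀ ε : ℝ} (hε : 0 < ε) :
    ∫ x in a..b, ε / ((x - x₀) ^ 2 + ε ^ 2) ≤ Real.pi := by
  have hder : ∀ x : ℝ, HasDerivAt (fun x => Real.arctan ((x - x₀) / ε))
      (ε / ((x - x₀) ^ 2 + ε ^ 2)) x := by
    intro x
    have h1 : HasDerivAt (fun x : ℝ => (x - x₀) / ε) (1 / ε) x :=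
      ((hasDerivAt_id x).sub_const x₀).div_const ε
    refine h1.arctan.congr_deriv ?_
    field_simp
    ring
  rw [intervalIntegral.integral_eq_sub_of_hasDerivAt (fun x _ => hder x)]
  · have h1 := Real.arctan_lt_pi_div_two ((b - x₀) / ε)
    have h2 := Real.neg_pi_div_two_lt_arctan ((a - x₀) / ε)
    linarith
  · refine Continuous.intervalIntegrable ?_ _ _
    refine continuous_const.div (by fun_prop) fun x => ?_
    positivity

variable {E : Type*} [NormedAddCommGroup E] [NormedSpace ℂ E] {N : ℕ}
  {Γ : Fin N → PwC1ClosedCurve} {D : Set ℂ}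

theorem norm_inv_sub_inv_le {w v a : ℂ} {m : ℝ} (hm : 0 < m) (h1 : m ≤ ‖w - (v + a)‖)
    (h2 : m ≤ ‖w - (v - a)‖) :
    ‖(w - (v + a))⁻¹ - (w - (v - a))⁻¹‖ ≤ 2 * ‖a‖ / m ^ 2 := by
  have h1' : w - (v + a) ≠ 0 := norm_pos_iff.1 (hm.trans_le h1)
  have h2' : w - (v - a) ≠ 0 := norm_pos_iff.1 (hm.trans_le h2)
  have : (w - (v + a))⁻¹ - (w - (v - a))⁻¹ = 2 * a / ((w - (v + a)) * (w - (v - a))) := by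
    field_simp; ring
  rw [this, norm_div, norm_mul, norm_mul, sq]
  simp only [Complex.norm_ofNat]
  gcongr

/-- The jump of the Cauchy integral of a density that vanishes at the given smooth point. -/
theorem jump_of_eq_zero (hd : Pairwise fun k l => Disjoint (Γ k).image (Γ l).image) {g : ℂ → E}
    (hg : ContinuousOn g (trace Γ)) (k : Fin N) {i : ℕ} (hi : i < (Γ k).n) {x₀ : ℝ}
    (hx₀ : x₀ ∈ Ioo ((Γ k).t i) ((Γ k).t (i + 1))) (hg0 : g ((Γ k).γ x₀) = 0) :
    Tendsto (fun ε : ℝ => contourIntegral Γ fun w =>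
      ((w - ((Γ k).γ x₀ + ε * (I * deriv (Γ k).γ x₀)))⁻¹ -
        (w - ((Γ k).γ x₀ - ε * (I * deriv (Γ k).γ x₀)))⁻¹) • g w) (𝓝[>] 0) (𝓝 0) := by
  set v := (Γ k).γ x₀ with hv
  set u := deriv (Γ k).γ x₀ with hu
  have hu0 : 0 < ‖u‖ := norm_pos_iff.2 ((Γ k).deriv_ne_zero' hi hx₀)
  have hx₀' := (Γ k).Ioo_piece_subset hi hx₀
  choose M hM0 hM using fun l => (Γ l).exists_ae_norm_deriv_le
  obtain ⟨C, hC⟩ := (isCompact_trace Γ).exists_bound_of_continuousOn hg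
  obtain ⟨δ₀, hδ₀, hest⟩ := exists_le_norm_sub_normal (norm_pos_iff.1 hu0)
    ((Γ k).hasDerivAt hi hx₀)
  have hgγ : ContinuousAt (fun x => g ((Γ k).γ x)) x₀ := by
    have := (hg.mono (image_subset_trace Γ k)).comp (Γ k).continuousOn
      fun x hx => mem_image_of_mem _ hx
    exact this.continuousAt (Icc_mem_nhds hx₀'.1 hx₀'.2)
  -- `A * η` bounds the integral of `η` times the dominating Poisson kernels
  set A : ℝ := ∑ l, M l * (32 / ‖u‖) * Real.pi with hA
  have hA0 : 0 ≤ A := Finset.sum_nonneg fun l _ => by have := hM0 l; positivity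
  rw [tendsto_zero_iff_norm_tendsto_zero]
  refine (Metric.tendsto_nhds.2 fun κ hκ => ?_)
  set η : ℝ := κ / (2 * (A + 1)) with hη
  have hη0 : 0 < η := by positivity
  obtain ⟨δ₁, hδ₁, hsmall⟩ := Metric.continuousAt_iff.1 hgγ η hη0
  obtain ⟨r, hr, hfar1, hfar2⟩ := exists_le_dist_trace hd k (lt_min hδ₀ hδ₁) hx₀'
  set B : Fin N → ℝ := fun l => M l * (8 * ‖u‖ / r ^ 2 * |C|) with hB
  have hB0 : ∀ l, 0 ≤ B l := fun l => by have := hM0 l; positivity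
  -- near `x₀` the kernel is dominated by a Poisson kernel, elsewhere it is small
  have hpt : ∀ ε : ℝ, 0 < ε → ε < r / (2 * ‖u‖) → ∀ l,
      ∀ᵐ x ∂volume.restrict (Ioc ((Γ l).t 0) ((Γ l).t (Γ l).n)),
      ‖deriv (Γ l).γ x • (((Γ l).γ x - (v + ε * (I * u)))⁻¹ -
        ((Γ l).γ x - (v - ε * (I * u)))⁻¹) • g ((Γ l).γ x)‖ ≤
      M l * (32 / ‖u‖) * η * (ε / ((x - x₀) ^ 2 + ε ^ 2)) + B l * ε := by
    intro ε hε hεr l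
    have hna : ‖(ε : ℂ) * (I * u)‖ = ε * ‖u‖ := by
      rw [norm_mul, norm_mul, norm_I, one_mul, norm_real, Real.norm_of_nonneg hε.le]
    have hna2 : ε * ‖u‖ < r / 2 := by
      rw [lt_div_iff₀ (by positivity)] at hεr
      linarith
    filter_upwards [hM l, ae_restrict_mem measurableSet_Ioc] with x hx hx'
    have hxI := Ioc_subset_Icc_self hx'
    have hw : (Γ l).γ x ∈ trace Γ := image_subset_trace Γ l (mem_image_of_mem _ hxI)
    rw [norm_smul, norm_smul]
    have hP0 : 0 ≤ ε / ((x - x₀) ^ 2 + ε ^ 2) := by positivity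
    have hfar : r ≤ dist ((Γ l).γ x) v →
        ‖deriv (Γ l).γ x‖ * (‖((Γ l).γ x - (v + ε * (I * u)))⁻¹ -
          ((Γ l).γ x - (v - ε * (I * u)))⁻¹‖ * ‖g ((Γ l).γ x)‖) ≤
        M l * (32 / ‖u‖) * η * (ε / ((x - x₀) ^ 2 + ε ^ 2)) + B l * ε := by
      intro hdist
      rw [dist_eq_norm] at hdist
      have h1 : r / 2 ≤ ‖(Γ l).γ x - (v + ε * (I * u))‖ := by
        have := norm_sub_norm_le ((Γ l).γ x - v) (ε * (I * u))
        rw [hna] at this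
        rw [← sub_sub]
        linarith
      have h2 : r / 2 ≤ ‖(Γ l).γ x - (v - ε * (I * u))‖ := by
        have := norm_sub_le_norm_add ((Γ l).γ x - v) (ε * (I * u))
        rw [hna] at this
        rw [sub_sub_eq_add_sub, add_sub_right_comm]
        linarith
      have h3 := norm_inv_sub_inv_le (half_pos hr) h1 h2
      rw [hna] at h3
      have h4 : ‖g ((Γ l).γ x)‖ ≤ |C| := (hC _ hw).trans (le_abs_self C)
      have h5 : ‖deriv (Γ l).γ x‖ * (‖((Γ l).γ x - (v + ε * (I * u)))⁻¹ -
          ((Γ l).γ x - (v - ε * (I * u)))⁻¹‖ * ‖g ((Γ l).γ x)‖) ≤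
          M l * (2 * (ε * ‖u‖) / (r / 2) ^ 2 * |C|) := by
        have := hM0 l
        gcongr
      have h6 : M l * (2 * (ε * ‖u‖) / (r / 2) ^ 2 * |C|) = B l * ε := by
        simp only [hB]; field_simp; ring
      have h7 : 0 ≤ M l * (32 / ‖u‖) * η * (ε / ((x - x₀) ^ 2 + ε ^ 2)) := by
        have := hM0 l
        positivity
      linarith
    by_cases hl : l = k
    · subst hl
      by_cases hxn : x ∈ Ioo (x₀ - min δ₀ δ₁) (x₀ + min δ₀ δ₁)
      · have hxa : |x - x₀| < min δ₀ δ₁ := by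
          rw [abs_lt]; constructor <;> linarith [hxn.1, hxn.2]
        have hpos : 0 < ‖u‖ / 4 * (|x - x₀| + |ε|) := by
          rw [abs_of_pos hε]
          positivity
        have h1 := hest x (hxa.trans_le (min_le_left _ _)) ε
        have h2 := hest x (hxa.trans_le (min_le_left _ _)) (-ε)
        rw [abs_neg, ofReal_neg, neg_mul, ← sub_eq_add_neg] at h2
        have h3 := norm_inv_sub_inv_le hpos h1 h2
        rw [hna, abs_of_pos hε] at h3
        have h4 : 2 * (ε * ‖u‖) / (‖u‖ / 4 * (|x - x₀| + ε)) ^ 2 ≤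
            32 / ‖u‖ * (ε / ((x - x₀) ^ 2 + ε ^ 2)) := by
          have h5 : 2 * (ε * ‖u‖) / (‖u‖ / 4 * (|x - x₀| + ε)) ^ 2 =
              32 / ‖u‖ * (ε / (|x - x₀| + ε) ^ 2) := by
            field_simp; ring
          rw [h5]
          have h6 : (x - x₀) ^ 2 + ε ^ 2 ≤ (|x - x₀| + ε) ^ 2 := by
            rw [← sq_abs (x - x₀)]
            nlinarith [abs_nonneg (x - x₀)]
          gcongr
        have h7 : ‖g ((Γ l).γ x)‖ ≤ η := by
          have := hsmall (show dist x x₀ < δ₁ by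
            rw [Real.dist_eq]; exact hxa.trans_le (min_le_right _ _))
          rw [← hv, hg0, dist_zero_right] at this
          exact this.le
        have h8 : ‖deriv (Γ l).γ x‖ * (‖((Γ l).γ x - (v + ε * (I * u)))⁻¹ -
            ((Γ l).γ x - (v - ε * (I * u)))⁻¹‖ * ‖g ((Γ l).γ x)‖) ≤
            M l * (32 / ‖u‖ * (ε / ((x - x₀) ^ 2 + ε ^ 2)) * η) := by
          have := hM0 l
          have h9 := h3.trans h4
          gcongr
        have h10 : 0 ≤ B l * ε := mul_nonneg (hB0 l) hε.le
        calc _ ≤ _ := h8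
          _ = M l * (32 / ‖u‖) * η * (ε / ((x - x₀) ^ 2 + ε ^ 2)) := by ring
          _ ≤ _ := le_add_of_nonneg_right h10
      · exact hfar (hfar1 x hxI hxn)
    · exact hfar (hfar2 l hl _ (mem_image_of_mem _ hxI))
  have hmain : ∀ ε : ℝ, 0 < ε → ε < r / (2 * ‖u‖) →
      ‖contourIntegral Γ fun w => ((w - (v + ε * (I * u)))⁻¹ -
        (w - (v - ε * (I * u)))⁻¹) • g w‖ ≤
      A * η + (∑ l, B l * ((Γ l).t (Γ l).n - (Γ l).t 0)) * ε := by
    intro ε hε hεr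
    refine (norm_sum_le _ _).trans ?_
    rw [hA, Finset.sum_mul, Finset.sum_mul, ← Finset.sum_add_distrib]
    refine Finset.sum_le_sum fun l _ => ?_
    have hcont : Continuous fun x : ℝ => ε / ((x - x₀) ^ 2 + ε ^ 2) :=
      continuous_const.div (by fun_prop) fun x => by positivity
    have h1 := intervalIntegral.norm_integral_le_of_norm_le (μ := volume) (Γ l).t_zero_lt.le
      ((ae_restrict_iff' measurableSet_Ioc).1 (hpt ε hε hεr l))
      (Continuous.intervalIntegrable (by fun_prop) _ _)
    refine h1.trans ?_
    rw [intervalIntegral.integral_add (Continuous.intervalIntegrable (by fun_prop) _ _)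
      (Continuous.intervalIntegrable (by fun_prop) _ _), intervalIntegral.integral_const_mul,
      intervalIntegral.integral_const, smul_eq_mul]
    have h2 := integral_poisson_le (a := (Γ l).t 0) (b := (Γ l).t (Γ l).n) (x₀ := x₀) hε
    have h3 : 0 ≤ M l * (32 / ‖u‖) * η := by have := hM0 l; positivity
    have h4 := mul_le_mul_of_nonneg_left h2 h3
    linarith
  have hlim : Tendsto (fun ε : ℝ => A * η + (∑ l, B l * ((Γ l).t (Γ l).n - (Γ l).t 0)) * ε)
      (𝓝[>] 0) (𝓝 (A * η)) := by
    have : Continuous fun ε : ℝ => A * η + (∑ l, B l * ((Γ l).t (Γ l).n - (Γ l).t 0)) * ε := by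
      fun_prop
    simpa using (this.tendsto 0).mono_left nhdsWithin_le_nhds
  have hAη : A * η < κ := by
    rw [hη, mul_div_assoc', div_lt_iff₀ (by positivity)]
    nlinarith
  filter_upwards [hlim.eventually (gt_mem_nhds hAη),
    Ioo_mem_nhdsGT (show 0 < r / (2 * ‖u‖) by positivity)] with ε h1 h2
  rw [dist_zero_right, norm_norm]
  exact (hmain ε h2.1 h2.2).trans_lt h1

variable [CompleteSpace E]

/-- The jump relation: across a smooth point of the contour, the Cauchy integral jumps by the
density. The value of the density at the point contributes the jump of the winding number. -/
theorem IsSide.tendsto_jump (h : IsSide Γ D 1) (hb : Bornology.IsBounded D) {g : ℂ → E}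
    (hg : ContinuousOn g (trace Γ)) (k : Fin N) {i : ℕ} (hi : i < (Γ k).n) {x₀ : ℝ}
    (hx₀ : x₀ ∈ Ioo ((Γ k).t i) ((Γ k).t (i + 1))) :
    Tendsto (fun ε : ℝ =>
      cauchyIntegral Γ g ((Γ k).γ x₀ + ε * (I * deriv (Γ k).γ x₀)) -
        cauchyIntegral Γ g ((Γ k).γ x₀ - ε * (I * deriv (Γ k).γ x₀))) (𝓝[>] 0)
      (𝓝 (g ((Γ k).γ x₀))) := by
  set v := (Γ k).γ x₀ with hv
  set u := deriv (Γ k).γ x₀ with hu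
  have hg' : ContinuousOn (fun w => g w - g v) (trace Γ) := hg.sub continuousOn_const
  have h0 := jump_of_eq_zero h.disjoint hg' k hi hx₀ (sub_self _)
  have h1 := (h0.const_smul (2 * Real.pi * I : ℂ)⁻¹).add_const (g v)
  rw [smul_zero, zero_add] at h1
  refine h1.congr' ?_
  filter_upwards [h.left_right k i hi x₀ hx₀] with ε hε
  rw [ofReal_one, one_mul, ← hu, ← hv] at hε
  have hp : v + ε * (I * u) ∉ trace Γ := h.notMem_trace hε.1
  have hm : v - ε * (I * u) ∉ trace Γ := fun h' => hε.2 (h.trace_subset_closure h')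
  have hsplit : ∀ z ∉ trace Γ, cauchyIntegral Γ g z =
      cauchyIntegral Γ (fun w => g w - g v) z + cauchyIntegral Γ (fun _ => (1 : ℂ)) z • g v := by
    intro z hz
    have h2 := cauchyIntegral_add (Γ := Γ) (g := fun w => g w - g v)
      (h := fun _ => (1 : ℂ) • g v) hg' continuousOn_const hz
    simp only [one_smul, sub_add_cancel] at h2
    rw [h2, ← cauchyIntegral_smul_const]
    simp
  rw [hsplit _ hp, hsplit _ hm, h.cauchyIntegral_one_of_mem hb hε.1,
    h.cauchyIntegral_one_of_notMem hb hε.2, one_smul, zero_smul, add_zero, add_sub_right_comm]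
  congr 1
  rw [cauchyIntegral, cauchyIntegral, ← smul_sub]
  congr 1
  rw [← contourIntegral_sub Γ (continuousOn_inv_sub_smul hg' hp) (continuousOn_inv_sub_smul hg' hm)]
  simp only [sub_smul]
  rfl

end Jump

end SliceHyper

namespace SliceHyper

open Set Filter

/-! ### Slices of axially symmetric sets -/

section Geometry

theorem imagUnits_mul_self {j : ℍ} (hj : j ∈ imagUnits) : j * j = -1 := by
  have h1 := Quaternion.sq_eq_neg_normSq.2 hj.1
  rw [sq, Quaternion.normSq_eq_norm_mul_self, hj.2] at h1
  simpa using h1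

theorem neg_mem_imagUnits {j : ℍ} (hj : j ∈ imagUnits) : -j ∈ imagUnits :=
  ⟨by simp [hj.1], by simp [hj.2]⟩

/-- The embedding `ℂ ≃ ℂ_j ⊆ ℍ` as a homomorphism of algebras. -/
noncomputable def sliceHom {j : ℍ} (hj : j ∈ imagUnits) : ℂ →ₐ[ℝ] ℍ :=
  Complex.lift ⟨j, imagUnits_mul_self hj⟩

theorem sliceHom_apply {j : ℍ} (hj : j ∈ imagUnits) (z : ℂ) : sliceHom hj z = slicePt j z := by
  refine (Complex.liftAux_apply j (imagUnits_mul_self hj) z).trans ?_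
  rw [slicePt, Quaternion.mul_coe_eq_smul]
  rfl

theorem star_of_mem_imagUnits {j : ℍ} (hj : j ∈ imagUnits) : star j = -j :=
  Quaternion.star_eq_neg.2 hj.1

theorem slicePt_neg (j : ℍ) (z : ℂ) : slicePt (-j) z = slicePt j (star z) := by
  simp [slicePt]

theorem star_slicePt {j : ℍ} (hj : j ∈ imagUnits) (z : ℂ) :
    star (slicePt j z) = slicePt j (star z) := by
  simp only [slicePt, star_add, star_mul, Quaternion.star_coe, star_of_mem_imagUnits hj]
  simp [Quaternion.coe_mul_eq_smul, Quaternion.mul_coe_eq_smul]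

theorem slicePt_re {j : ℍ} (hj : j ∈ imagUnits) (z : ℂ) : (slicePt j z).re = z.re := by
  simp [slicePt, Quaternion.mul_coe_eq_smul, hj.1]

theorem slicePt_im {j : ℍ} (hj : j ∈ imagUnits) (z : ℂ) : (slicePt j z).im = z.im • j := by
  have : j.im = j := by ext <;> simp [hj.1]
  simp [slicePt, Quaternion.mul_coe_eq_smul, this]

theorem norm_slicePt {j : ℍ} (hj : j ∈ imagUnits) (z : ℂ) : ‖slicePt j z‖ = ‖z‖ := by
  have h0 : slicePt j z * slicePt j (star z) = slicePt j (Complex.normSq z : ℂ) := by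
    rw [← sliceHom_apply hj, ← sliceHom_apply hj, ← map_mul, Complex.star_def,
      Complex.mul_conj, sliceHom_apply hj]
  have h1 := Quaternion.self_mul_star (slicePt j z)
  rw [star_slicePt hj, h0, Quaternion.normSq_eq_norm_mul_self] at h1
  have h2 := congrArg (fun q : ℍ => q.re) h1
  simp only [slicePt_re hj, Complex.ofReal_re, Quaternion.re_coe] at h2
  rw [Complex.normSq_eq_norm_sq, sq] at h2
  exact ((mul_self_inj (norm_nonneg _) (norm_nonneg _)).1 h2).symm

theorem continuous_slicePt (j : ℍ) : Continuous (slicePt j) := by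
  have h : slicePt j = fun z => (z.re : ℍ) + z.im • j :=
    funext fun z => by rw [slicePt, Quaternion.mul_coe_eq_smul]
  rw [h]
  exact (Quaternion.continuous_coe.comp Complex.continuous_re).add
    (Complex.continuous_im.smul continuous_const)

/-- The point `(Re q, |Im q|)` of the closed upper half plane. -/
noncomputable def halfPt (q : ℍ) : ℂ := ⟨q.re, ‖q.im‖⟩

/-- The imaginary unit `i` of the quaternions. -/
def baseUnit : ℍ := ⟨0, 1, 0, 0⟩

theorem baseUnit_mem : baseUnit ∈ imagUnits := by
  refine ⟨rfl, ?_⟩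
  have h : ‖baseUnit‖ * ‖baseUnit‖ = 1 := by
    rw [← Quaternion.normSq_eq_norm_mul_self, Quaternion.normSq_def']
    simp [baseUnit]
  nlinarith [norm_nonneg baseUnit]

open Classical in
/-- The imaginary unit `Im q / |Im q|`, with an arbitrary value at the real points `q`. -/
noncomputable def imUnit (q : ℍ) : ℍ := if q.im = 0 then baseUnit else ‖q.im‖⁻¹ • q.im

theorem imUnit_mem (q : ℍ) : imUnit q ∈ imagUnits := by
  unfold imUnit
  split_ifs with h
  · exact baseUnit_mem
  · refine ⟨by simp, ?_⟩
    rw [norm_smul, norm_inv, norm_norm, inv_mul_cancel₀ (norm_ne_zero_iff.2 h)]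

theorem slicePt_imUnit (q : ℍ) : slicePt (imUnit q) (halfPt q) = q := by
  have h : slicePt (imUnit q) (halfPt q) = (q.re : ℍ) + q.im := by
    simp only [slicePt, halfPt, Quaternion.mul_coe_eq_smul]
    congr 1
    unfold imUnit
    split_ifs with h
    · simp [h]
    · rw [smul_smul, mul_inv_cancel₀ (norm_ne_zero_iff.2 h), one_smul]
  rw [h, Quaternion.re_add_im]

theorem continuous_halfPt : Continuous halfPt := by
  have h1 : halfPt = fun q : ℍ => (q.re : ℂ) + (‖q.im‖ : ℝ) * Complex.I := by
    ext q
    exact Complex.mk_eq_add_mul_I _ _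
  rw [h1]
  have h2 := Quaternion.continuous_re
  have h3 := Quaternion.continuous_im
  fun_prop

theorem halfPt_slicePt {j : ℍ} (hj : j ∈ imagUnits) (z : ℂ) :
    halfPt (slicePt j z) = z ∨ halfPt (slicePt j z) = star z := by
  have h : halfPt (slicePt j z) = ⟨z.re, |z.im|⟩ := by
    simp [halfPt, slicePt_re hj, slicePt_im hj, norm_smul, hj.2]
  rw [h]
  rcases abs_choice z.im with h | h
  · exact Or.inl (by rw [h])
  · refine Or.inr ?_
    rw [h]
    rfl

theorem star_mem_sliceBase {U : Set ℍ} {z : ℂ} (hz : z ∈ sliceBase U) :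
    star z ∈ sliceBase U := by
  intro j hj
  have := hz (-j) (neg_mem_imagUnits hj)
  rwa [slicePt_neg] at this

namespace AxiallySymmetric

variable {U V : Set ℍ} {i j : ℍ}

theorem slicePt_mem (hU : AxiallySymmetric U) (hi : i ∈ imagUnits) (hj : j ∈ imagUnits) {z : ℂ}
    (hz : slicePt i z ∈ U) : slicePt j z ∈ U := by
  have key : ∀ k ∈ imagUnits, slicePt k (halfPt (slicePt i z)) ∈ U := fun k hk =>
    hU _ hz ⟨k, hk, rfl⟩
  rcases halfPt_slicePt hi z with h | h
  · exact h ▸ key j hj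
  · have := key (-j) (neg_mem_imagUnits hj)
    rwa [h, slicePt_neg, star_star] at this

/-- A set whose slices are all the same subset of the plane is axially symmetric. -/
theorem of_slicePt_mem (h : ∀ z : ℂ, ∀ i ∈ imagUnits, ∀ j ∈ imagUnits, slicePt i z ∈ U →
    slicePt j z ∈ U) : AxiallySymmetric U := by
  rintro q hq _ ⟨j, hj, rfl⟩
  refine h (halfPt q) _ (imUnit_mem q) j hj ?_
  rwa [slicePt_imUnit]

theorem sliceBase_eq (hU : AxiallySymmetric U) (hj : j ∈ imagUnits) : sliceBase U = slice U j :=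
  Set.ext fun _ => ⟨fun hz => hz j hj, fun hz _ hi => hU.slicePt_mem hj hi hz⟩

theorem star_mem_slice (hU : AxiallySymmetric U) (hj : j ∈ imagUnits) {z : ℂ}
    (hz : z ∈ slice U j) : star z ∈ slice U j := by
  have := hU.slicePt_mem hj (neg_mem_imagUnits hj) hz
  rwa [slicePt_neg] at this

theorem halfPt_mem (hU : AxiallySymmetric U) {q : ℍ} (hq : q ∈ U) : halfPt q ∈ sliceBase U := by
  rw [hU.sliceBase_eq (imUnit_mem q)]
  change slicePt _ _ ∈ U
  rwa [slicePt_imUnit]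

/-- Slices commute with closures, since `q ↦ (Re q, |Im q|)` is continuous and maps an axially
symmetric set into its slices. -/
theorem slice_closure (hU : AxiallySymmetric U) (hj : j ∈ imagUnits) :
    slice (closure U) j = closure (slice U j) := by
  apply Subset.antisymm
  · intro z hz
    have h1 : halfPt (slicePt j z) ∈ closure (slice U j) := by
      refine closure_mono (image_subset_iff.2 fun q hq => ?_)
        (image_closure_subset_closure_image continuous_halfPt (mem_image_of_mem _ hz))
      rw [mem_preimage, ← hU.sliceBase_eq hj]
      exact hU.halfPt_mem hq
    rcases halfPt_slicePt hj z with h | h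
    · rwa [h] at h1
    · rw [h] at h1
      have h2 := image_closure_subset_closure_image Complex.continuous_conj
        (mem_image_of_mem _ h1)
      have h3 : (starRingEnd ℂ) '' slice U j ⊆ slice U j := by
        rintro _ ⟨w, hw, rfl⟩
        exact hU.star_mem_slice hj hw
      simpa using closure_mono h3 h2
  · exact (continuous_slicePt j).closure_preimage_subset U

protected theorem closure (hU : AxiallySymmetric U) : AxiallySymmetric (closure U) := by
  refine of_slicePt_mem fun z i hi j hj hz => ?_
  change z ∈ slice (closure U) j
  have h1 : z ∈ slice (closure U) i := hz
  rwa [hU.slice_closure hj, ← hU.sliceBase_eq hj, hU.sliceBase_eq hi, ← hU.slice_closure hi]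

protected theorem compl (hU : AxiallySymmetric U) : AxiallySymmetric Uᶜ :=
  of_slicePt_mem fun _ _ hi _ hj hz hz' => hz (hU.slicePt_mem hj hi hz')

protected theorem inter (hU : AxiallySymmetric U) (hV : AxiallySymmetric V) :
    AxiallySymmetric (U ∩ V) :=
  fun q hq _ hp => ⟨hU q hq.1 hp, hV q hq.2 hp⟩

protected theorem outer (hU : AxiallySymmetric U) : AxiallySymmetric (outer U) :=
  hU.closure.compl

protected theorem frontier (hU : AxiallySymmetric U) : AxiallySymmetric (frontier U) := by
  rw [frontier_eq_closure_inter_closure]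
  exact hU.closure.inter hU.compl.closure

theorem slice_outer (hU : AxiallySymmetric U) (hj : j ∈ imagUnits) :
    slice (outer U) j = (closure (slice U j))ᶜ := by
  rw [← hU.slice_closure hj]
  rfl

theorem slice_frontier (hU : AxiallySymmetric U) (hj : j ∈ imagUnits) :
    slice (frontier U) j = frontier (slice U j) := by
  rw [frontier_eq_closure_inter_closure, frontier_eq_closure_inter_closure]
  change slice (closure U) j ∩ slice (closure Uᶜ) j = _
  rw [hU.slice_closure hj, hU.compl.slice_closure hj]
  rfl

/-- The set of the inverses of the points of `V`, together with `0 = 1 / ∞`. -/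
theorem inv (hV : AxiallySymmetric V) : AxiallySymmetric ({p | p ≠ 0 ∧ p⁻¹ ∈ V} ∪ {0}) := by
  refine of_slicePt_mem fun z i hi j hj hz => ?_
  rcases eq_or_ne z 0 with rfl | hz0
  · right
    simp [slicePt]
  · left
    have h1 : slicePt i z ≠ 0 := by rw [← norm_ne_zero_iff, norm_slicePt hi]; simpa using hz0
    have h2 := (hz.resolve_right h1).2
    refine ⟨by rw [← norm_ne_zero_iff, norm_slicePt hj]; simpa using hz0, ?_⟩
    rw [← sliceHom_apply hi, ← map_inv₀, sliceHom_apply hi] at h2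
    rw [← sliceHom_apply hj, ← map_inv₀, sliceHom_apply hj]
    exact hV.slicePt_mem hi hj h2

end AxiallySymmetric

theorem slicePt_inv {j : ℍ} (hj : j ∈ imagUnits) (z : ℂ) : (slicePt j z)⁻¹ = slicePt j z⁻¹ := by
  rw [← sliceHom_apply hj, ← map_inv₀, sliceHom_apply hj]

theorem isOpen_slice {U : Set ℍ} (hU : IsOpen U) (j : ℍ) : IsOpen (slice U j) :=
  hU.preimage (continuous_slicePt j)

theorem isBounded_slice {U : Set ℍ} (hU : Bornology.IsBounded U) {j : ℍ} (hj : j ∈ imagUnits) :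
    Bornology.IsBounded (slice U j) := by
  obtain ⟨R, hR⟩ := hU.exists_norm_le
  exact isBounded_iff_forall_norm_le.2 ⟨R, fun z hz => norm_slicePt hj z ▸ hR _ hz⟩

theorem isOpen_inv_union {V : Set ℍ} (hV : IsOpen V) (hVb : Bornology.IsBounded Vᶜ) :
    IsOpen ({p | p ≠ 0 ∧ p⁻¹ ∈ V} ∪ {0} : Set ℍ) := by
  rw [isOpen_iff_mem_nhds]
  rintro p (⟨hp, hpV⟩ | hp)
  · have h1 : ContinuousAt (fun p : ℍ => p⁻¹) p := continuousAt_inv₀ hp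
    filter_upwards [h1.eventually (hV.eventually_mem hpV), eventually_ne_nhds hp] with q hq hq0
    exact Or.inl ⟨hq0, hq⟩
  · obtain rfl : p = 0 := hp
    obtain ⟨R, hR0, hR⟩ := hVb.exists_pos_norm_le
    filter_upwards [Metric.ball_mem_nhds (0 : ℍ) (inv_pos.2 hR0)] with q hq
    by_cases hq0 : q = 0
    · exact Or.inr hq0
    refine Or.inl ⟨hq0, ?_⟩
    by_contra hcon
    have h1 := hR _ hcon
    rw [norm_inv] at h1
    rw [mem_ball_zero_iff] at hq
    have h2 : 0 < ‖q‖ := norm_pos_iff.2 hq0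
    rw [lt_inv_comm₀ h2 hR0] at hq
    linarith

end Geometry

/-! ### Slice functions -/

section SliceFunctions

variable {X : Type*} [NormedAddCommGroup X] [NormedSpace ℂ X] [Module ℍ X]
  [IsScalarTower ℝ ℍ X] [NormSMulClass ℍ X]

/-- The even part of a slice function, from its values on `ℂ_j`. -/
noncomputable def evenPart (f : ℍ → X) (j : ℍ) (z : ℂ) : X :=
  (2⁻¹ : ℝ) • (f (slicePt j z) + f (slicePt j (star z)))

/-- The odd part of a slice function, from its values on `ℂ_j`. -/
noncomputable def oddPart (f : ℍ → X) (j : ℍ) (z : ℂ) : X :=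
  -((2⁻¹ : ℝ) • j • (f (slicePt j z) - f (slicePt j (star z))))

/-- The representation formula: the values of `f` on `V` are determined by those on `ℂ_j`. -/
def SliceFormula (f : ℍ → X) (V : Set ℍ) (j : ℍ) : Prop :=
  ∀ z ∈ sliceBase V, ∀ i ∈ imagUnits, f (slicePt i z) = evenPart f j z + i • oddPart f j z

variable {f : ℍ → X} {V : Set ℍ} {j : ℍ}

omit [NormSMulClass ℍ X] [IsScalarTower ℝ ℍ X] in
theorem SliceFormula.isLeftSliceRep (h : SliceFormula f V j) :
    IsLeftSliceRep V f (evenPart f j) (oddPart f j) where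
  even z _ := by simp only [evenPart, star_star, add_comm]
  odd z _ := by
    simp only [oddPart, star_star]
    rw [← neg_sub (f (slicePt j z)), smul_neg, smul_neg]
  eq := h

omit [NormSMulClass ℍ X] [NormedSpace ℂ X] [IsScalarTower ℝ ℍ X] in
theorem imagUnits_smul_smul (hj : j ∈ imagUnits) (x : X) : j • j • x = -x := by
  rw [smul_smul, imagUnits_mul_self hj, neg_smul, one_smul]

omit [NormSMulClass ℍ X] [Module ℍ X] [IsScalarTower ℝ ℍ X] in
theorem smul_half_add (x : X) : (2⁻¹ : ℝ) • (x + x) = x := by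
  rw [← two_smul ℝ x, smul_smul]; norm_num

omit [NormSMulClass ℍ X] [IsScalarTower ℝ ℍ X] in
/-- The coefficients of a slice function are recovered from its values on `ℂ_j`. -/
theorem IsLeftSliceRep.eq_parts {f₀ f₁ : ℂ → X} (h : IsLeftSliceRep V f f₀ f₁)
    (hj : j ∈ imagUnits) {z : ℂ} (hz : z ∈ sliceBase V) :
    evenPart f j z = f₀ z ∧ oddPart f j z = f₁ z := by
  have h1 := h.eq z hz j hj
  have h2 := h.eq _ (star_mem_sliceBase hz) j hj
  rw [h.even z hz, h.odd z hz, smul_neg] at h2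
  constructor
  · rw [evenPart, h1, h2, show f₀ z + j • f₁ z + (f₀ z + -(j • f₁ z)) = f₀ z + f₀ z by abel,
      smul_half_add]
  · rw [oddPart, h1, h2, show f₀ z + j • f₁ z - (f₀ z + -(j • f₁ z)) = j • f₁ z + j • f₁ z by abel,
      smul_add, imagUnits_smul_smul hj, smul_half_add, neg_neg]

omit [NormSMulClass ℍ X] [IsScalarTower ℝ ℍ X] in
theorem IsLeftSliceRep.sliceFormula {f₀ f₁ : ℂ → X} (h : IsLeftSliceRep V f f₀ f₁)
    (hj : j ∈ imagUnits) : SliceFormula f V j := by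
  intro z hz i hi
  rw [(h.eq_parts hj hz).1, (h.eq_parts hj hz).2]
  exact h.eq z hz i hi

omit [NormSMulClass ℍ X] [IsScalarTower ℝ ℍ X] in
theorem SliceFormula.congr {g : ℍ → X} (h : SliceFormula f V j) (hj : j ∈ imagUnits)
    (hfg : EqOn g f V) : SliceFormula g V j := by
  intro z hz i hi
  have h1 : evenPart g j z = evenPart f j z := by
    rw [evenPart, evenPart, hfg (hz j hj), hfg (star_mem_sliceBase hz j hj)]
  have h2 : oddPart g j z = oddPart f j z := by
    rw [oddPart, oddPart, hfg (hz j hj), hfg (star_mem_sliceBase hz j hj)]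
  rw [h1, h2, hfg (hz i hi)]
  exact h z hz i hi

omit [IsScalarTower ℝ ℍ X] in
/-- A slice continuous function is continuous, also at the real points, since its odd part
vanishes there. -/
theorem LeftSliceContinuousOn.continuousOn (hV : AxiallySymmetric V)
    (h : LeftSliceContinuousOn f V) : ContinuousOn f V := by
  obtain ⟨f₀, f₁, hrep, h0, h1⟩ := h
  have hmaps : MapsTo halfPt V (sliceBase V) := fun q hq => hV.halfPt_mem hq
  have h0' := h0.comp continuous_halfPt.continuousOn hmaps
  have h1' := h1.comp continuous_halfPt.continuousOn hmaps
  have heq : EqOn f (fun q => f₀ (halfPt q) + imUnit q • f₁ (halfPt q)) V := by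
    intro q hq
    have := hrep.eq _ (hV.halfPt_mem hq) _ (imUnit_mem q)
    rwa [slicePt_imUnit] at this
  refine ContinuousOn.congr ?_ heq
  refine h0'.add fun q hq => ?_
  -- `imUnit` is discontinuous at the real points, but bounded
  by_cases him : q.im = 0
  · have hstar : star (halfPt q) = halfPt q := by
      apply Complex.ext <;> simp [halfPt, him]
    have hz : f₁ (halfPt q) = 0 := by
      have h2 := hrep.odd _ (hV.halfPt_mem hq)
      rw [hstar] at h2
      rw [← smul_half_add (f₁ (halfPt q)), add_eq_zero_iff_eq_neg.2 h2, smul_zero]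
    have h3 : Tendsto (fun q => f₁ (halfPt q)) (𝓝[V] q) (𝓝 0) := by
      have := (h1' q hq).tendsto
      simpa [Function.comp_def, hz] using this
    change Tendsto _ _ (𝓝 (imUnit q • f₁ (halfPt q)))
    rw [hz, smul_zero]
    rw [tendsto_zero_iff_norm_tendsto_zero] at h3 ⊢
    simpa [norm_smul, (imUnit_mem _).2] using h3
  · have h2 : ContinuousAt imUnit q := by
      have h3 : ContinuousAt (fun q : ℍ => ‖q.im‖⁻¹ • q.im) q :=
        (Quaternion.continuous_im.norm.continuousAt.inv₀ (norm_ne_zero_iff.2 him)).smul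
          Quaternion.continuous_im.continuousAt
      refine h3.congr ?_
      filter_upwards [Quaternion.continuous_im.continuousAt.eventually_ne him] with p hp
      simp [imUnit, hp]
    exact h2.continuousWithinAt.smul (h1' q hq)

omit [IsScalarTower ℝ ℍ X] in
/-- A slice function on `V` that is continuous up to the boundary is slice continuous there: the
representation formula extends to the closure by continuity. -/
theorem SliceFormula.leftSliceContinuousOn_closure (hj : j ∈ imagUnits) (hV : AxiallySymmetric V)
    (h : SliceFormula f V j) (hf : ContinuousOn f (closure V)) :
    LeftSliceContinuousOn f (closure V) := by
  have hb : ∀ i ∈ imagUnits, sliceBase (closure V) = closure (sliceBase V) := fun i hi => by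
    rw [hV.closure.sliceBase_eq hi, hV.slice_closure hi, hV.sliceBase_eq hi]
  have hc : ∀ i ∈ imagUnits, ContinuousOn (fun z => f (slicePt i z)) (sliceBase (closure V)) :=
    fun i hi => hf.comp (continuous_slicePt i).continuousOn fun z hz => hz i hi
  have hc' : ContinuousOn (fun z => f (slicePt j (star z))) (sliceBase (closure V)) :=
    (hc j hj).comp (t := sliceBase (closure V)) (f := star) continuous_star.continuousOn
      fun z hz => star_mem_sliceBase hz
  have h0 : ContinuousOn (evenPart f j) (sliceBase (closure V)) :=
    ((hc j hj).add hc').const_smul _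
  have h1 : ContinuousOn (oddPart f j) (sliceBase (closure V)) :=
    ((((hc j hj).sub hc').const_smul j).const_smul (2⁻¹ : ℝ)).neg
  have hform : SliceFormula f (closure V) j := by
    intro z hz i hi
    have heq : EqOn (fun z => f (slicePt i z)) (fun z => evenPart f j z + i • oddPart f j z)
        (sliceBase V) := fun w hw => h w hw i hi
    refine heq.of_subset_closure (hc i hi) (h0.add (h1.const_smul i)) ?_ ?_ hz
    · exact fun w hw k hk => subset_closure (hw k hk)
    · rw [hb i hi]
  exact ⟨_, _, hform.isLeftSliceRep, h0, h1⟩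

/-- The multiplication by a quaternion, as a continuous real linear map. -/
noncomputable def quatSMul (X : Type*) [NormedAddCommGroup X] [NormedSpace ℝ X] [Module ℍ X]
    [IsScalarTower ℝ ℍ X] [NormSMulClass ℍ X] (q : ℍ) : X →L[ℝ] X :=
  ContinuousLinearMap.lsmul ℝ ℍ q

theorem quatSMul_apply (q : ℍ) (x : X) : quatSMul X q x = q • x := rfl

/-- If `i` acts on `X` as the imaginary unit `j`, then the Cauchy-Riemann equations of the
coefficients say that the restriction to `ℂ_j` is holomorphic. -/
theorem LeftSliceHyperholomorphicOn.differentiableOn (hI : ∀ x : X, Complex.I • x = j • x)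
    (hj : j ∈ imagUnits) (hV : AxiallySymmetric V) (hVo : IsOpen V)
    (h : LeftSliceHyperholomorphicOn f V) :
    DifferentiableOn ℂ (fun z => f (slicePt j z)) (slice V j) := by
  obtain ⟨f₀, f₁, hrep, hd⟩ := h
  intro z hz
  rw [← hV.sliceBase_eq hj] at hz
  obtain ⟨h0, h1, hcr1, hcr2⟩ := hd z hz
  have heq : (fun z => f (slicePt j z)) =ᶠ[𝓝 z] fun z => f₀ z + quatSMul X j (f₁ z) := by
    have : slice V j ∈ 𝓝 z := (isOpen_slice hVo j).mem_nhds (hz j hj)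
    filter_upwards [this] with w hw
    rw [← hV.sliceBase_eq hj] at hw
    exact hrep.eq w hw j hj
  have hder : HasFDerivAt (fun z => f₀ z + quatSMul X j (f₁ z))
      (fderiv ℝ f₀ z + (quatSMul X j).comp (fderiv ℝ f₁ z)) z :=
    h0.hasFDerivAt.add ((quatSMul X j).hasFDerivAt.comp z h1.hasFDerivAt)
  refine DifferentiableAt.differentiableWithinAt (DifferentiableAt.congr_of_eventuallyEq ?_ heq)
  refine differentiableAt_complex_iff_differentiableAt_real.2 ⟨hder.differentiableAt, ?_⟩
  rw [hder.fderiv]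
  simp only [add_apply, ContinuousLinearMap.comp_apply, quatSMul_apply]
  rw [hI, smul_add, imagUnits_smul_smul hj, eq_neg_of_add_eq_zero_left hcr1,
    sub_eq_zero.1 hcr2]
  abel

/-- A slice function is slice hyperholomorphic if its restriction to `ℂ_j` is holomorphic. -/
theorem SliceFormula.leftSliceHyperholomorphicOn (hI : ∀ x : X, Complex.I • x = j • x)
    (hj : j ∈ imagUnits) (hV : AxiallySymmetric V) (hVo : IsOpen V) (h : SliceFormula f V j)
    (hd : DifferentiableOn ℂ (fun z => f (slicePt j z)) (slice V j)) :
    LeftSliceHyperholomorphicOn f V := by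
  refine ⟨_, _, h.isLeftSliceRep, fun z hz => ?_⟩
  have hdiff : ∀ w ∈ sliceBase V, DifferentiableAt ℂ (fun z => f (slicePt j z)) w := by
    intro w hw
    rw [hV.sliceBase_eq hj] at hw
    exact hd.differentiableAt ((isOpen_slice hVo j).mem_nhds hw)
  obtain ⟨hL, hLI⟩ := differentiableAt_complex_iff_differentiableAt_real.1 (hdiff z hz)
  obtain ⟨hM, hMI⟩ := differentiableAt_complex_iff_differentiableAt_real.1
    (hdiff _ (star_mem_sliceBase hz))
  set L := fderiv ℝ (fun z => f (slicePt j z)) z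
  set M := fderiv ℝ (fun z => f (slicePt j z)) (star z)
  have h1 : HasFDerivAt (fun z => f (slicePt j z)) L z := hL.hasFDerivAt
  have h2 : HasFDerivAt (fun z => f (slicePt j (star z)))
      (M.comp (Complex.conjCLE : ℂ →L[ℝ] ℂ)) z :=
    HasFDerivAt.comp z (f := fun z => Complex.conjCLE z) hM.hasFDerivAt
      Complex.conjCLE.hasFDerivAt
  have h3 : HasFDerivAt (evenPart f j)
      ((2⁻¹ : ℝ) • (L + M.comp (Complex.conjCLE : ℂ →L[ℝ] ℂ))) z := (h1.add h2).const_smul _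
  have h4 : HasFDerivAt (oddPart f j) (-((2⁻¹ : ℝ) • (quatSMul X j).comp
      (L - M.comp (Complex.conjCLE : ℂ →L[ℝ] ℂ)))) z :=
    (((quatSMul X j).hasFDerivAt.comp z (h1.sub h2)).const_smul (2⁻¹ : ℝ)).neg
  refine ⟨h3.differentiableAt, h4.differentiableAt, ?_, ?_⟩
  · rw [h3.fderiv, h4.fderiv]
    simp only [smul_apply, neg_apply, add_apply, sub_apply, ContinuousLinearMap.comp_apply,
      quatSMul_apply]
    simp only [ContinuousLinearEquiv.coe_coe, Complex.conjCLE_apply, Complex.conj_I, map_one,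
      map_neg, hLI, hMI, hI, smul_sub, smul_add, smul_neg]
    abel
  · rw [h3.fderiv, h4.fderiv]
    simp only [smul_apply, neg_apply, add_apply, sub_apply, ContinuousLinearMap.comp_apply,
      quatSMul_apply]
    simp only [ContinuousLinearEquiv.coe_coe, Complex.conjCLE_apply, Complex.conj_I, map_one,
      map_neg, hLI, hMI, hI, smul_sub, smul_add, smul_neg, imagUnits_smul_smul hj]
    abel

end SliceFunctions

section SliceFormulaAlgebra

variable {X : Type*} [NormedAddCommGroup X] [NormedSpace ℂ X] [Module ℍ X]
variable {f g : ℍ → X} {V W : Set ℍ} {j : ℍ}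

theorem SliceFormula.mono (h : SliceFormula f W j) (hVW : V ⊆ W) : SliceFormula f V j :=
  fun z hz i hi => h z (fun k hk => hVW (hz k hk)) i hi

theorem SliceFormula.add (hf : SliceFormula f V j) (hg : SliceFormula g V j) :
    SliceFormula (fun q => f q + g q) V j := by
  intro z hz i hi
  simp only [hf z hz i hi, hg z hz i hi, evenPart, oddPart, smul_add, smul_sub, smul_neg]
  abel

theorem SliceFormula.neg (hf : SliceFormula f V j) : SliceFormula (fun q => -f q) V j := by
  intro z hz i hi
  simp only [hf z hz i hi, evenPart, oddPart, smul_add, smul_sub, smul_neg]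
  abel

theorem SliceFormula.const (c : X) : SliceFormula (fun _ => c) V j := by
  intro z _ i _
  simp only [evenPart, oddPart, sub_self, smul_zero, neg_zero, add_zero, smul_half_add]

/-- Slice functions that agree on one slice agree. -/
theorem SliceFormula.eqOn (hf : SliceFormula f V j) (hg : SliceFormula g V j) (hj : j ∈ imagUnits)
    (hV : AxiallySymmetric V) (h : ∀ z ∈ slice V j, f (slicePt j z) = g (slicePt j z)) :
    EqOn f g V := by
  intro q hq
  have hm := hV.halfPt_mem hq
  have h1 := hf _ hm _ (imUnit_mem q)
  have h2 := hg _ hm _ (imUnit_mem q)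
  rw [slicePt_imUnit] at h1 h2
  rw [h1, h2, evenPart, oddPart, evenPart, oddPart, h _ (hm j hj),
    h _ (star_mem_sliceBase hm j hj)]

end SliceFormulaAlgebra

/-! ### The Cauchy transform -/

section Transform

/-- The Cauchy kernel is a slice function of its second variable: its coefficients are the same
for all imaginary units. -/
theorem exists_cauchyKernel_eq (s : ℍ) (z : ℂ) :
    ∃ S₀ S₁ : ℍ, ∀ i ∈ imagUnits, cauchyKernel s (slicePt i z) = S₀ + i * S₁ := by
  set A : ℂ := -(z ^ 2 - 2 * z * (s.re : ℂ) + ((‖s‖ ^ 2 : ℝ) : ℂ))⁻¹ with hA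
  refine ⟨A.re • (z.re - star s) - ((A.im * z.im : ℝ) : ℍ),
    ((A.re * z.im : ℝ) : ℍ) + A.im • (z.re - star s), fun i hi => ?_⟩
  have hcoe : ∀ r : ℝ, (r : ℍ) = sliceHom hi (r : ℂ) := fun r => by
    rw [sliceHom_apply]; simp [slicePt]
  have hQ : slicePt i z ^ 2 - 2 * slicePt i z * (s.re : ℍ) + ((‖s‖ ^ 2 : ℝ) : ℍ) =
      sliceHom hi (z ^ 2 - 2 * z * (s.re : ℂ) + ((‖s‖ ^ 2 : ℝ) : ℂ)) := by
    rw [hcoe, hcoe, ← sliceHom_apply hi]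
    simp only [map_add, map_sub, map_mul, map_pow, map_ofNat]
  have hii := imagUnits_mul_self hi
  rw [cauchyKernel, hQ, ← map_inv₀, ← map_neg, ← hA, sliceHom_apply]
  simp only [slicePt, Quaternion.mul_coe_eq_smul, Quaternion.coe_mul]
  simp only [← Quaternion.coe_mul_eq_smul]
  have c1 : ∀ (r : ℝ) (q : ℍ), q * (r : ℍ) = r * q := fun r q => (Quaternion.coe_commutes r q).symm
  have hc := Quaternion.coe_commutes A.im i
  have hc' := Quaternion.coe_commutes z.im i
  have hc2 := Quaternion.coe_commutes A.re i
  have hc3 := Quaternion.coe_commutes z.im (A.im : ℍ)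
  -- with `A = a + b I` and `z = u + v I`, expand `(a + i b) (u + i v - star s)`
  calc ((A.re : ℍ) + A.im * i) * (z.re + z.im * i - star s)
      = A.re * (z.re - star s) + A.re * z.im * i + A.im * i * (z.re - star s)
        + A.im * (i * z.im) * i := by noncomm_ring
    _ = A.re * (z.re - star s) + i * (A.re * z.im) + i * A.im * (z.re - star s)
        + A.im * z.im * (i * i) := by
          rw [← hc', ← hc, ← mul_assoc i, ← hc2, mul_assoc (A.re : ℍ) i, ← hc']
          noncomm_ring
    _ = _ := by
          rw [hii, mul_add, c1 z.im (A.re : ℍ), ← hc3]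
          noncomm_ring

/-- On a slice, the quaternionic kernel is the complex Cauchy kernel, since
`z² - 2 z Re w + |w|² = (z - w) (z - w̄)`. -/
theorem cauchyKernel_slicePt {j : ℍ} (hj : j ∈ imagUnits) {w z : ℂ} (hwz : w ≠ z)
    (hwz' : w ≠ star z) : cauchyKernel (slicePt j w) (slicePt j z) = slicePt j (w - z)⁻¹ := by
  have hcoe : ∀ r : ℝ, (r : ℍ) = sliceHom hj (r : ℂ) := fun r => by
    rw [sliceHom_apply]; simp [slicePt]
  rw [cauchyKernel, star_slicePt hj, slicePt_re hj, norm_slicePt hj, hcoe, hcoe,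
    ← sliceHom_apply hj, ← sliceHom_apply hj, ← sliceHom_apply hj]
  simp only [← map_ofNat (sliceHom hj), ← map_mul, ← map_pow, ← map_sub, ← map_add, ← map_inv₀,
    ← map_neg]
  congr 1
  have h1 : (2 * w.re : ℂ) = w + star w := by
    rw [Complex.star_def, Complex.add_conj]; push_cast; rfl
  have h2 : ((‖w‖ ^ 2 : ℝ) : ℂ) = w * star w := by
    rw [Complex.star_def, Complex.mul_conj, Complex.normSq_eq_norm_sq]
  have h3 : z ^ 2 - 2 * z * (w.re : ℂ) + ((‖w‖ ^ 2 : ℝ) : ℂ) = (z - w) * (z - star w) := by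
    rw [h2, show (2 * z * w.re : ℂ) = z * (2 * w.re) by ring, h1]; ring
  have h4 : z - star w ≠ 0 := fun h => hwz' (by rw [sub_eq_zero.1 h, star_star])
  have h5 : z - w ≠ 0 := sub_ne_zero.2 hwz.symm
  have h6 : w - z ≠ 0 := sub_ne_zero.2 hwz
  rw [h3]
  field_simp
  ring

variable {X : Type*} [NormedAddCommGroup X] [NormedSpace ℂ X] [CompleteSpace X] [Module ℍ X]
  [IsScalarTower ℝ ℍ X] [NormSMulClass ℍ X]
variable {f : ℍ → X} {V : Set ℍ} {j : ℍ} {N : ℕ} {Γ : Fin N → PwC1ClosedCurve}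

omit [CompleteSpace X] [IsScalarTower ℝ ℍ X] [NormSMulClass ℍ X] in
theorem cauchyKernel_smul_eq (hj : j ∈ imagUnits) (hc : ∀ (c : ℂ) (x : X), c • x = slicePt j c • x)
    {w z : ℂ} (hwz : w ≠ z) (hwz' : w ≠ star z) (d : ℂ) (x : X) :
    (cauchyKernel (slicePt j w) (slicePt j z) * (-j * slicePt j d)) • x =
      d • (-Complex.I) • (w - z)⁻¹ • x := by
  have hI : -j = sliceHom hj (-Complex.I) := by rw [sliceHom_apply]; simp [slicePt]
  rw [cauchyKernel_slicePt hj hwz hwz', hI, ← sliceHom_apply hj, ← sliceHom_apply hj, ← map_mul,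
    ← map_mul, sliceHom_apply hj, ← hc, smul_smul, smul_smul]
  ring_nf

omit [CompleteSpace X] [IsScalarTower ℝ ℍ X] [NormSMulClass ℍ X] in
/-- On the slice of the contour, the Cauchy transform is the Cauchy integral. -/
theorem cauchyTransform_slicePt (hj : j ∈ imagUnits)
    (hc : ∀ (c : ℂ) (x : X), c • x = slicePt j c • x) {z : ℂ} (hz : z ∉ trace Γ)
    (hz' : star z ∉ trace Γ) :
    cauchyTransform j Γ f (slicePt j z) = cauchyIntegral Γ (fun w => f (slicePt j w)) z := by
  have h1 : (2 * (Real.pi : ℂ) * Complex.I)⁻¹ = ((2 * Real.pi : ℝ)⁻¹ : ℝ) * (-Complex.I) := by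
    push_cast
    rw [mul_inv (2 * (Real.pi : ℂ)), Complex.inv_I]
  rw [cauchyIntegral, cauchyTransform, h1, mul_smul, ← contourIntegral_smul, Complex.coe_smul]
  congr 1
  refine Finset.sum_congr rfl fun k _ => ?_
  refine intervalIntegral.integral_congr fun x hx => ?_
  rw [uIcc_of_le (Γ k).t_zero_lt.le] at hx
  have hx' : (Γ k).γ x ∈ trace Γ := image_subset_trace Γ k (mem_image_of_mem _ hx)
  exact cauchyKernel_smul_eq hj hc (ne_of_mem_of_not_mem hx' hz) (ne_of_mem_of_not_mem hx' hz') _ _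

omit [CompleteSpace X] [IsScalarTower ℝ ℍ X] [NormSMulClass ℍ X] in
theorem intervalIntegrable_cauchyKernel (hj : j ∈ imagUnits)
    (hc : ∀ (c : ℂ) (x : X), c • x = slicePt j c • x)
    (hg : ContinuousOn (fun w => f (slicePt j w)) (trace Γ)) {z : ℂ} (hz : z ∉ trace Γ)
    (hz' : star z ∉ trace Γ) (k : Fin N) :
    IntervalIntegrable (fun x => (cauchyKernel (slicePt j ((Γ k).γ x)) (slicePt j z) *
      (-j * slicePt j (deriv (Γ k).γ x))) • f (slicePt j ((Γ k).γ x))) MeasureTheory.volume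
      ((Γ k).t 0) ((Γ k).t (Γ k).n) := by
  have h1 := ((continuousOn_inv_sub_smul hg hz).const_smul (-Complex.I)).mono
    (image_subset_trace Γ k)
  refine ((Γ k).intervalIntegrable h1).congr fun x hx => ?_
  rw [uIoc_of_le (Γ k).t_zero_lt.le] at hx
  have hx' : (Γ k).γ x ∈ trace Γ :=
    image_subset_trace Γ k (mem_image_of_mem _ (Ioc_subset_Icc_self hx))
  exact (cauchyKernel_smul_eq hj hc (ne_of_mem_of_not_mem hx' hz)
    (ne_of_mem_of_not_mem hx' hz') _ _).symm

/-- Off the contour, the Cauchy transform is a slice function, because the kernel is. -/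
theorem sliceFormula_cauchyTransform (hj : j ∈ imagUnits)
    (hc : ∀ (c : ℂ) (x : X), c • x = slicePt j c • x) (hV : AxiallySymmetric V)
    (hg : ContinuousOn (fun w => f (slicePt j w)) (trace Γ))
    (hdisj : ∀ z ∈ slice V j, z ∉ trace Γ) :
    SliceFormula (cauchyTransform j Γ f) V j := by
  intro z hz i hi
  rw [hV.sliceBase_eq hj] at hz
  have hz1 := hdisj z hz
  have hz2 := hdisj _ (hV.star_mem_slice hj hz)
  have hint := intervalIntegrable_cauchyKernel hj hc hg hz1 hz2
  have hint' := intervalIntegrable_cauchyKernel hj hc hg hz2 (by rwa [star_star])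
  have key : ∀ s : ℍ, cauchyKernel s (slicePt i z) =
      (2⁻¹ : ℝ) • (1 - i * j) * cauchyKernel s (slicePt j z) +
      (2⁻¹ : ℝ) • (1 + i * j) * cauchyKernel s (slicePt j (star z)) := by
    intro s
    obtain ⟨S₀, S₁, hS⟩ := exists_cauchyKernel_eq s z
    rw [← slicePt_neg, hS i hi, hS j hj, hS _ (neg_mem_imagUnits hj), smul_mul_assoc,
      smul_mul_assoc, ← smul_add]
    have e1 : (1 - i * j) * (S₀ + j * S₁) + (1 + i * j) * (S₀ + -j * S₁) =
        (2 : ℝ) • (S₀ + i * S₁) := by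
      rw [two_smul]
      calc _ = S₀ + S₀ - (i * (j * j) * S₁ + i * (j * j) * S₁) := by noncomm_ring
        _ = _ := by rw [imagUnits_mul_self hj]; noncomm_ring
    rw [e1, smul_smul]
    norm_num
  have hT : cauchyTransform j Γ f (slicePt i z) =
      quatSMul X ((2⁻¹ : ℝ) • (1 - i * j)) (cauchyTransform j Γ f (slicePt j z)) +
      quatSMul X ((2⁻¹ : ℝ) • (1 + i * j)) (cauchyTransform j Γ f (slicePt j (star z))) := by
    simp only [cauchyTransform, map_smul, map_sum]
    rw [← smul_add, ← Finset.sum_add_distrib]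
    congr 1
    refine Finset.sum_congr rfl fun k _ => ?_
    rw [← ContinuousLinearMap.intervalIntegral_comp_comm _ (hint k),
      ← ContinuousLinearMap.intervalIntegral_comp_comm _ (hint' k),
      ← intervalIntegral.integral_add
        ⟨(quatSMul X _).integrable_comp (hint k).1, (quatSMul X _).integrable_comp (hint k).2⟩
        ⟨(quatSMul X _).integrable_comp (hint' k).1,
          (quatSMul X _).integrable_comp (hint' k).2⟩]
    refine intervalIntegral.integral_congr fun x _ => ?_
    simp only [quatSMul_apply, smul_smul]
    rw [← add_smul, key, add_mul, mul_assoc, mul_assoc]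
  rw [hT, evenPart, oddPart, quatSMul_apply, quatSMul_apply, smul_neg, smul_comm i (2⁻¹ : ℝ),
    smul_assoc, smul_assoc, ← smul_add, sub_smul, add_smul, one_smul, one_smul, ← sub_eq_add_neg,
    ← smul_sub, smul_sub j, smul_sub i, smul_smul i j, smul_smul i j]
  congr 1
  abel

end Transform

/-! ### Behaviour at infinity -/

section Infinity

variable {X : Type*} [NormedAddCommGroup X] [NormedSpace ℂ X] [Module ℍ X]
  [IsScalarTower ℝ ℍ X] [NormSMulClass ℍ X]
variable {V : Set ℍ} {j : ℍ}

theorem invInfty_zero : invInfty 0 = ∞ := by simp [invInfty]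

theorem invInfty_of_ne {p : ℍ} (hp : p ≠ 0) : invInfty p = ((p⁻¹ : ℍ) : OnePoint ℍ) := by
  simp [invInfty, hp]

theorem slicePt_zero (j : ℍ) : slicePt j 0 = 0 := by simp [slicePt]

theorem slicePt_ne_zero (hj : j ∈ imagUnits) {z : ℂ} (hz : z ≠ 0) : slicePt j z ≠ 0 := by
  rw [← norm_ne_zero_iff, norm_slicePt hj]
  simpa using hz

/-- Slice hyperholomorphy at infinity implies continuity there. -/
theorem LeftSliceHyperholomorphicOnInfty.tendsto_cobounded
    (hI : ∀ x : X, Complex.I • x = j • x) (hj : j ∈ imagUnits) (hV : AxiallySymmetric V)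
    (hVo : IsOpen V) (hVb : Bornology.IsBounded Vᶜ) {g : OnePoint ℍ → X}
    (h : LeftSliceHyperholomorphicOnInfty g V) :
    Tendsto (fun z : ℂ => g (slicePt j z : ℍ)) (Bornology.cobounded ℂ) (𝓝 (g ∞)) := by
  have hW := isOpen_inv_union hVo hVb
  have hd := h.2.differentiableOn hI hj hV.inv hW
  have h0 : (0 : ℂ) ∈ slice ({p | p ≠ 0 ∧ p⁻¹ ∈ V} ∪ {0}) j := Or.inr (slicePt_zero j)
  have hc := (hd.differentiableAt ((isOpen_slice hW j).mem_nhds h0)).continuousAt.tendsto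
  rw [slicePt_zero, invInfty_zero] at hc
  refine (hc.comp tendsto_inv₀_cobounded).congr' ?_
  filter_upwards [Bornology.eventually_ne_cobounded (0 : ℂ)] with z hz
  simp only [Function.comp_apply]
  rw [invInfty_of_ne (slicePt_ne_zero hj (inv_ne_zero hz)), slicePt_inv hj, inv_inv]

/-- At infinity, slice hyperholomorphy amounts to the existence of the limit, by the theorem on
removable singularities. -/
theorem SliceFormula.leftSliceHyperholomorphicOnInfty [CompleteSpace X]
    (hI : ∀ x : X, Complex.I • x = j • x) (hj : j ∈ imagUnits) (hV : AxiallySymmetric V)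
    (hVo : IsOpen V) (hVb : Bornology.IsBounded Vᶜ) {F : ℍ → X} (h : SliceFormula F V j)
    (hd : DifferentiableOn ℂ (fun z => F (slicePt j z)) (slice V j))
    (hlim : Tendsto (fun z : ℂ => F (slicePt j z)) (Bornology.cobounded ℂ) (𝓝 0)) :
    LeftSliceHyperholomorphicOnInfty (fun p => p.elim 0 F) V := by
  refine ⟨h.leftSliceHyperholomorphicOn hI hj hV hVo hd, ?_⟩
  have hW := isOpen_inv_union hVo hVb
  set G : ℍ → X := fun p => (invInfty p).elim 0 F with hG
  have hG0 : ∀ i, G (slicePt i 0) = 0 := fun i => by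
    rw [slicePt_zero, hG]; simp only [invInfty_zero]; rfl
  have hG1 : ∀ i ∈ imagUnits, ∀ z : ℂ, z ≠ 0 → G (slicePt i z) = F (slicePt i z⁻¹) := by
    intro i hi z hz
    rw [hG]
    simp only [invInfty_of_ne (slicePt_ne_zero hi hz), slicePt_inv hi]
    rfl
  refine SliceFormula.leftSliceHyperholomorphicOn (j := j) hI hj hV.inv hW ?_ ?_
  · intro z hz i hi
    rcases eq_or_ne z 0 with rfl | hz0
    · rw [evenPart, oddPart, star_zero, hG0, hG0]
      simp
    · have hs : (star z) ≠ 0 := star_ne_zero.2 hz0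
      have hm : z⁻¹ ∈ sliceBase V := fun k hk => by
        have := ((hz k hk).resolve_right (slicePt_ne_zero hk hz0)).2
        rwa [slicePt_inv hk] at this
      have := h _ hm i hi
      rw [hG1 i hi z hz0, this, evenPart, oddPart, evenPart, oddPart, hG1 j hj z hz0,
        hG1 j hj _ hs, star_inv₀]
  · have hcong : ∀ z : ℂ, z ≠ 0 →
        (fun w => G (slicePt j w)) =ᶠ[𝓝 z] fun w => F (slicePt j w⁻¹) := fun z hz => by
      filter_upwards [eventually_ne_nhds hz] with w hw using hG1 j hj w hw
    have hne : ∀ z ∈ slice ({p | p ≠ 0 ∧ p⁻¹ ∈ V} ∪ {0}) j, z ≠ 0 →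
        DifferentiableAt ℂ (fun w => G (slicePt j w)) z := by
      intro z hz hz0
      have hm : z⁻¹ ∈ slice V j := by
        have hz' : slicePt j z ∈ ({p | p ≠ 0 ∧ p⁻¹ ∈ V} ∪ {0} : Set ℍ) := hz
        have := (hz'.resolve_right (slicePt_ne_zero hj hz0)).2
        rwa [slicePt_inv hj] at this
      have h1 := hd.differentiableAt ((isOpen_slice hVo j).mem_nhds hm)
      exact (h1.comp z (differentiableAt_inv hz0)).congr_of_eventuallyEq (hcong z hz0)
    intro z hz
    rcases eq_or_ne z 0 with rfl | hz0
    · refine (Complex.analyticAt_of_differentiable_on_punctured_nhds_of_continuousAt ?_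
        ?_).differentiableAt.differentiableWithinAt
      · filter_upwards [self_mem_nhdsWithin,
          mem_nhdsWithin_of_mem_nhds ((isOpen_slice hW j).mem_nhds hz)] with w hw hw'
        exact hne w hw' hw
      · rw [continuousAt_iff_punctured_nhds, hG0]
        refine (hlim.comp tendsto_inv₀_nhdsNE_zero).congr' ?_
        filter_upwards [self_mem_nhdsWithin] with w hw
        exact (hG1 j hj w hw).symm
    · exact (hne z hz hz0).differentiableWithinAt

end Infinity

/-! ### Splittings and the Cauchy transform -/

section Splitting

variable {X : Type*} [NormedAddCommGroup X] [NormedSpace ℂ X] [CompleteSpace X] [Module ℍ X]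
  [IsScalarTower ℝ ℍ X] [NormSMulClass ℍ X]
variable {U : Set ℍ} {f : ℍ → X} {j : ℍ} {N : ℕ} {Γ : Fin N → PwC1ClosedCurve}

theorem slice_frontier_eq_trace (hUs : AxiallySymmetric U) (hj : j ∈ imagUnits)
    (hΓ : IsSide Γ (slice U j) 1) : slice (frontier U) j = trace Γ := by
  rw [hUs.slice_frontier hj, hΓ.frontier_eq]

theorem slice_closure_outer (hUs : AxiallySymmetric U) (hj : j ∈ imagUnits) :
    slice (closure (outer U)) j = closure (closure (slice U j))ᶜ := by
  rw [hUs.outer.slice_closure hj, hUs.slice_outer hj]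

omit [NormedSpace ℂ X] [CompleteSpace X] [Module ℍ X] [IsScalarTower ℝ ℍ X]
  [NormSMulClass ℍ X] in
theorem continuousOn_comp_slicePt {V : Set ℍ} (hf : ContinuousOn f V) :
    ContinuousOn (fun w => f (slicePt j w)) (slice V j) :=
  hf.comp (continuous_slicePt j).continuousOn fun _ hz => hz

omit [CompleteSpace X] [IsScalarTower ℝ ℍ X] in
theorem LeftSliceContinuousOn.continuousOn_trace (hUs : AxiallySymmetric U) (hj : j ∈ imagUnits)
    (hΓ : IsSide Γ (slice U j) 1) (hf : LeftSliceContinuousOn f (frontier U)) :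
    ContinuousOn (fun w => f (slicePt j w)) (trace Γ) := by
  rw [← slice_frontier_eq_trace hUs hj hΓ]
  exact continuousOn_comp_slicePt (hf.continuousOn hUs.frontier)

theorem notMem_trace_of_mem_slice_outer (hUs : AxiallySymmetric U) (hj : j ∈ imagUnits)
    (hΓ : IsSide Γ (slice U j) 1) {z : ℂ} (hz : z ∈ slice (outer U) j) : z ∉ trace Γ := by
  rw [hUs.slice_outer hj] at hz
  exact fun h => hz (hΓ.trace_subset_closure h)

omit [CompleteSpace X] [IsScalarTower ℝ ℍ X] [NormSMulClass ℍ X] in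
theorem cauchyTransform_eq_of_mem (hUs : AxiallySymmetric U) (hj : j ∈ imagUnits)
    (hΓ : IsSide Γ (slice U j) 1) (hc : ∀ (c : ℂ) (x : X), c • x = slicePt j c • x) {z : ℂ}
    (hz : z ∈ slice U j) :
    cauchyTransform j Γ f (slicePt j z) = cauchyIntegral Γ (fun w => f (slicePt j w)) z :=
  cauchyTransform_slicePt hj hc (hΓ.notMem_trace hz) (hΓ.notMem_trace (hUs.star_mem_slice hj hz))

omit [CompleteSpace X] [IsScalarTower ℝ ℍ X] [NormSMulClass ℍ X] in
theorem cauchyTransform_eq_of_mem_outer (hUs : AxiallySymmetric U) (hj : j ∈ imagUnits)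
    (hΓ : IsSide Γ (slice U j) 1) (hc : ∀ (c : ℂ) (x : X), c • x = slicePt j c • x) {z : ℂ}
    (hz : z ∈ slice (outer U) j) :
    cauchyTransform j Γ f (slicePt j z) = cauchyIntegral Γ (fun w => f (slicePt j w)) z :=
  cauchyTransform_slicePt hj hc (notMem_trace_of_mem_slice_outer hUs hj hΓ hz)
    (notMem_trace_of_mem_slice_outer hUs hj hΓ (hUs.outer.star_mem_slice hj hz))

/-- The Cauchy transform of a function that splits, by Cauchy's formulas for the two summands.
The formulas hold on `ℂ_j`, and extend by the representation formula. -/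
theorem IsSplitting.cauchyTransform_eqOn (hUo : IsOpen U) (hUb : Bornology.IsBounded U)
    (hUs : AxiallySymmetric U) (hj : j ∈ imagUnits) (hΓ : IsSide Γ (slice U j) 1)
    (hc : ∀ (c : ℂ) (x : X), c • x = slicePt j c • x) (hf : LeftSliceContinuousOn f (frontier U))
    {fp : ℍ → X} {fm : OnePoint ℍ → X} (h : IsSplitting f U fp fm) :
    EqOn (cauchyTransform j Γ f) (fun q => fp q + fm ∞) U ∧
      EqOn (cauchyTransform j Γ f) (fun q => fm ∞ + -fm q) (outer U) := by
  have hI : ∀ x : X, Complex.I • x = j • x := fun x => by rw [hc]; simp [slicePt]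
  have hUb' : Bornology.IsBounded (outer U)ᶜ := by
    rw [outer, compl_compl]; exact hUb.closure
  have hUo' : IsOpen (outer U) := isClosed_closure.isOpen_compl
  have hb := isBounded_slice hUb hj
  have hpc : ContinuousOn (fun w => fp (slicePt j w)) (closure (slice U j)) := by
    rw [← hUs.slice_closure hj]
    exact continuousOn_comp_slicePt (h.continuous_plus.continuousOn hUs.closure)
  have hmc : ContinuousOn (fun w => fm (slicePt j w : ℍ)) (closure (closure (slice U j))ᶜ) := by
    rw [← slice_closure_outer hUs hj]
    exact continuousOn_comp_slicePt (f := fun q : ℍ => fm q)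
      (h.continuous_minus.continuousOn hUs.outer.closure)
  have hpd := h.hyperholomorphic_plus.differentiableOn hI hj hUs hUo
  have hmd := h.hyperholomorphic_minus.1.differentiableOn hI hj hUs.outer hUo'
  rw [hUs.slice_outer hj] at hmd
  have hlim := h.hyperholomorphic_minus.tendsto_cobounded hI hj hUs.outer hUo' hUb'
  have htr := hΓ.trace_subset_closure
  have htr' : trace Γ ⊆ closure (closure (slice U j))ᶜ := by
    rw [hΓ.closure_exterior]; exact subset_union_right
  have hsum : ∀ z, z ∉ trace Γ → cauchyIntegral Γ (fun w => f (slicePt j w)) z =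
      cauchyIntegral Γ (fun w => fp (slicePt j w)) z +
      cauchyIntegral Γ (fun w => fm (slicePt j w : ℍ)) z := by
    intro z hz
    rw [← cauchyIntegral_add (hpc.mono htr) (hmc.mono htr') hz]
    refine cauchyIntegral_congr (fun w hw => ?_) z
    rw [← slice_frontier_eq_trace hUs hj hΓ] at hw
    exact h.eq_add _ hw
  have hg := hf.continuousOn_trace hUs hj hΓ
  constructor
  · refine (sliceFormula_cauchyTransform hj hc hUs hg fun z hz => hΓ.notMem_trace hz).eqOn
      (SliceFormula.add ?_ (SliceFormula.const _)) hj hUs fun z hz => ?_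
    · obtain ⟨f₀, f₁, hrep, -⟩ := h.hyperholomorphic_plus
      exact hrep.sliceFormula hj
    · rw [cauchyTransform_eq_of_mem hUs hj hΓ hc hz, hsum z (hΓ.notMem_trace hz),
        hΓ.cauchyIntegral_eq hb hpd hpc hz, hΓ.cauchyIntegral_exterior_of_mem hb hmd hmc hlim hz]
  · refine (sliceFormula_cauchyTransform hj hc hUs.outer hg fun z hz =>
      notMem_trace_of_mem_slice_outer hUs hj hΓ hz).eqOn
      (SliceFormula.add (SliceFormula.const _) (SliceFormula.neg ?_)) hj hUs.outer fun z hz => ?_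
    · obtain ⟨f₀, f₁, hrep, -⟩ := h.hyperholomorphic_minus.1
      exact hrep.sliceFormula hj
    · have hz' : z ∉ closure (slice U j) := by rwa [hUs.slice_outer hj] at hz
      rw [cauchyTransform_eq_of_mem_outer hUs hj hΓ hc hz,
        hsum z (notMem_trace_of_mem_slice_outer hUs hj hΓ hz),
        hΓ.cauchyIntegral_eq_zero hb hpd hpc hz',
        hΓ.cauchyIntegral_exterior_of_notMem hb hmd hmc hlim hz', zero_add, sub_eq_add_neg]

/-- The difference of the boundary values of a Cauchy integral, if they exist, is its density: at the smooth points of the contour by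
approach along the normal, and at the break points by continuity. -/
theorem IsSide.sub_eq_of_continuousOn {E : Type*} [NormedAddCommGroup E] [NormedSpace ℂ E]
    [CompleteSpace E] {D : Set ℂ} (h : IsSide Γ D 1) (hb : Bornology.IsBounded D)
    {g Gp Gm : ℂ → E} (hg : ContinuousOn g (trace Γ)) (hp : ContinuousOn Gp (closure D))
    (hm : ContinuousOn Gm (closure (closure D)ᶜ)) (hpe : EqOn (cauchyIntegral Γ g) Gp D)
    (hme : EqOn (cauchyIntegral Γ g) Gm (closure D)ᶜ) {w : ℂ} (hw : w ∈ trace Γ) :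
    g w = Gp w - Gm w := by
  have htr := h.trace_subset_closure
  have htr' : trace Γ ⊆ closure (closure D)ᶜ := by
    rw [h.closure_exterior]; exact subset_union_right
  have hZ : IsClosed (trace Γ ∩ (fun w => g w - (Gp w - Gm w)) ⁻¹' {0}) :=
    (hg.sub ((hp.mono htr).sub (hm.mono htr'))).preimage_isClosed_of_isClosed
      (isCompact_trace Γ).isClosed isClosed_singleton
  have key : trace Γ ⊆ trace Γ ∩ (fun w => g w - (Gp w - Gm w)) ⁻¹' {0} := by
    refine trace_subset_of_smooth hZ fun k i hi x hx => ?_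
    have hxt : (Γ k).γ x ∈ trace Γ :=
      image_subset_trace Γ k
        (mem_image_of_mem _ (Ioo_subset_Icc_self ((Γ k).Ioo_piece_subset hi hx)))
    refine ⟨hxt, sub_eq_zero.2 ?_⟩
    have hjump := h.tendsto_jump hb hg k hi hx
    have hlr := h.left_right k i hi x hx
    simp only [Complex.ofReal_one, one_mul] at hlr
    have ha : Tendsto (fun ε : ℝ => (Γ k).γ x + ε * (Complex.I * deriv (Γ k).γ x)) (𝓝[>] 0)
        (𝓝 ((Γ k).γ x)) := by
      have : Continuous fun ε : ℝ => (Γ k).γ x + ε * (Complex.I * deriv (Γ k).γ x) := by fun_prop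
      simpa using (this.tendsto 0).mono_left nhdsWithin_le_nhds
    have hb' : Tendsto (fun ε : ℝ => (Γ k).γ x - ε * (Complex.I * deriv (Γ k).γ x)) (𝓝[>] 0)
        (𝓝 ((Γ k).γ x)) := by
      have : Continuous fun ε : ℝ => (Γ k).γ x - ε * (Complex.I * deriv (Γ k).γ x) := by fun_prop
      simpa using (this.tendsto 0).mono_left nhdsWithin_le_nhds
    have h1 := (hp _ (htr hxt)).tendsto.comp (tendsto_nhdsWithin_iff.2
      ⟨ha, hlr.mono fun ε hε => subset_closure hε.1⟩)
    have h2 := (hm _ (htr' hxt)).tendsto.comp (tendsto_nhdsWithin_iff.2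
      ⟨hb', hlr.mono fun ε hε => subset_closure hε.2⟩)
    refine tendsto_nhds_unique (hjump.congr' ?_) (h1.sub h2)
    filter_upwards [hlr] with ε hε
    simp only [Function.comp_apply]
    rw [hpe hε.1, hme hε.2]
  exact sub_eq_zero.1 (key hw).2

/-- The continuous extensions of the Cauchy transform form a splitting. -/
theorem isSplitting_of_isContinuousExtension (hUo : IsOpen U) (hUb : Bornology.IsBounded U)
    (hUs : AxiallySymmetric U) (hj : j ∈ imagUnits) (hΓ : IsSide Γ (slice U j) 1)
    (hc : ∀ (c : ℂ) (x : X), c • x = slicePt j c • x) (hf : LeftSliceContinuousOn f (frontier U))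
    {Fp Fm : ℍ → X} (hp : IsContinuousExtension (cauchyTransform j Γ f) U Fp)
    (hm : IsContinuousExtension (cauchyTransform j Γ f) (outer U) Fm) :
    IsSplitting f U Fp (fun p => p.elim 0 fun q => -Fm q) := by
  have hI : ∀ x : X, Complex.I • x = j • x := fun x => by rw [hc]; simp [slicePt]
  have hUb' : Bornology.IsBounded (outer U)ᶜ := by
    rw [outer, compl_compl]; exact hUb.closure
  have hUo' : IsOpen (outer U) := isClosed_closure.isOpen_compl
  have hb := isBounded_slice hUb hj
  have hg := hf.continuousOn_trace hUs hj hΓ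
  have hpS : SliceFormula Fp U j := (sliceFormula_cauchyTransform hj hc hUs hg
    fun z hz => hΓ.notMem_trace hz).congr hj hp.2
  have hmS : SliceFormula (fun q => -Fm q) (outer U) j := SliceFormula.neg
    ((sliceFormula_cauchyTransform hj hc hUs.outer hg fun z hz =>
      notMem_trace_of_mem_slice_outer hUs hj hΓ hz).congr hj hm.2)
  have hpe : EqOn (cauchyIntegral Γ fun w => f (slicePt j w)) (fun z => Fp (slicePt j z))
      (slice U j) := fun z hz => by
    rw [← cauchyTransform_eq_of_mem hUs hj hΓ hc hz]; exact (hp.2 hz).symm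
  have hme : EqOn (cauchyIntegral Γ fun w => f (slicePt j w)) (fun z => Fm (slicePt j z))
      (slice (outer U) j) := fun z hz => by
    rw [← cauchyTransform_eq_of_mem_outer hUs hj hΓ hc hz]; exact (hm.2 hz).symm
  have hpd : DifferentiableOn ℂ (fun z => Fp (slicePt j z)) (slice U j) :=
    DifferentiableOn.congr (fun z hz => (differentiableAt_cauchyIntegral hg
      (hΓ.notMem_trace hz)).differentiableWithinAt) fun z hz => (hpe hz).symm
  have hmd : DifferentiableOn ℂ (fun z => -Fm (slicePt j z)) (slice (outer U) j) :=
    DifferentiableOn.neg (DifferentiableOn.congr (fun z hz => (differentiableAt_cauchyIntegral hg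
      (notMem_trace_of_mem_slice_outer hUs hj hΓ hz)).differentiableWithinAt)
      fun z hz => (hme hz).symm)
  have hlim : Tendsto (fun z => -Fm (slicePt j z)) (Bornology.cobounded ℂ) (𝓝 0) := by
    rw [← neg_zero]
    refine ((tendsto_cauchyIntegral_cobounded hg).congr' ?_).neg
    have : slice (outer U) j ∈ Bornology.cobounded ℂ := by
      rw [hUs.slice_outer hj]; exact Bornology.isBounded_def.1 hb.closure
    filter_upwards [this] with z hz using hme hz
  have hpC : LeftSliceContinuousOn Fp (closure U) :=
    hpS.leftSliceContinuousOn_closure hj hUs hp.1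
  have hmC : LeftSliceContinuousOn (fun q => -Fm q) (closure (outer U)) :=
    hmS.leftSliceContinuousOn_closure hj hUs.outer hm.1.neg
  refine ⟨hpC, hpS.leftSliceHyperholomorphicOn hI hj hUs hUo hpd, hmC,
    hmS.leftSliceHyperholomorphicOnInfty hI hj hUs.outer hUo' hUb' hmd hlim, ?_⟩
  have hfr : frontier U ⊆ closure (outer U) := by
    intro q hq
    have hz := hUs.frontier.halfPt_mem hq
    have hz' : halfPt q ∈ slice (closure (outer U)) j := by
      rw [slice_closure_outer hUs hj, hΓ.closure_exterior, ← slice_frontier_eq_trace hUs hj hΓ]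
      exact Or.inr (hz j hj)
    have := hUs.outer.closure.slicePt_mem hj (imUnit_mem q) hz'
    rwa [slicePt_imUnit] at this
  obtain ⟨_, _, hr, -⟩ := hf
  obtain ⟨_, _, hpr, -⟩ := hpC
  obtain ⟨_, _, hmr, -⟩ := hmC
  refine (hr.sliceFormula hj).eqOn (((hpr.sliceFormula hj).mono frontier_subset_closure).add
    ((hmr.sliceFormula hj).mono hfr)) hj hUs.frontier fun z hz => ?_
  rw [slice_frontier_eq_trace hUs hj hΓ] at hz
  rw [hUs.slice_outer hj] at hme
  change f (slicePt j z) = Fp (slicePt j z) + -Fm (slicePt j z)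
  rw [← sub_eq_add_neg]
  refine hΓ.sub_eq_of_continuousOn hb (Gp := fun z => Fp (slicePt j z))
    (Gm := fun z => Fm (slicePt j z)) hg ?_ ?_ hpe hme hz
  · rw [← hUs.slice_closure hj]
    exact continuousOn_comp_slicePt hp.1
  · rw [← slice_closure_outer hUs hj]
    exact continuousOn_comp_slicePt hm.1

end Splitting

/-! ### The complex structure given by an imaginary unit -/

/-- The complex structure of a quaternionic Banach space given by an imaginary unit. -/
@[reducible] noncomputable def sliceNormedSpace (X : Type*) [NormedAddCommGroup X] [Module ℍ X]
    [NormSMulClass ℍ X] {j : ℍ} (hj : j ∈ imagUnits) : NormedSpace ℂ X :=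
  { Module.compHom X (sliceHom hj).toRingHom with
    norm_smul_le := fun c x => by
      change ‖sliceHom hj c • x‖ ≤ _
      rw [norm_smul, sliceHom_apply, norm_slicePt hj] }

/-- The complex structure given by an imaginary unit extends the given real structure. -/
theorem complexToReal_sliceNormedSpace (X : Type*) [NormedAddCommGroup X] [hR : NormedSpace ℝ X]
    [Module ℍ X] [IsScalarTower ℝ ℍ X] [NormSMulClass ℍ X] {j : ℍ} (hj : j ∈ imagUnits) :
    @NormedSpace.complexToReal X _ (sliceNormedSpace X hj) = hR := by
  have key : ∀ (r : ℝ) (x : X), sliceHom hj (r : ℂ) • x = r • x := fun r x => by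
    rw [sliceHom_apply, ← smul_one_smul ℍ r x]
    congr 1
    simp [slicePt, ← Quaternion.coe_mul_eq_smul]
  -- a normed space structure is determined by the underlying module
  have h1 : (@NormedSpace.complexToReal X _ (sliceNormedSpace X hj)).toModule = hR.toModule :=
    Module.ext' _ _ key
  cases hR
  cases h1
  rfl

end SliceHyper

theorem mainTheorem1 {X : Type*} [NormedAddCommGroup X] [NormedSpace ℝ X] [CompleteSpace X]
    [Module ℍ X] [IsScalarTower ℝ ℍ X] [NormSMulClass ℍ X]
    (U : Set ℍ) (hUo : IsOpen U) (hUb : Bornology.IsBounded U)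
    (hUs : SliceHyper.AxiallySymmetric U)
    (j : ℍ) (hj : j ∈ SliceHyper.imagUnits)
    {N : ℕ} (Γ : Fin N → SliceHyper.PwC1ClosedCurve)
    (hΓ : SliceHyper.IsOrientedBoundary Γ (SliceHyper.slice U j))
    (f : ℍ → X) (hf : SliceHyper.LeftSliceContinuousOn f (frontier U)) :
    (SliceHyper.Splits f U ↔
      (∃ Fp : ℍ → X,
        SliceHyper.IsContinuousExtension (SliceHyper.cauchyTransform j Γ f) U Fp) ∧
      (∃ Fm : ℍ → X,
        SliceHyper.IsContinuousExtension (SliceHyper.cauchyTransform j Γ f)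
          (SliceHyper.outer U) Fm)) ∧
    (∀ Fp Fm : ℍ → X,
      SliceHyper.IsContinuousExtension (SliceHyper.cauchyTransform j Γ f) U Fp →
      SliceHyper.IsContinuousExtension (SliceHyper.cauchyTransform j Γ f)
        (SliceHyper.outer U) Fm →
      SliceHyper.IsSplitting f U Fp (fun p => p.elim 0 fun q => -Fm q) ∧
      ∀ (gp : ℍ → X) (gm : OnePoint ℍ → X), SliceHyper.IsSplitting f U gp gm → gm ∞ = 0 →
        Set.EqOn gp Fp (closure U) ∧
        ∀ p ∈ closure (SliceHyper.outer U), gm p = -Fm p) := by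
  rename_i hR _ _ _ _
  -- `X` becomes a complex Banach space on which `i` acts as `j`; the given real structure is
  -- replaced by the one that underlies it
  obtain ⟨hC, rfl, hc⟩ : ∃ hC : NormedSpace ℂ X, @NormedSpace.complexToReal X _ hC = hR ∧
      ∀ (c : ℂ) (x : X), c • x = SliceHyper.slicePt j c • x :=
    ⟨SliceHyper.sliceNormedSpace X hj, SliceHyper.complexToReal_sliceNormedSpace X hj,
      fun c x => by rw [← SliceHyper.sliceHom_apply hj]; rfl⟩
  have hside := hΓ.isSide (SliceHyper.isOpen_slice hUo j)
  refine ⟨⟨?_, ?_⟩, fun Fp Fm hp hm => ⟨?_, fun gp gm h h0 => ?_⟩⟩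
  · rintro ⟨fp, fm, h⟩
    have heq := h.cauchyTransform_eqOn hUo hUb hUs hj hside hc hf
    exact ⟨⟨_, (h.continuous_plus.continuousOn hUs.closure).add continuousOn_const, heq.1.symm⟩,
      ⟨_, continuousOn_const.add (h.continuous_minus.continuousOn hUs.outer.closure).neg,
        heq.2.symm⟩⟩
  · rintro ⟨⟨Fp, hp⟩, ⟨Fm, hm⟩⟩
    exact ⟨_, _, SliceHyper.isSplitting_of_isContinuousExtension hUo hUb hUs hj hside hc hf hp hm⟩
  · exact SliceHyper.isSplitting_of_isContinuousExtension hUo hUb hUs hj hside hc hf hp hm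
  · have heq := h.cauchyTransform_eqOn hUo hUb hUs hj hside hc hf
    rw [h0] at heq
    constructor
    · refine Set.EqOn.of_subset_closure (fun q hq => ?_)
        (h.continuous_plus.continuousOn hUs.closure) hp.1 subset_closure subset_rfl
      rw [hp.2 hq, heq.1 hq]
      exact (add_zero _).symm
    · refine Set.EqOn.of_subset_closure (s := SliceHyper.outer U) (fun q hq => ?_)
        (h.continuous_minus.continuousOn hUs.outer.closure) hm.1.neg subset_closure subset_rfl
      rw [hm.2 hq, heq.2 hq]
      simp only [zero_add, neg_neg]
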